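/- Setting. Let $p$ be a prime, $q$ a power of $p$, $n=j+k$ with integers $j,k\ge 1$, $\gcd(j,k)=1$ and $p\nmid j$; let $K=\overline{\mathbb F}_{q^n}$ and $\alpha=j^{-1}\in\mathbb F_p$. Put $\mathrm{Tr}_a(T)=T+T^q+\cdots+T^{q^{a-1}}$. Let $x_1$ be transcendental over $K$, and let $x_2,x_3,\dots$ (in some extension field) satisfy $$\mathrm{Tr}_j\!\left(\frac{x_{i+1}}{x_i^{q^k}}\right)+\mathrm{Tr}_k\!\left(\frac{x_{i+1}^{q^j}}{x_i}\right)=1\qquad(i\ge 1).$$ Put $F_i=K(x_1,\dots,x_i)$. For each $s\ge1$ there is a unique element $u_s\in K(x_s,x_{s+1})$ with $$\mathrm{Tr}_k(u_s)+\alpha=\frac{x_{s+1}}{x_s^{q^k}},\qquad \mathrm{Tr}_j(u_s)=-\frac{x_{s+1}^{q^j}}{x_s};$$ put $E_s=K(u_1,\dots,u_s)$ and $z=-x_2^{q^n-1}$. (A) Let $i\ge1$ and let $\widetilde P$ be a place of $F_{i+1}$ that is a zero of $x_1$ and a pole of $x_2$. Let hats denote completions at the restrictions of $\widetilde P$ (viewed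 inside $\widehat F_{i+1}$), and put $H=\widehat{K(z)}$, $E=\widehat{K(u_1)}$. Then there is $t\in E$ with $t^{q^j-1}=z^{-1}$, and for each such $t$: 1. $H(t)/H$ is cyclic of degree $q^j-1$, with ramification index $q^j-1$ and different exponent $q^j-2$. 2. $E/H(t)$ is Galois of degree $q^{k-1}$, with ramification index $e=q^{k-1}$ and different exponent $2(e-1)=2(q^{k-1}-1)$; in particular it is weakly ramified. 3. Define $G_1=H(t)$ and $G_{s+1}=G_s(u_{s+1})$ for $1\le s<i$. Then $G_s\subseteq\widehat E_s$ for $1\le s\le i$, and for $1\le s<i$ the extension $G_{s+1}/G_s$ is Galois of degree $q^j$, with ramification index $e=q^j$ and different exponent $2(e-1)=2(q^j-1)$; in particular it is weakly ramified. Here a finite separable extension $L'/L$ of complete discretely valued fields is called weakly ramified if there is a chain $L=L_0\subseteq\cdots\subseteq L_m=L'$ in which all $L_{r+1}/L_r$ are Galois $p$-extensions, and the different exponent satisfies $d(L'|L)=2(e(L'|L)-1)$. (B) (Main Claim.) The place $[x_1=0]$ of $F_1=K(x_1)$ is $b_0$-bounded in the tower $F_1\subseteq F_2\subseteq\cdots$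 with $b_0=\frac{q^n-1}{q^k-1}+1$; that is, for each $i\ge1$ and each place $P'$ of $F_i$ above $[x_1=0]$, $$d(P'|[x_1=0])\le\left(\frac{q^n-1}{q^k-1}+1\right)\bigl(e(P'|[x_1=0])-1\bigr).$$ -/

import Mathlib

namespace GarciaTower

noncomputable section

/-! ### Valuation rings, ramification index and different exponent -/

section Ramification

variable {F F' : Type*} [Field F] [Field F']

/-- A place of a function field `F / K`, given by its valuation ring `K ⊆ O ⊊ F`. -/
def IsPlace (K : Type*) [Field K] [Algebra K F] (O : ValuationSubring F) : Prop :=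
  (∀ c : K, algebraMap K F c ∈ O) ∧ O ≠ ⊤

/-- `f` vanishes at the place with valuation ring `O`. -/
def IsZeroAt (O : ValuationSubring F) (f : F) : Prop := O.valuation f < 1

/-- `f` has a pole at the place with valuation ring `O`. -/
def IsPoleAt (O : ValuationSubring F) (f : F) : Prop := 1 < O.valuation f

/-- For a discrete valuation ring `O` of the field `F`: the element `f` has normalized
(that is, `ℤ`-valued and surjective) valuation `n`; it is `τ ^ n` times a unit, where `τ` is a
prime element. -/
def HasOrder (O : ValuationSubring F) (f : F) (n : ℤ) : Prop :=
  ∃ τ : O, Irreducible τ ∧ O.valuation f = O.valuation (τ : F) ^ n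

variable (F) in
/-- `e(P' | P) = e`, where `O'` is the valuation ring of the place `P'` of `F'` and `P` is the
restriction of `P'` to `F`: a prime element of `P` has order `e` at `P'`. -/
def HasRamificationIndex [Algebra F F'] (O' : ValuationSubring F') (e : ℕ) : Prop :=
  ∃ τ : O'.comap (algebraMap F F'), Irreducible τ ∧ HasOrder O' (algebraMap F F' (τ : F)) e

variable (F F') in
/-- The complementary module of the extension `F' / F` over the valuation ring `O` of `F`:
all `z` with `Tr (z * b) ∈ O` for each `b` in the integral closure of `O` in `F'`. -/
def complementaryModule [Algebra F F'] (O : ValuationSubring F) :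
    Submodule (integralClosure O F') F' :=
  Submodule.traceDual O F (1 : Submodule (integralClosure O F') F')

variable (F) in
/-- `d(P' | P) = d`, where `O'` is the valuation ring of the place `P'` of `F'` and `P` is the
restriction of `P'` to `F`: the least order at `P'` of the elements of the complementary module
over `P` is `-d`. -/
def HasDifferentExponent [Algebra F F'] (O' : ValuationSubring F') (d : ℕ) : Prop :=
  (∃ z ∈ complementaryModule F F' (O'.comap (algebraMap F F')), HasOrder O' z (-(d : ℤ))) ∧
  ∀ z ∈ complementaryModule F F' (O'.comap (algebraMap F F')),
    ∀ n : ℤ, HasOrder O' z n → -(d : ℤ) ≤ n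

/-- The place of `F` with valuation ring `O` is `b`-bounded in the extension `F'`:
`d(P' | P) ≤ b * (e(P' | P) - 1)` for every place `P'` of `F'` above it. -/
def IsBounded (O : ValuationSubring F) (F' : Type*) [Field F'] [Algebra F F'] (b : ℝ) : Prop :=
  ∀ O' : ValuationSubring F', O'.comap (algebraMap F F') = O →
    ∃ e d : ℕ, HasRamificationIndex F O' e ∧ HasDifferentExponent F O' d ∧
      (d : ℝ) ≤ b * ((e : ℝ) - 1)

end Ramification

/-! ### Extensions of subfields of a valued field -/

section Steps

variable {L : Type*} [Field L]

/-- The subfield `A(a)`. -/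
def adjoinElement (A : Subfield L) (a : L) : Subfield L :=
  (IntermediateField.adjoin A {a}).toSubfield

/-- For subfields `A ⊆ B` of `L`, the valuation ring of `L` being `O`: the extension `B / A` has
degree `N`, ramification index `e` and different exponent `d` (with respect to the restricted
valuations). -/
def HasInvariants (O : ValuationSubring L) (A B : Subfield L) (N e d : ℕ) : Prop :=
  ∃ h : A ≤ B,
    Module.finrank A (Subfield.extendScalars h) = N ∧
    HasRamificationIndex A (O.comap (algebraMap (Subfield.extendScalars h) L)) e ∧
    HasDifferentExponent A (O.comap (algebraMap (Subfield.extendScalars h) L)) d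

/-- `A ⊆ B` and `B / A` is a finite Galois extension. -/
def IsFiniteGalois (A B : Subfield L) : Prop :=
  ∃ h : A ≤ B, FiniteDimensional A (Subfield.extendScalars h) ∧
    IsGalois A (Subfield.extendScalars h)

/-- `A ⊆ B` and `B / A` is a finite Galois extension with cyclic Galois group. -/
def IsFiniteCyclic (A B : Subfield L) : Prop :=
  ∃ h : A ≤ B, FiniteDimensional A (Subfield.extendScalars h) ∧
    IsGalois A (Subfield.extendScalars h) ∧
    IsCyclic (Subfield.extendScalars h ≃ₐ[A] Subfield.extendScalars h)

/-- `A ⊆ B` and `B / A` is a Galois `p`-extension: finite Galois of `p`-power degree. -/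
def IsGaloisPExtension (p : ℕ) (A B : Subfield L) : Prop :=
  ∃ h : A ≤ B, FiniteDimensional A (Subfield.extendScalars h) ∧
    IsGalois A (Subfield.extendScalars h) ∧
    ∃ r : ℕ, Module.finrank A (Subfield.extendScalars h) = p ^ r

/-- The finite separable extension `B / A` is weakly ramified: it is a chain of Galois
`p`-extensions and its different exponent is `2 * (e - 1)`. -/
def IsWeaklyRamified (p : ℕ) (O : ValuationSubring L) (A B : Subfield L) : Prop :=
  ∃ h : A ≤ B, FiniteDimensional A (Subfield.extendScalars h) ∧
    Algebra.IsSeparable A (Subfield.extendScalars h) ∧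
    (∃ (m : ℕ) (C : ℕ → Subfield L), C 0 = A ∧ C m = B ∧
      ∀ r < m, IsGaloisPExtension p (C r) (C (r + 1))) ∧
    ∃ e d : ℕ, HasRamificationIndex A (O.comap (algebraMap (Subfield.extendScalars h) L)) e ∧
      HasDifferentExponent A (O.comap (algebraMap (Subfield.extendScalars h) L)) d ∧
      (d : ℤ) = 2 * ((e : ℤ) - 1)

/-- The fields `G₁ = H(t)` and `G_{s+1} = G_s(u_{s+1})` for `s ≥ 1` (the value at `0` is not
used). -/
def gField (H : Subfield L) (t : L) (u : ℕ → L) : ℕ → Subfield L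
  | 0 => adjoinElement H t
  | 1 => adjoinElement H t
  | s + 2 => adjoinElement (gField H t u (s + 1)) (u (s + 2))

end Steps

/-! ### Completions -/

section Completion

variable {F : Type*} [Field F]

/-- The completion of `F` at the place with valuation ring `O`. -/
abbrev Compl (O : ValuationSubring F) : Type _ := O.valuation.Completion

/-- The embedding of `F` into its completion. -/
def toCompl (O : ValuationSubring F) : F →+* Compl O :=
  (UniformSpace.Completion.coeRingHom (α := WithVal O.valuation)).comp
    (WithVal.equiv O.valuation).symm.toRingHom

/-- The valuation ring of the completion. -/
def complRing (O : ValuationSubring F) : ValuationSubring (Compl O) :=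
  (Valued.v : Valuation (Compl O) O.ValueGroup).valuationSubring

/-- The completion of the subfield `A` of `F` at the restriction of the place, as a subfield of the
completion of `F`: the topological closure of `A`. -/
def hat {K : Type*} [Field K] [Algebra K F] (O : ValuationSubring F) (A : IntermediateField K F) :
    Subfield (Compl O) :=
  (A.toSubfield.map (toCompl O)).topologicalClosure

end Completion

/-! ### The tower -/

section Tower

/-- `Tr_a(T) = T + T ^ q + ⋯ + T ^ (q ^ (a - 1))`. -/
def Tr (q a : ℕ) {R : Type*} [Semiring R] (T : R) : R := ∑ r ∈ Finset.range a, T ^ q ^ r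

variable (K : Type*) [Field K] {Ω : Type*} [Field Ω] [Algebra K Ω]

/-- The elements `x₁, x₂, …` (the value `x 0` is not used) generate the tower: `x₁` is
transcendental over `K`, and `x_i, x_{i+1}` satisfy the recursive equation. -/
def GeneratesTower (q j k : ℕ) (x : ℕ → Ω) : Prop :=
  Transcendental K (x 1) ∧
  ∀ i ≥ 1, Tr q j (x (i + 1) / x i ^ q ^ k) + Tr q k (x (i + 1) ^ q ^ j / x i) = 1

/-- The field `F_i = K(x₁, …, x_i)`. -/
def towerField (x : ℕ → Ω) (i : ℕ) : IntermediateField K Ω :=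
  IntermediateField.adjoin K (x '' Set.Icc 1 i)

/-- The element `x_s` of `F_i`, for `1 ≤ s ≤ i`. -/
def towerElement (x : ℕ → Ω) (i s : ℕ) (hs : 1 ≤ s ∧ s ≤ i) : towerField K x i :=
  ⟨x s, IntermediateField.subset_adjoin K _ ⟨s, hs, rfl⟩⟩

theorem towerField_mono (x : ℕ → Ω) {i i' : ℕ} (h : i ≤ i') :
    towerField K x i ≤ towerField K x i' :=
  IntermediateField.adjoin.mono K _ _ (Set.image_mono (Set.Icc_subset_Icc_right h))

/-- The element `v` of `K(x, y)` satisfies `Tr_k(v) + α = y / x ^ (q ^ k)` and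
`Tr_j(v) = - y ^ (q ^ j) / x`, where `α = j⁻¹`. -/
def IsUElement (q j k : ℕ) (x y v : Ω) : Prop :=
  v ∈ IntermediateField.adjoin K {x, y} ∧
  Tr q k v + (j : Ω)⁻¹ = y / x ^ q ^ k ∧ Tr q j v = -(y ^ q ^ j / x)

end Tower

end

end GarciaTower

/-! Let x, x' be consecutive generators, u the element attached to them, X = x'/x^(q^k), Z =
-x'^(q^j)/x, z = -x^(q^n-1) and z' = -x'^(q^n-1). Then X = Tr_k(u) + α, Z = Tr_j(u), X^(q^j) - X =
Z^(q^k) - Z, X^(q^j) z = Z and z' X = Z^(q^k) (`TowerRelation.isTowerStep`). These relations are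
invariant under exchanging j with k, X with Z and z with 1/z' (`IsTowerStep.symm`). Over a zero of
x, either x' vanishes and u is integral, or both x' and u have poles; over a pole of x, x' has a
pole, u is integral and Z is a unit (`IsTraceSystem.of_zero`, `IsTraceSystem.of_pole`).

Everything local happens inside the completion L = K((ϖ)) at a place. As K is algebraically closed,
the complete subfields that occur are of the form K((π)); `IsLaurent` records exactly what is needed
of this. The wild steps are generated by y with P(y) = s, where P is an additive polynomial with
constant roots and s is the inverse of a uniformizer. Where u has a pole and t^(q^j-1) = 1/z', the
element X equals c/t up to an integral error; removing from u an integral preimage of that error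
under Tr_k leaves such a step with P = Tr_k (`pole_step`). Beyond the pole Z is a unit with residue
c, and X/t solves T^(q^j) - T = c/t up to an integral error; this gives the steps of degree q^j
(`unit_step`).

Differents are computed with the derivation D = d/dϖ of L: the different exponent is the difference
of the orders of D at uniformizers below and above (`val_derivative_mul_deriv`). An equation y^p - y
= s gives D y = -D s, so along Artin–Schreier steps the order of D(1/π) does not change
(`asChain_invariants`), and this is the equality d = 2(e-1). Every additive step decomposes into
Artin–Schreier steps (`additive_chain`). Part (A) is the combination of these facts with a Kummer
step.

For the bound, if all generators vanish at the place, each u is a simple root over K((x_1)) and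
nothing ramifies. Otherwise let x_(r+1) be the first pole. Starting from K((1/u_r)), the later u_s
are reached by the steps above and the earlier ones by their mirror images under the symmetry. Two
Artin–Schreier steps over one field can be completed to a diamond (`asStep_diamond`), so the
Church–Rosser theorem yields a field M that contains all u_s and is reached by Artin–Schreier steps
from a field with uniformizer t, t^(q^k-1) = -x_1^(q^n-1). Adjoining x_1 to M is tame and reaches a
uniformizer of L. Hence d can be computed exactly; the bound exceeds it by N - (q^n-1)/(q^k-1),
where N is the ramification index of L over M, and this is nonnegative (`different_bound`). -/

namespace GarciaTower

noncomputable section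

/-! ### Subfields of a valued field whose elements have expansions in a uniformizer -/

section Local

open Polynomial

variable {L Γ K : Type*} [Field L] [LinearOrderedCommGroupWithZero Γ] [Field K]

/-- The elements of the subfield `A` can be approximated by monomials `κ c * π ^ m`. -/
structure HasExpansions (v : Valuation L Γ) (κ : K →+* L) (A : Subfield L) (π : L) : Prop where
  val_const : ∀ c, c ≠ 0 → v (κ c) = 1
  const : ∀ c, κ c ∈ A
  mem : π ∈ A
  ne_zero : π ≠ 0
  lt_one : v π < 1
  approx : ∀ a ∈ A, a ≠ 0 → ∃ (m : ℤ) (c : K), v (a - κ c * π ^ m) < v a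

/-- A complete subfield whose elements have expansions in the uniformizer `π`. -/
structure IsLaurent (v : Valuation L Γ) (κ : K →+* L) (A : Subfield L) (π : L) : Prop
    extends HasExpansions v κ A π where
  complete : ∀ f : ℕ → L, (∀ n, f n ∈ A) → (∀ n, v (f (n + 1) - f n) ≤ v π ^ n) →
    ∃ a ∈ A, ∀ n, v (a - f n) ≤ v π ^ n

variable {v : Valuation L Γ} {κ : K →+* L} {A B : Subfield L} {π : L}

theorem val_eq_of_sub_lt {x y : L} (h : v (x - y) < v x) : v y = v x := by
  have := Valuation.map_sub_eq_of_lt_right v h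
  rw [← this, Valuation.map_sub_swap]; congr 1; ring

theorem val_eq_of_sub_lt' {x y : L} (h : v (x - y) < v y) : v x = v y := by
  rw [Valuation.map_sub_swap] at h
  exact val_eq_of_sub_lt h

namespace HasExpansions

variable (h : HasExpansions v κ A π)
include h

theorem pos : 0 < v π := (Valuation.pos_iff v).2 h.ne_zero

theorem val_const_le (c : K) : v (κ c) ≤ 1 := by
  by_cases hc : c = 0
  · simp [hc]
  · exact (h.val_const c hc).le

theorem eq_zero_of_val_lt {c : K} (hc : v (κ c) < 1) : c = 0 := by
  by_contra h0
  exact hc.ne (h.val_const c h0)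

theorem exists_monomial {a : L} (ha : a ∈ A) (h0 : a ≠ 0) :
    ∃ (m : ℤ) (c : K), c ≠ 0 ∧ v (a - κ c * π ^ m) < v a ∧ v a = v π ^ m := by
  obtain ⟨m, c, hmc⟩ := h.approx a ha h0
  have hc : c ≠ 0 := by
    rintro rfl
    simp at hmc
  refine ⟨m, c, hc, hmc, ?_⟩
  rw [← val_eq_of_sub_lt hmc, map_mul, h.val_const c hc, one_mul, map_zpow₀]

theorem zpow_lt_iff {m n : ℤ} : v π ^ m < v π ^ n ↔ n < m :=
  zpow_lt_zpow_iff_right_of_lt_one₀ h.pos h.lt_one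

theorem zpow_le_iff {m n : ℤ} : v π ^ m ≤ v π ^ n ↔ n ≤ m :=
  zpow_le_zpow_iff_right_of_lt_one₀ h.pos h.lt_one

theorem zpow_inj {m n : ℤ} : v π ^ m = v π ^ n ↔ m = n := by
  rw [le_antisymm_iff, h.zpow_le_iff, h.zpow_le_iff]; omega

theorem exists_val {a : L} (ha : a ∈ A) (h0 : a ≠ 0) : ∃ m : ℤ, v a = v π ^ m := by
  obtain ⟨m, c, _, _, hm⟩ := h.exists_monomial ha h0
  exact ⟨m, hm⟩

theorem val_le_of_lt_one {a : L} (ha : a ∈ A) (h1 : v a < 1) : v a ≤ v π := by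
  by_cases h0 : a = 0
  · simp [h0]
  obtain ⟨m, hm⟩ := h.exists_val ha h0
  rw [hm] at h1 ⊢
  rw [← zpow_zero (v π), h.zpow_lt_iff] at h1
  conv_rhs => rw [← zpow_one (v π)]
  rw [h.zpow_le_iff]; omega

theorem exists_residue {a : L} (ha : a ∈ A) (h1 : v a ≤ 1) : ∃ c : K, v (a - κ c) < 1 := by
  rcases h1.lt_or_eq with h1 | h1
  · exact ⟨0, by simpa using h1⟩
  have h0 : a ≠ 0 := by rintro rfl; simp at h1
  obtain ⟨m, c, hc, hlt, hm⟩ := h.exists_monomial ha h0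
  have : m = 0 := by rw [← h.zpow_inj, ← hm, h1, zpow_zero]
  subst this
  exact ⟨c, by simpa [h1] using hlt⟩

theorem eq_zero_of_forall_le {a : L} (ha : a ∈ A) (hn : ∀ n : ℕ, v a ≤ v π ^ n) : a = 0 := by
  by_contra h0
  obtain ⟨m, hm⟩ := h.exists_val ha h0
  have := hn (m.toNat + 1)
  rw [hm, ← zpow_natCast, h.zpow_le_iff] at this
  omega

theorem exists_pow_lt {a : L} (ha : a ∈ A) (h0 : a ≠ 0) : ∃ n : ℕ, v π ^ n < v a := by
  by_contra! hn
  exact h0 (h.eq_zero_of_forall_le ha hn)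

theorem of_val_eq {π' : L} (hm : π' ∈ A) (hv : v π' = v π) : HasExpansions v κ A π' where
  val_const := h.val_const
  const := h.const
  mem := hm
  ne_zero := by
    rw [← Valuation.ne_zero_iff v, hv]; exact h.pos.ne'
  lt_one := hv ▸ h.lt_one
  approx a ha h0 := by
    have h0' : π' ≠ 0 := by rw [← Valuation.ne_zero_iff v, hv]; exact h.pos.ne'
    obtain ⟨m, hm'⟩ := h.exists_val ha h0
    have h1 : v (a / π' ^ m) = 1 := by
      rw [map_div₀, map_zpow₀, hv, hm', div_self]
      exact zpow_ne_zero _ h.pos.ne'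
    obtain ⟨c, hc⟩ := h.exists_residue (A.div_mem ha (A.zpow_mem hm m)) h1.le
    refine ⟨m, c, ?_⟩
    have : a - κ c * π' ^ m = (a / π' ^ m - κ c) * π' ^ m := by
      field_simp
    rw [this, map_mul, map_zpow₀, hv, hm']
    exact mul_lt_of_lt_one_left (zpow_pos h.pos m) hc

theorem residue_unique {a : L} {c d : K} (hc : v (a - κ c) < 1) (hd : v (a - κ d) < 1) : c = d := by
  have : v (κ (c - d)) < 1 := by
    rw [map_sub, show κ c - κ d = (a - κ d) - (a - κ c) by ring]
    exact (Valuation.map_sub _ _ _).trans_lt (max_lt hd hc)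
  exact sub_eq_zero.1 (h.eq_zero_of_val_lt this)

end HasExpansions

theorem IsLaurent.of_val_eq (h : IsLaurent v κ A π) {π' : L} (hm : π' ∈ A) (hv : v π' = v π) :
    IsLaurent v κ A π' where
  toHasExpansions := h.toHasExpansions.of_val_eq hm hv
  complete := hv ▸ h.complete

/-- The integral elements of the subfield `A`. -/
def intRing (v : Valuation L Γ) (A : Subfield L) : Subring L := A.toSubring ⊓ v.integer

theorem val_coe_intRing_le (a : intRing v A) : v (a : L) ≤ 1 := a.2.2

theorem val_eval_sub_eval_le (f : (intRing v A)[X]) (a b : intRing v A) :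
    v (↑(f.eval a) - ↑(f.eval b) : L) ≤ v (a - b : L) := by
  obtain ⟨k, hk⟩ := f.evalSubFactor a b
  have : (↑(f.eval a) - ↑(f.eval b) : L) = (k : L) * (a - b : L) := by
    have := congrArg (Subtype.val) hk
    simpa using this
  rw [this, map_mul]
  exact mul_le_of_le_one_left' k.2.2

theorem exists_inv_intRing {a : intRing v A} (h : v (a : L) = 1) :
    ∃ b : intRing v A, a * b = 1 ∧ v (b : L) = 1 := by
  have h0 : (a : L) ≠ 0 := by rintro h0; simp [h0] at h
  have : v (a : L)⁻¹ = 1 := by simp [h]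
  exact ⟨⟨(a : L)⁻¹, A.inv_mem a.2.1, this.le⟩, Subtype.ext (mul_inv_cancel₀ h0), this⟩

/-- Hensel's lemma. -/
theorem IsLaurent.hensel (h : IsLaurent v κ A π) (f : (intRing v A)[X]) (c : intRing v A)
    (hc : v (↑(f.eval c) : L) < 1) (hd : v (↑(f.derivative.eval c) : L) = 1) :
    ∃ a : intRing v A, f.eval a = 0 ∧ v (a - c : L) < 1 := by
  have step : ∀ (n : ℕ) (x : intRing v A), v (↑(f.eval x) : L) ≤ v π ^ (n + 1) →
      v (↑(f.derivative.eval x) : L) = 1 →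
      ∃ y : intRing v A, v (↑(f.eval y) : L) ≤ v π ^ (n + 2) ∧ v (↑(f.derivative.eval y) : L) = 1 ∧
        v (y - x : L) ≤ v π ^ (n + 1) := by
    intro n x hx hx'
    obtain ⟨b, hb, hvb⟩ := exists_inv_intRing hx'
    -- Newton's correction: b is the inverse of the derivative at x, so the new value of f is a
    -- multiple of t².
    set t : intRing v A := - (f.eval x * b) with ht
    have hvt : v (t : L) = v (↑(f.eval x) : L) := by
      rw [ht]; push_cast; rw [Valuation.map_neg, map_mul, hvb, mul_one]
    refine ⟨x + t, ?_, ?_, ?_⟩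
    · obtain ⟨k, hk⟩ := f.binomExpansion x t
      have : f.eval (x + t) = k * t ^ 2 := by
        rw [hk, ht]
        linear_combination (- f.eval x) * hb
      rw [this]
      push_cast
      rw [map_mul, map_pow, hvt]
      calc v (k : L) * v (↑(f.eval x) : L) ^ 2 ≤ 1 * (v π ^ (n + 1)) ^ 2 := by
            gcongr; exact k.2.2
        _ = v π ^ (n + 2) * v π ^ n := by
            rw [one_mul, ← pow_mul, ← pow_add]; congr 1; omega
        _ ≤ v π ^ (n + 2) := mul_le_of_le_one_right' (pow_le_one' h.lt_one.le n)
    · have h1 : v (↑(f.derivative.eval (x + t)) - ↑(f.derivative.eval x) : L) < 1 := by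
        refine (val_eval_sub_eval_le _ _ _).trans_lt ?_
        have : ((x + t : intRing v A) - x : L) = t := by push_cast; ring
        rw [this, hvt]
        exact hx.trans_lt (pow_lt_one₀ zero_le h.lt_one (by omega))
      rw [← hx'] at h1 ⊢
      exact val_eq_of_sub_lt' h1
    · have : ((x + t : intRing v A) - x : L) = t := by push_cast; ring
      rw [this, hvt]; exact hx
  have h0 : v (↑(f.eval c) : L) ≤ v π ^ (0 + 1) := by
    simpa using h.val_le_of_lt_one (f.eval c).2.1 hc
  let S : ℕ → Type _ := fun n ↦ {x : intRing v A // v (↑(f.eval x) : L) ≤ v π ^ (n + 1) ∧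
    v (↑(f.derivative.eval x) : L) = 1}
  let next : ∀ n, S n → S (n + 1) := fun n x ↦
    ⟨(step n x.1 x.2.1 x.2.2).choose, (step n x.1 x.2.1 x.2.2).choose_spec.1,
      (step n x.1 x.2.1 x.2.2).choose_spec.2.1⟩
  let seq : ∀ n, S n := fun n ↦ Nat.rec ⟨c, h0, hd⟩ next n
  have hseq : ∀ n, v (((seq (n + 1)).1 : L) - (seq n).1) ≤ v π ^ (n + 1) := fun n ↦
    (step n (seq n).1 (seq n).2.1 (seq n).2.2).choose_spec.2.2
  have hle : ∀ n, v π ^ (n + 1) ≤ v π ^ n := fun n ↦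
    pow_le_pow_right_of_le_one' h.lt_one.le (Nat.le_succ n)
  obtain ⟨a, ha, hlim⟩ := h.complete (fun n ↦ ((seq (n + 1)).1 : L)) (fun n ↦ (seq _).1.2.1)
    (fun n ↦ (hseq (n + 1)).trans ((hle _).trans (hle _)))
  have hva : v a ≤ 1 := by
    have := hlim 0
    rw [pow_zero] at this
    have h2 := Valuation.map_add v (a - (seq 1).1) (seq 1).1
    rw [sub_add_cancel] at h2
    exact h2.trans (max_le this (seq 1).1.2.2)
  refine ⟨⟨a, ha, hva⟩, ?_, ?_⟩
  · refine Subtype.ext (h.eq_zero_of_forall_le (f.eval _).2.1 fun n ↦ ?_)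
    have h1 := val_eval_sub_eval_le f ⟨a, ha, hva⟩ (seq (n + 1)).1
    have h2 := Valuation.map_add v ((↑(f.eval ⟨a, ha, hva⟩) : L) - (↑(f.eval (seq (n + 1)).1) : L))
      (↑(f.eval (seq (n + 1)).1) : L)
    rw [sub_add_cancel] at h2
    exact h2.trans (max_le (h1.trans (hlim n)) ((seq (n + 1)).2.1.trans ((hle _).trans (hle _))))
  · have h1 : v (a - (seq 2).1) < 1 := by
      refine (hlim 1).trans_lt (by simpa using h.lt_one)
    have h2 : v (((seq 2).1 : L) - (seq 1).1) < 1 :=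
      (hseq 1).trans_lt (pow_lt_one₀ zero_le h.lt_one (by omega))
    have h3 : v (((seq 1).1 : L) - c) < 1 :=
      (hseq 0).trans_lt (pow_lt_one₀ zero_le h.lt_one (by omega))
    have : (a - c : L) = (a - (seq 2).1) + ((((seq 2).1 : L) - (seq 1).1) + (((seq 1).1 : L) - c)) := by
      ring
    change v (a - c : L) < 1
    rw [this]
    exact Valuation.map_add_lt v h1 (Valuation.map_add_lt v h2 h3)

/-- Uniqueness in Hensel's lemma. -/
theorem hensel_unique (f : (intRing v A)[X]) (a b : intRing v A) (ha : f.eval a = 0)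
    (hb : f.eval b = 0) (hd : v (↑(f.derivative.eval a) : L) = 1) (hab : v (a - b : L) < 1) :
    a = b := by
  obtain ⟨k, hk⟩ := f.binomExpansion a (b - a)
  rw [add_sub_cancel, hb, ha, zero_add] at hk
  by_contra hne
  have hba : b - a ≠ 0 := fun h ↦ hne (sub_eq_zero.1 h).symm
  have h1 : f.derivative.eval a = - (k * (b - a)) := by
    have : (f.derivative.eval a + k * (b - a)) * (b - a) = 0 := by
      rw [add_mul]
      linear_combination - hk
    linear_combination (mul_eq_zero.1 this).resolve_right hba
  rw [h1] at hd
  push_cast at hd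
  rw [Valuation.map_neg, map_mul] at hd
  rw [Valuation.map_sub_swap] at hab
  exact ((mul_le_of_le_one_left' (val_coe_intRing_le k)).trans_lt hab).ne hd

/-- An element of the large field `B` that is a simple root of a polynomial over the integers of
`A` lies in `A`. -/
theorem IsLaurent.mem_of_root (h : IsLaurent v κ A π) {π' : L} (h' : HasExpansions v κ B π')
    (hAB : A ≤ B) (f : (intRing v A)[X]) {y : L} (hy : y ∈ B) (hvy : v y ≤ 1)
    (hf : f.eval₂ (intRing v A).subtype y = 0)
    (hd : v (f.derivative.eval₂ (intRing v A).subtype y) = 1) : y ∈ A := by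
  have hle : intRing v A ≤ intRing v B := fun a ha ↦ ⟨hAB ha.1, ha.2⟩
  let ι : intRing v A →+* intRing v B := Subring.inclusion hle
  have hι : ∀ (g : (intRing v A)[X]) (x : intRing v B),
      (((g.map ι).eval x : intRing v B) : L) = g.eval₂ (intRing v A).subtype (x : L) := by
    intro g x
    rw [eval_map, ← Subring.subtype_apply, hom_eval₂]
    rfl
  have hιA : ∀ (g : (intRing v A)[X]) (x : intRing v A),
      (↑(g.eval x) : L) = g.eval₂ (intRing v A).subtype (x : L) := by
    intro g x
    rw [← Subring.subtype_apply, ← eval₂_id, hom_eval₂, RingHom.comp_id]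
    rfl
  let Y : intRing v B := ⟨y, hy, hvy⟩
  obtain ⟨c, hc⟩ := h'.exists_residue hy hvy
  let C : intRing v A := ⟨κ c, h.const c, h.val_const_le c⟩
  have e1 : v ((↑(f.eval C) : L)) < 1 := by
    have := val_eval_sub_eval_le (f.map ι) Y (ι C)
    rw [hι, hf, zero_sub, Valuation.map_neg, hι] at this
    rw [hιA]
    exact this.trans_lt hc
  have e2 : v ((↑(f.derivative.eval C) : L)) = 1 := by
    have := val_eval_sub_eval_le (f.derivative.map ι) Y (ι C)
    rw [hι, hι] at this
    have := this.trans_lt hc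
    rw [← hd] at this
    rw [hιA]
    exact (val_eq_of_sub_lt this).trans hd
  obtain ⟨a, ha, hac⟩ := h.hensel f C e1 e2
  have : Y = ι a := by
    refine hensel_unique (f.map ι) Y (ι a) (Subtype.ext ?_) (Subtype.ext ?_) ?_ ?_
    · rw [hι]; exact hf
    · rw [hι]
      change f.eval₂ _ (a : L) = 0
      rw [← hιA, ha]; rfl
    · rw [derivative_map, hι]; exact hd
    · have : ((Y : L) - (ι a : L)) = (y - κ c) - ((a : L) - κ c) := by
        change y - (a : L) = _
        ring
      rw [this]
      exact (Valuation.map_sub _ _ _).trans_lt (max_lt hc hac)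
  have := congrArg Subtype.val this
  change y = (a : L) at this
  rw [this]; exact a.2.1

end Local

/-! ### Density and equality of complete subfields, roots of units, totally ramified extensions -/

section Local

open Polynomial IntermediateField

variable {L Γ K : Type*} [Field L] [LinearOrderedCommGroupWithZero Γ] [Field K]
variable {v : Valuation L Γ} {κ : K →+* L} {A B : Subfield L} {π : L}

/-- Leading terms are removed one after the other. The approximants are polynomials in π over the
constants, so they lie in any subfield that contains these, with no completeness or expansions
required of it. -/
theorem HasExpansions.exists_approx (h : HasExpansions v κ B π) (hπ : π ∈ A)
    (hκ : ∀ c, κ c ∈ A) {b : L} (hb : b ∈ B) (hvb : v b ≤ 1) (n : ℕ) :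
    ∃ a ∈ A, a ∈ B ∧ v (b - a) ≤ v π ^ n := by
  induction n with
  | zero => exact ⟨0, A.zero_mem, B.zero_mem, by simpa using hvb⟩
  | succ n ih =>
    obtain ⟨a, haA, haB, ha⟩ := ih
    have hπn : π ^ n ≠ 0 := pow_ne_zero _ h.ne_zero
    have hmem : (b - a) / π ^ n ∈ B := B.div_mem (B.sub_mem hb haB) (B.pow_mem h.mem n)
    have h1 : v ((b - a) / π ^ n) ≤ 1 := by
      rw [map_div₀, map_pow]
      exact div_le_one_of_le₀ ha zero_le
    obtain ⟨c, hc⟩ := h.exists_residue hmem h1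
    refine ⟨a + κ c * π ^ n, A.add_mem haA (A.mul_mem (hκ c) (A.pow_mem hπ n)),
      B.add_mem haB (B.mul_mem (h.const c) (B.pow_mem h.mem n)), ?_⟩
    have h2 := h.val_le_of_lt_one (B.sub_mem hmem (h.const c)) hc
    have : b - (a + κ c * π ^ n) = ((b - a) / π ^ n - κ c) * π ^ n := by
      field_simp; ring
    rw [this, map_mul, map_pow, pow_succ']
    exact mul_le_mul_left h2 _

/-- A complete subfield contains the limits of its sequences. -/
theorem IsLaurent.mem_of_approx (h : IsLaurent v κ A π) {ϖ : L} (h' : HasExpansions v κ B ϖ) (hAB : A ≤ B)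
    {b : L} (hb : b ∈ B) (hn : ∀ n : ℕ, ∃ a ∈ A, v (b - a) ≤ v π ^ n) : b ∈ A := by
  choose f hfA hf using hn
  obtain ⟨a, ha, hlim⟩ := h.complete f hfA fun n ↦ by
    rw [show f (n + 1) - f n = (b - f n) - (b - f (n + 1)) by ring]
    refine (Valuation.map_sub _ _ _).trans (max_le (hf n) ((hf _).trans ?_))
    exact pow_le_pow_right_of_le_one' h.lt_one.le n.le_succ
  have : b - a = 0 := h'.eq_zero_of_forall_le (B.sub_mem hb (hAB ha)) fun n ↦ by
    rw [show b - a = (b - f n) - (a - f n) by ring]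
    exact ((Valuation.map_sub _ _ _).trans (max_le (hf n) (hlim n))).trans
      (pow_le_pow_left₀ zero_le (h'.val_le_of_lt_one (hAB h.mem) h.lt_one) n)
  rwa [sub_eq_zero.1 this]

/-- A complete subfield of `B` that contains an element with the same valuation as a uniformizer of
`B` is equal to `B`. -/
theorem IsLaurent.eq_of_le (h : IsLaurent v κ A π) {π' : L} (h' : HasExpansions v κ B π')
    (hAB : A ≤ B) (hv : v π = v π') : A = B := by
  have h'' := h'.of_val_eq (hAB h.mem) hv
  refine le_antisymm hAB fun b hb ↦ ?_
  have key : ∀ b ∈ B, v b ≤ 1 → b ∈ A := fun b hb hvb ↦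
    h.mem_of_approx h'' hAB hb fun n ↦ by
      obtain ⟨a, ha, _, hn⟩ := h''.exists_approx h.mem h.const hb hvb n
      exact ⟨a, ha, hn⟩
  rcases le_total (v b) 1 with h1 | h1
  · exact key b hb h1
  · rw [← inv_inv b]
    refine A.inv_mem (key _ (B.inv_mem hb) ?_)
    rw [map_inv₀]
    exact inv_le_one_of_one_le₀ h1

theorem HasExpansions.val_natCast (h : HasExpansions v κ A π) {m : ℕ} (hm : (m : K) ≠ 0) :
    v (m : L) = 1 := by
  rw [← map_natCast κ]; exact h.val_const _ hm

/-- If a power of a unit of a larger field, with exponent prime to the characteristic, lies in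
`A`, then so does the unit. -/
theorem IsLaurent.mem_of_pow_mem (h : IsLaurent v κ A π) {π' : L} (h' : HasExpansions v κ B π')
    (hAB : A ≤ B) {m : ℕ} (hm : (m : K) ≠ 0) {y : L} (hy : y ∈ B) (hvy : v y = 1)
    (hpow : y ^ m ∈ A) : y ∈ A := by
  refine h.mem_of_root h' hAB (X ^ m - C ⟨y ^ m, hpow, (by simp [hvy] : v (y ^ m) ≤ 1)⟩) hy hvy.le ?_ ?_
  · simp [eval₂_sub]
  · simp [hvy, h.val_natCast hm, derivative_X_pow]

/-- Roots of elements of suitable valuation, with exponent prime to the characteristic. -/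
theorem IsLaurent.exists_pow_eq [IsAlgClosed K] (h : IsLaurent v κ A π) {m : ℕ} (hm : (m : K) ≠ 0)
    {a : L} (ha : a ∈ A) {l : ℤ} (hva : v a = v π ^ (m * l)) : ∃ t ∈ A, t ^ m = a := by
  have hm0 : 0 < m := Nat.pos_of_ne_zero (by rintro rfl; simp at hm)
  have hπl : π ^ (m * l) ≠ 0 := zpow_ne_zero _ h.ne_zero
  set b := a / π ^ (m * l) with hb
  have hbA : b ∈ A := A.div_mem ha (A.zpow_mem h.mem _)
  have hvb : v b = 1 := by
    rw [hb, map_div₀, map_zpow₀, hva, div_self (zpow_ne_zero _ h.pos.ne')]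
  obtain ⟨c, hc⟩ := h.exists_residue hbA hvb.le
  obtain ⟨d, hd⟩ := IsAlgClosed.exists_pow_nat_eq c hm0
  have hc0 : c ≠ 0 := by rintro rfl; simp [hvb] at hc
  have hd0 : d ≠ 0 := by rintro rfl; simp [hm0.ne'] at hd; exact hc0 hd.symm
  obtain ⟨t, ht, -⟩ := h.hensel (X ^ m - C ⟨b, hbA, hvb.le⟩)
    ⟨κ d, h.const d, h.val_const_le d⟩ (by
      simp only [eval_sub, eval_pow, eval_X, eval_C]
      push_cast
      rw [Valuation.map_sub_swap, ← map_pow, hd]; exact hc) (by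
      simp [derivative_X_pow, h.val_natCast hm, h.val_const d hd0])
  refine ⟨t * π ^ l, A.mul_mem t.2.1 (A.zpow_mem h.mem _), ?_⟩
  have : (t : L) ^ m = b := by
    have := congrArg Subtype.val ht
    simp only [eval_sub, eval_pow, eval_X, eval_C] at this
    push_cast at this
    exact sub_eq_zero.1 this
  rw [mul_pow, this, hb, ← zpow_natCast (π ^ l), ← zpow_mul, mul_comm l, div_mul_cancel₀ _ hπl]

theorem residue_mul (hκ : ∀ c, c ≠ 0 → v (κ c) = 1) {x y : L} {c d : K} (hc : c ≠ 0)
    (hx : v (x - κ c) < 1) (hd : d ≠ 0) (hy : v (y - κ d) < 1) : v (x * y - κ (c * d)) < 1 := by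
  have hvx : v x = 1 := by rw [← hκ c hc] at hx ⊢; exact val_eq_of_sub_lt' hx
  rw [map_mul, show x * y - κ c * κ d = x * (y - κ d) + (x - κ c) * κ d by ring]
  refine Valuation.map_add_lt v ?_ ?_
  · rw [map_mul, hvx, one_mul]; exact hy
  · rw [map_mul, hκ d hd, mul_one]; exact hx

theorem residue_inv (hκ : ∀ c, c ≠ 0 → v (κ c) = 1) {x : L} {c : K} (hc : c ≠ 0)
    (hx : v (x - κ c) < 1) : v (x⁻¹ - κ c⁻¹) < 1 := by
  have hvx : v x = 1 := by rw [← hκ c hc] at hx ⊢; exact val_eq_of_sub_lt' hx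
  have hx0 : x ≠ 0 := by rintro rfl; simp at hvx
  have hc0 : κ c ≠ 0 := (map_ne_zero κ).2 hc
  rw [map_inv₀, inv_sub_inv hx0 hc0, map_div₀, map_mul, hvx, hκ c hc, mul_one, div_one,
    Valuation.map_sub_swap]
  exact hx

theorem residue_zpow (hκ : ∀ c, c ≠ 0 → v (κ c) = 1) {x : L} {c : K} (hc : c ≠ 0)
    (hx : v (x - κ c) < 1) (m : ℤ) : v (x ^ m - κ (c ^ m)) < 1 := by
  have hnat : ∀ n : ℕ, v (x ^ n - κ (c ^ n)) < 1 := by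
    intro n
    induction n with
    | zero => simp
    | succ n ih => rw [pow_succ, pow_succ]; exact residue_mul hκ (pow_ne_zero _ hc) ih hc hx
  obtain ⟨n, rfl | rfl⟩ := m.eq_nat_or_neg
  · simpa using hnat n
  · rw [zpow_neg, zpow_neg, zpow_natCast, zpow_natCast]
    exact residue_inv hκ (pow_ne_zero _ hc) (hnat n)

theorem mem_adjoinElement {y : L} {b : L} : b ∈ adjoinElement A y ↔ b ∈ A⟮y⟯ := Iff.rfl

theorem le_adjoinElement (A : Subfield L) (y : L) : A ≤ adjoinElement A y := fun a ha ↦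
  (IntermediateField.adjoin A {y}).algebraMap_mem ⟨a, ha⟩

theorem self_mem_adjoinElement (A : Subfield L) (y : L) : y ∈ adjoinElement A y :=
  IntermediateField.mem_adjoin_simple_self A y

theorem adjoinElement_le {y : L} (hAB : A ≤ B) (hy : y ∈ B) : adjoinElement A y ≤ B := by
  have : IntermediateField.adjoin A {y} ≤ Subfield.extendScalars hAB := by
    rw [IntermediateField.adjoin_le_iff]
    rintro _ rfl
    exact hy
  exact this

theorem exists_sum_of_mem_adjoin {τ : L} {e : ℕ} [FiniteDimensional A A⟮τ⟯]
    (hle : Module.finrank A A⟮τ⟯ ≤ e) {b : L} (hb : b ∈ adjoinElement A τ) :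
    ∃ a : ℕ → L, (∀ i, a i ∈ A) ∧ b = ∑ i ∈ Finset.range e, a i * τ ^ i := by
  have hint : IsIntegral A τ := by
    have := IsIntegral.of_finite A (⟨τ, mem_adjoin_simple_self A τ⟩ : A⟮τ⟯)
    exact (isIntegral_algebraMap_iff (B := L) (algebraMap A⟮τ⟯ L).injective).2 this
  rw [mem_adjoinElement, ← mem_toSubalgebra, adjoin_simple_toSubalgebra_of_isAlgebraic
    hint.isAlgebraic, Algebra.adjoin_singleton_eq_range_aeval] at hb
  obtain ⟨P, rfl⟩ := hb
  have hmon := minpoly.monic hint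
  set Q := P %ₘ minpoly A τ with hQ
  have hdeg : Q.natDegree < e ∨ Q = 0 := by
    by_cases h0 : Q = 0
    · exact Or.inr h0
    refine Or.inl (lt_of_lt_of_le ?_ hle)
    rw [IntermediateField.adjoin.finrank hint]
    exact natDegree_lt_natDegree h0 (degree_modByMonic_lt P hmon)
  refine ⟨fun i ↦ Q.coeff i, fun i ↦ (Q.coeff i).2, ?_⟩
  have : aeval τ P = aeval τ Q := by
    conv_lhs => rw [← modByMonic_add_div P (minpoly A τ)]
    simp [hQ]
  change aeval τ P = _
  rw [this]
  rcases hdeg with hd | h0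
  · rw [aeval_eq_sum_range' hd]; rfl
  · rw [h0]; simp

section Totally

variable {τ : L} {e : ℕ} {c : K}

theorem HasExpansions.val_pow_of_sub_lt (h : HasExpansions v κ A π) (hc : c ≠ 0)
    (hτ : v (τ ^ e - κ c * π) < v π) : v τ ^ e = v π := by
  have h1 : v (κ c * π) = v π := by rw [map_mul, h.val_const c hc, one_mul]
  rw [← map_pow, ← h1]
  rw [← h1] at hτ
  exact val_eq_of_sub_lt' hτ

variable (h : HasExpansions v κ A π) (he : 0 < e) (hτ : v τ ^ e = v π)
include h he hτ

set_option linter.unusedSectionVars false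

theorem HasExpansions.root_pos : 0 < v τ := by
  rcases zero_le (a := v τ) |>.eq_or_lt with h0 | h0
  · rw [← h0, zero_pow he.ne'] at hτ
    exact absurd hτ h.pos.ne
  · exact h0

theorem HasExpansions.root_lt_one : v τ < 1 := by
  by_contra! h1
  exact absurd (hτ ▸ h.lt_one) (not_lt.2 (one_le_pow₀ h1))

theorem HasExpansions.root_zpow_le_iff {m n : ℤ} : v τ ^ m ≤ v τ ^ n ↔ n ≤ m :=
  zpow_le_zpow_iff_right_of_lt_one₀ (h.root_pos he hτ) (h.root_lt_one he hτ)

theorem HasExpansions.root_zpow_inj {m n : ℤ} : v τ ^ m = v τ ^ n ↔ m = n := by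
  rw [le_antisymm_iff, h.root_zpow_le_iff he hτ, h.root_zpow_le_iff he hτ]; omega

theorem HasExpansions.exists_val_root {a : L} (ha : a ∈ A) (h0 : a ≠ 0) :
    ∃ m : ℤ, v a = v τ ^ (e * m) := by
  obtain ⟨m, hm⟩ := h.exists_val ha h0
  exact ⟨m, by rw [hm, zpow_mul, zpow_natCast, hτ]⟩

/-- The terms of a sum `∑ a i * τ ^ i` with `i < e` have distinct valuations. -/
theorem HasExpansions.val_sum {a : ℕ → L} (ha : ∀ i, a i ∈ A) :
    (∀ i < e, v (a i * τ ^ i) ≤ v (∑ i ∈ Finset.range e, a i * τ ^ i)) ∧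
    (∑ i ∈ Finset.range e, a i * τ ^ i ≠ 0 → ∃ i < e, a i ≠ 0 ∧
      v (∑ i ∈ Finset.range e, a i * τ ^ i - a i * τ ^ i) <
        v (∑ i ∈ Finset.range e, a i * τ ^ i)) := by
  obtain ⟨i₀, hi₀, hmax⟩ := Finset.exists_max_image (Finset.range e) (fun i ↦ v (a i * τ ^ i))
    ⟨0, Finset.mem_range.2 he⟩
  rw [Finset.mem_range] at hi₀
  by_cases h0 : a i₀ = 0
  · have hz : ∀ i ∈ Finset.range e, a i * τ ^ i = 0 := fun i hi ↦ by
      have := hmax i hi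
      rw [h0, zero_mul, map_zero] at this
      exact (Valuation.zero_iff v).1 (le_antisymm this zero_le)
    rw [Finset.sum_eq_zero hz]
    refine ⟨fun i hi ↦ ?_, fun h ↦ absurd rfl h⟩
    rw [hz i (Finset.mem_range.2 hi)]
  have hτ0 : τ ≠ 0 := (Valuation.pos_iff v).1 (h.root_pos he hτ)
  have hne : v (a i₀ * τ ^ i₀) ≠ 0 := (Valuation.ne_zero_iff v).2 (mul_ne_zero h0 (pow_ne_zero _ hτ0))
  have hlt : ∀ i ∈ (Finset.range e).erase i₀, v (a i * τ ^ i) < v (a i₀ * τ ^ i₀) := by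
    intro i hi
    rw [Finset.mem_erase] at hi
    refine lt_of_le_of_ne (hmax i hi.2) fun heq ↦ ?_
    have hai : a i ≠ 0 := by
      rintro hai
      rw [hai, zero_mul, map_zero] at heq
      exact hne heq.symm
    obtain ⟨m, hm⟩ := h.exists_val_root he hτ (ha i) hai
    obtain ⟨n, hn⟩ := h.exists_val_root he hτ (ha i₀) h0
    have hp := (h.root_pos he hτ).ne'
    rw [map_mul, map_mul, map_pow, map_pow, hm, hn, ← zpow_natCast, ← zpow_natCast,
      ← zpow_add₀ hp, ← zpow_add₀ hp, h.root_zpow_inj he hτ] at heq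
    have h2 := Finset.mem_range.1 hi.2
    apply hi.1
    -- Coefficients have order divisible by e, so the order of a term modulo e recovers its index.
    have h3 : ((e : ℤ) * m + i) % e = ((e : ℤ) * n + i₀) % e := by rw [heq]
    rw [Int.add_comm, Int.add_mul_emod_self_left, Int.add_comm, Int.add_mul_emod_self_left,
      Int.emod_eq_of_lt (by omega) (by omega), Int.emod_eq_of_lt (by omega) (by omega)] at h3
    exact_mod_cast h3
  have hsub : ∑ i ∈ Finset.range e, a i * τ ^ i - a i₀ * τ ^ i₀ =
      ∑ i ∈ (Finset.range e).erase i₀, a i * τ ^ i := by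
    rw [← Finset.sum_erase_add _ _ (Finset.mem_range.2 hi₀), add_sub_cancel_right]
  have h1 : v (∑ i ∈ Finset.range e, a i * τ ^ i - a i₀ * τ ^ i₀) < v (a i₀ * τ ^ i₀) := by
    rw [hsub]
    exact Valuation.map_sum_lt v hne hlt
  have h2 := val_eq_of_sub_lt' h1
  refine ⟨fun i hi ↦ h2 ▸ hmax i (Finset.mem_range.2 hi), fun _ ↦ ⟨i₀, hi₀, h0, h2 ▸ h1⟩⟩

/-- A minimal polynomial of degree below e would give a vanishing sum of terms of distinct values
whose leading term is a power of τ, which is not zero. -/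
theorem HasExpansions.le_finrank [FiniteDimensional A A⟮τ⟯] : e ≤ Module.finrank A A⟮τ⟯ := by
  by_contra! hlt
  have hint : IsIntegral A τ := by
    have := IsIntegral.of_finite A (⟨τ, mem_adjoin_simple_self A τ⟩ : A⟮τ⟯)
    exact (isIntegral_algebraMap_iff (B := L) (algebraMap A⟮τ⟯ L).injective).2 this
  rw [IntermediateField.adjoin.finrank hint] at hlt
  have h0 := minpoly.aeval A τ
  rw [aeval_eq_sum_range' hlt] at h0
  have h1 := (h.val_sum he hτ (a := fun i ↦ ((minpoly A τ).coeff i : L))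
    fun i ↦ ((minpoly A τ).coeff i).2).1
    _ hlt
  have h0' : ∑ i ∈ Finset.range e, ((minpoly A τ).coeff i : L) * τ ^ i = 0 := h0
  rw [h0', map_zero, (minpoly.monic hint).coeff_natDegree, map_mul] at h1
  have h2 := le_antisymm h1 zero_le
  simp only [OneMemClass.coe_one, map_one, one_mul, map_pow] at h2
  exact (h.root_pos he hτ).ne' (pow_eq_zero_iff (by rintro h9; rw [h9] at h2; simp at h2) |>.1 h2)

/-- No cancellation occurs among the terms, so each of them is integral; since the order of a
coefficient is a multiple of e and its power of τ contributes less than e, the coefficient is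
integral as well. -/
theorem HasExpansions.exists_polynomial [FiniteDimensional A A⟮τ⟯]
    (hle : Module.finrank A A⟮τ⟯ ≤ e) {b : L} (hb : b ∈ adjoinElement A τ) (hvb : v b ≤ 1) :
    ∃ P : (intRing v A)[X], b = P.eval₂ (intRing v A).subtype τ := by
  obtain ⟨a, ha, rfl⟩ := exists_sum_of_mem_adjoin hle hb
  have hp := (h.root_pos he hτ).ne'
  have h1 : ∀ i < e, v (a i) ≤ 1 := fun i hi ↦ by
    have := ((h.val_sum he hτ ha).1 i hi).trans hvb
    by_cases h0 : a i = 0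
    · simp [h0]
    obtain ⟨m, hm⟩ := h.exists_val_root he hτ (ha i) h0
    rw [map_mul, map_pow, hm, ← zpow_natCast, ← zpow_add₀ hp, ← zpow_zero (v τ),
      h.root_zpow_le_iff he hτ] at this
    rw [hm, ← zpow_zero (v τ), h.root_zpow_le_iff he hτ]
    have h3 : -1 < m := by
      by_contra! h4
      nlinarith
    have h5 : 0 ≤ m := by omega
    positivity
  classical
  refine ⟨∑ i : Fin e, C ⟨a i, ha i, h1 i i.2⟩ * X ^ (i : ℕ), ?_⟩
  rw [eval₂_finsetSum, Finset.sum_range]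
  simp

/-- A totally ramified extension generated by a root of a uniformizer. -/
theorem IsLaurent.adjoin (hA : IsLaurent v κ A π) (hc : c ≠ 0)
    (hτc : v (τ ^ e - κ c * π) < v π) [FiniteDimensional A A⟮τ⟯]
    (hle : Module.finrank A A⟮τ⟯ ≤ e) : IsLaurent v κ (adjoinElement A τ) τ where
  val_const := h.val_const
  const d := le_adjoinElement A τ (h.const d)
  mem := self_mem_adjoinElement A τ
  ne_zero := (Valuation.pos_iff v).1 (h.root_pos he hτ)
  lt_one := h.root_lt_one he hτ
  approx b hb hb0 := by
    obtain ⟨a, ha, rfl⟩ := exists_sum_of_mem_adjoin hle hb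
    obtain ⟨i, hi, h0, hlt⟩ := (h.val_sum he hτ ha).2 hb0
    set S := ∑ i ∈ Finset.range e, a i * τ ^ i
    have hvS := val_eq_of_sub_lt hlt
    have hτ0 : τ ≠ 0 := (Valuation.pos_iff v).1 (h.root_pos he hτ)
    obtain ⟨m, d, hd, hmd, hvm⟩ := h.exists_monomial (ha i) h0
    have hπm : π ^ m ≠ 0 := zpow_ne_zero _ h.ne_zero
    have r1 : v (a i / π ^ m - κ d) < 1 := by
      rw [show a i / π ^ m - κ d = (a i - κ d * π ^ m) / π ^ m by field_simp, map_div₀, map_zpow₀,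
        ← hvm]
      exact (div_lt_one₀ (by rw [hvm]; exact zpow_pos h.pos m)).2 hmd
    have r2 : v (τ ^ e / π - κ c) < 1 := by
      rw [show τ ^ e / π - κ c = (τ ^ e - κ c * π) / π by have := h.ne_zero; field_simp, map_div₀]
      exact (div_lt_one₀ h.pos).2 hτc
    have r3 := residue_mul h.val_const hd r1 (zpow_ne_zero (-m) hc)
      (residue_zpow h.val_const hc r2 (-m))
    refine ⟨e * m + i, d * c ^ (-m), ?_⟩
    have e1 : a i * τ ^ i - κ (d * c ^ (-m)) * τ ^ (e * m + i : ℤ) =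
        (a i / π ^ m * (τ ^ e / π) ^ (-m) - κ (d * c ^ (-m))) * τ ^ (e * m + i : ℤ) := by
      generalize κ (d * c ^ (-m)) = y
      have : (τ ^ e) ^ m ≠ 0 := zpow_ne_zero _ (pow_ne_zero _ hτ0)
      have hz : (τ ^ e / π) ^ (-m) = π ^ m / (τ ^ e) ^ m := by rw [zpow_neg, div_zpow, inv_div]
      rw [zpow_add₀ hτ0, zpow_mul, zpow_natCast, zpow_natCast, hz]
      field_simp
    have e2 : v (τ ^ (e * m + i : ℤ)) = v S := by
      rw [← hvS, zpow_add₀ hτ0, zpow_mul, zpow_natCast, zpow_natCast, map_mul, map_zpow₀, map_pow,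
        hτ, ← hvm, map_mul]
    rw [show S - κ (d * c ^ (-m)) * τ ^ (e * m + i : ℤ) = (S - a i * τ ^ i) +
      (a i * τ ^ i - κ (d * c ^ (-m)) * τ ^ (e * m + i : ℤ)) by ring]
    refine Valuation.map_add_lt v hlt ?_
    rw [e1, map_mul, e2]
    exact mul_lt_of_lt_one_left ((Valuation.pos_iff v).2 hb0) r3
  complete f hf hdiff := by
    have hlt1 := h.root_lt_one he hτ
    have hpos := h.root_pos he hτ
    have htel : ∀ n m, v (f (n + m) - f n) ≤ v τ ^ n := by
      intro n m
      induction m with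
      | zero => simp
      | succ m ih =>
        rw [show f (n + (m + 1)) - f n = (f (n + m + 1) - f (n + m)) + (f (n + m) - f n) by
          rw [add_assoc]; ring]
        refine (Valuation.map_add _ _ _).trans (max_le ((hdiff _).trans ?_) ih)
        exact pow_le_pow_right_of_le_one' hlt1.le (Nat.le_add_right _ _)
    -- The subsequence of indices e n + e is fine enough for the coordinates: dividing by τ^i with i
    -- < e still leaves differences bounded by the n-th power of π.
    choose a haA ha using fun n ↦ exists_sum_of_mem_adjoin hle (hf (e * n + e))
    have hai : ∀ i, i < e → ∀ n, v (a (n + 1) i - a n i) ≤ v π ^ n := by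
      intro i hi n
      have h1 := (h.val_sum he hτ (a := fun i ↦ a (n + 1) i - a n i)
        fun i ↦ A.sub_mem (haA _ _) (haA _ _)).1 i hi
      simp only [sub_mul, Finset.sum_sub_distrib] at h1
      rw [← ha, ← ha, ← sub_mul, map_mul, map_pow] at h1
      have h2 := h1.trans (htel (e * n + e) e)
      have h3 : v τ ^ (e * n + e) ≤ v π ^ n * v τ ^ i := by
        rw [← hτ, ← pow_mul, ← pow_add]
        exact pow_le_pow_right_of_le_one' hlt1.le (by omega)
      exact le_of_mul_le_mul_right (h2.trans h3) (pow_pos hpos i)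
    have hex : ∀ i : ℕ, ∃ x ∈ A, i < e → ∀ n, v (x - a n i) ≤ v π ^ n := by
      intro i
      by_cases hi : i < e
      · obtain ⟨x, hx, hx'⟩ := hA.complete (fun n ↦ a n i) (fun n ↦ haA n i) (hai i hi)
        exact ⟨x, hx, fun _ ↦ hx'⟩
      · exact ⟨0, A.zero_mem, fun h ↦ absurd h hi⟩
    choose x hxA hx using hex
    refine ⟨∑ i ∈ Finset.range e, x i * τ ^ i, ?_, fun n ↦ ?_⟩
    · exact sum_mem fun i _ ↦ mul_mem (le_adjoinElement A τ (hxA i))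
        (pow_mem (self_mem_adjoinElement A τ) _)
    · have hen : n ≤ e * n := Nat.le_mul_of_pos_left n he
      have h1 : v (∑ i ∈ Finset.range e, x i * τ ^ i - f (e * n + e)) ≤ v τ ^ n := by
        rw [ha n, ← Finset.sum_sub_distrib]
        refine Valuation.map_sum_le v fun i hi ↦ ?_
        rw [← sub_mul, map_mul, map_pow]
        refine (mul_le_of_le_one_right' (pow_le_one' hlt1.le i)).trans
          ((hx i (Finset.mem_range.1 hi) n).trans ?_)
        rw [← hτ, ← pow_mul]
        exact pow_le_pow_right_of_le_one' hlt1.le hen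
      obtain ⟨d, hd⟩ := Nat.exists_eq_add_of_le (show n ≤ e * n + e by omega)
      have h2 := htel n d
      rw [← hd] at h2
      rw [show ∑ i ∈ Finset.range e, x i * τ ^ i - f n =
        (∑ i ∈ Finset.range e, x i * τ ^ i - f (e * n + e)) + (f (e * n + e) - f n) by ring]
      exact (Valuation.map_add _ _ _).trans (max_le h1 h2)

end Totally

end Local

/-! ### Products over lines of the prime field -/

section Additive

open Polynomial

theorem monic_eq_prod_of_roots {F : Type*} [Field F] {f : F[X]} (hf : f.Monic) (S : Finset F)
    (hS : ∀ x ∈ S, f.eval x = 0) (hc : f.natDegree = S.card) :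
    f = ∏ x ∈ S, (X - C x) := by
  have hdvd : ∏ x ∈ S, (X - C x) ∣ f := by
    refine Finset.prod_dvd_of_coprime (fun x _ y _ hxy ↦ ?_) fun x hx ↦
      dvd_iff_isRoot.2 (hS x hx)
    exact isCoprime_X_sub_C_of_isUnit_sub (sub_ne_zero.2 hxy).isUnit
  have hm : (∏ x ∈ S, (X - C x)).Monic := monic_prod_of_monic _ _ fun x _ ↦ monic_X_sub_C x
  refine (eq_of_monic_of_dvd_of_natDegree_le hm hf hdvd ?_)
  rw [hc, natDegree_prod_of_monic _ _ fun x _ ↦ monic_X_sub_C x]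
  simp

/-- For w ≠ 0 this is the factorization of T^p - T over the prime field at T = y/w, made
homogeneous. -/
theorem prod_sub_natCast_mul {F : Type*} [Field F] (p : ℕ) [Fact p.Prime] [CharP F p] (y w : F) :
    ∏ i ∈ Finset.range p, (y - i * w) = y ^ p - w ^ (p - 1) * y := by
  classical
  have hp : 1 < p := (Fact.out : p.Prime).one_lt
  by_cases hw : w = 0
  · subst hw
    rw [zero_pow (by omega)]
    simp
  have hinj : Set.InjOn (Nat.cast : ℕ → F) (Finset.range p) := by
    intro a ha b hb hab
    rw [Finset.coe_range, Set.mem_Iio] at ha hb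
    rw [CharP.natCast_eq_natCast F p] at hab
    exact Nat.ModEq.eq_of_lt_of_lt hab ha hb
  have h1 : (X ^ p - X : F[X]) = ∏ x ∈ (Finset.range p).image Nat.cast, (X - C x) := by
    refine monic_eq_prod_of_roots (monic_X_pow_sub (by rw [degree_X]; exact_mod_cast hp)) _ ?_ ?_
    · intro x hx
      obtain ⟨i, -, rfl⟩ := Finset.mem_image.1 hx
      have := map_natCast (frobenius F p) i
      rw [frobenius_def] at this
      simp [this]
    · rw [Finset.card_image_of_injOn hinj, Finset.card_range]
      exact FiniteField.X_pow_card_sub_X_natDegree_eq F hp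
  rw [Finset.prod_image hinj] at h1
  have h2 := congrArg (eval (y / w)) h1
  simp only [eval_sub, eval_pow, eval_X, eval_prod, eval_C] at h2
  have h3 : ∏ i ∈ Finset.range p, (y - i * w) = w ^ p * ∏ i ∈ Finset.range p, (y / w - i) := by
    have : w ^ p = ∏ i ∈ Finset.range p, w := by simp
    rw [this, ← Finset.prod_mul_distrib]
    refine Finset.prod_congr rfl fun i _ ↦ ?_
    field_simp
  rw [h3, ← h2]
  have : w ^ p = w ^ (p - 1) * w := by rw [← pow_succ]; congr 1; omega
  rw [mul_sub, div_pow, mul_div_cancel₀ _ (pow_ne_zero _ hw), this]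
  field_simp

end Additive

/-! ### Extensions generated by an element with a pole -/

section Local

open Polynomial IntermediateField

variable {L Γ K : Type*} [Field L] [LinearOrderedCommGroupWithZero Γ] [Field K]
variable {v : Valuation L Γ} {κ : K →+* L} {A B : Subfield L} {π : L}

theorem adjoin_inv_eq (A : Subfield L) (y : L) : A⟮y⁻¹⟯ = A⟮y⟯ := by
  refine le_antisymm ?_ ?_
  · rw [adjoin_simple_le_iff]
    exact inv_mem (mem_adjoin_simple_self A y)
  · rw [adjoin_simple_le_iff]
    have := inv_mem (mem_adjoin_simple_self A y⁻¹)
    rwa [inv_inv] at this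

theorem HasExpansions.ne_zero_of_inv {s : L} (h : HasExpansions v κ A s⁻¹) : s ≠ 0 :=
  fun h0 ↦ h.ne_zero (by rw [h0, inv_zero])

theorem HasExpansions.one_lt_val {s : L} (h : HasExpansions v κ A s⁻¹) : 1 < v s := by
  have := h.lt_one
  rw [map_inv₀] at this
  exact (inv_lt_one₀ ((Valuation.pos_iff v).2 h.ne_zero_of_inv)).1 this

theorem sub_inv_lt {y s : L} (h : v (y - s) < v s) (hs : s ≠ 0) : v (y⁻¹ - s⁻¹) < v s⁻¹ := by
  have h1 := val_eq_of_sub_lt' h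
  have hvs := (Valuation.pos_iff v).2 hs
  have hy : y ≠ 0 := by rw [← Valuation.pos_iff v, h1]; exact hvs
  rw [inv_sub_inv hy hs, map_div₀, map_mul, h1, map_inv₀, Valuation.map_sub_swap,
    div_lt_iff₀ (mul_pos hvs hvs), inv_mul_cancel_left₀ hvs.ne']
  exact h

/-- A totally ramified extension generated by an element `y` such that `y ^ e` has the
same leading term as the inverse `s` of a uniformizer. -/
theorem IsLaurent.adjoin_pole {s y : L} {e : ℕ} (hA : IsLaurent v κ A s⁻¹) (he : 0 < e)
    (hy : v (y ^ e - s) < v s) [FiniteDimensional A A⟮y⟯] (hle : Module.finrank A A⟮y⟯ ≤ e) :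
    IsLaurent v κ (adjoinElement A y) y⁻¹ ∧ Module.finrank A A⟮y⟯ = e ∧
    ∀ b ∈ adjoinElement A y, v b ≤ 1 →
      ∃ P : (intRing v A)[X], b = P.eval₂ (intRing v A).subtype y⁻¹ := by
  have hs : s ≠ 0 := hA.ne_zero_of_inv
  have h1 : v (y⁻¹ ^ e - κ 1 * s⁻¹) < v s⁻¹ := by
    rw [map_one, one_mul, inv_pow]
    exact sub_inv_lt hy hs
  have h2 := hA.val_pow_of_sub_lt one_ne_zero h1
  have hE : adjoinElement A y = adjoinElement A y⁻¹ := by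
    simp only [adjoinElement, adjoin_inv_eq]
  rw [hE]
  rw [← adjoin_inv_eq A y] at hle ⊢
  have hfd : FiniteDimensional A A⟮y⁻¹⟯ := by rw [adjoin_inv_eq]; infer_instance
  exact ⟨IsLaurent.adjoin hA.toHasExpansions he h2 hA one_ne_zero h1 hle,
    le_antisymm hle (hA.toHasExpansions.le_finrank he h2),
    fun b hb hvb ↦ hA.toHasExpansions.exists_polynomial he h2 hle hb hvb⟩

theorem finrank_adjoin_le {y : L} {g : A[X]} (hg : g.Monic) (hy : aeval y g = 0) :
    FiniteDimensional A A⟮y⟯ ∧ Module.finrank A A⟮y⟯ ≤ g.natDegree := by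
  have hint : IsIntegral A y := ⟨g, hg, hy⟩
  refine ⟨adjoin.finiteDimensional hint, ?_⟩
  rw [adjoin.finrank hint]
  exact natDegree_le_of_dvd (minpoly.dvd A y hy) hg.ne_zero

/-! ### Steps with an additive polynomial -/

/-- `B / A` is generated by a root `y` of the additive polynomial `∏ (Y + w)`, minus the inverse `s`
of a uniformizer of `A`, where `w` runs over a subgroup of order `N` of the constants. -/
def IsAdditiveStep (v : Valuation L Γ) (κ : K →+* L) (A B : Subfield L) (N : ℕ) (y : L) : Prop :=
  ∃ (S : AddSubgroup K) (W : Finset K) (s : L), (∀ w, w ∈ W ↔ w ∈ S) ∧ W.card = N ∧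
    IsLaurent v κ A s⁻¹ ∧ ∏ w ∈ W, (y + κ w) = s ∧ B = adjoinElement A y

/-- An Artin–Schreier step: `B = A(y)` where `y ^ p - y` is the inverse of a uniformizer of
`A`. -/
def IsASStep (v : Valuation L Γ) (κ : K →+* L) (p : ℕ) (A B : Subfield L) : Prop :=
  ∃ y s : L, IsLaurent v κ A s⁻¹ ∧ y ^ p - y = s ∧ B = adjoinElement A y

theorem val_prod_add_sub_pow (hκ : ∀ c, v (κ c) ≤ 1) (W : Finset K) {y : L} (hy : 1 < v y) :
    v (∏ w ∈ W, (y + κ w) - y ^ W.card) < v (y ^ W.card) := by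
  classical
  induction W using Finset.induction_on with
  | empty => simp
  | insert a W ha ih =>
    rw [Finset.prod_insert ha, Finset.card_insert_of_notMem ha, pow_succ']
    have h0 := val_eq_of_sub_lt' ih
    have hy0 : 0 < v y := zero_lt_one.trans hy
    have hpos : 0 < v (y ^ W.card) := by rw [map_pow]; exact pow_pos hy0 _
    rw [show (y + κ a) * ∏ w ∈ W, (y + κ w) - y * y ^ W.card =
      y * (∏ w ∈ W, (y + κ w) - y ^ W.card) + κ a * ∏ w ∈ W, (y + κ w) by ring]
    rw [map_mul]
    refine Valuation.map_add_lt v ?_ ?_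
    · rw [map_mul]; exact mul_lt_mul_of_pos_left ih hy0
    · rw [map_mul, h0]
      exact mul_lt_mul_of_pos_right ((hκ a).trans_lt hy) hpos

section Step

variable {S : AddSubgroup K} {W : Finset K} {s y : L} (hS : ∀ w, w ∈ W ↔ w ∈ S)
  (hA : IsLaurent v κ A s⁻¹) (hy : ∏ w ∈ W, (y + κ w) = s)
include hS hA hy

set_option linter.unusedSectionVars false

theorem additive_one_lt : 1 < v y := by
  by_contra! h
  have h1 : v s ≤ 1 := by
    rw [← hy, map_prod]
    exact Finset.prod_le_one' fun w _ ↦ (Valuation.map_add _ _ _).trans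
      (max_le h (hA.val_const_le w))
  exact absurd hA.one_lt_val (not_lt.2 h1)

theorem additive_pow_sub_lt : v (y ^ W.card - s) < v s := by
  have h := val_prod_add_sub_pow hA.val_const_le W (additive_one_lt hS hA hy)
  rw [hy] at h
  rw [val_eq_of_sub_lt' h, Valuation.map_sub_swap]
  exact h

theorem additive_card_pos : 0 < W.card := Finset.card_pos.2 ⟨0, (hS 0).2 S.zero_mem⟩

/-- The polynomial `∏ (X + w) - s`. -/
theorem additive_exists_polynomial : ∃ g : A[X], g.Monic ∧ g.natDegree = W.card ∧
    ∀ x : L, aeval x g = ∏ w ∈ W, (x + κ w) - s := by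
  have hs : s ∈ A := by simpa using A.inv_mem hA.mem
  have hm : (∏ w ∈ W, (X + C (⟨κ w, hA.const w⟩ : A))).Monic :=
    monic_prod_of_monic _ _ fun w _ ↦ monic_X_add_C _
  have hd : (∏ w ∈ W, (X + C (⟨κ w, hA.const w⟩ : A))).natDegree = W.card := by
    rw [natDegree_prod_of_monic _ _ fun w _ ↦ monic_X_add_C _]
    simp
  have hlt : (C (⟨s, hs⟩ : A)).degree < (∏ w ∈ W, (X + C (⟨κ w, hA.const w⟩ : A))).degree := by
    rw [degree_eq_natDegree hm.ne_zero, hd]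
    refine degree_C_le.trans_lt ?_
    exact_mod_cast additive_card_pos hS hA hy
  refine ⟨∏ w ∈ W, (X + C (⟨κ w, hA.const w⟩ : A)) - C ⟨s, hs⟩, hm.sub_of_left hlt, ?_, ?_⟩
  · rw [natDegree_sub_C, hd]
  · intro x
    simp [map_prod]
    rfl

theorem additive_finrank_le : FiniteDimensional A A⟮y⟯ ∧ Module.finrank A A⟮y⟯ ≤ W.card := by
  obtain ⟨g, hg, hd, hx⟩ := additive_exists_polynomial hS hA hy
  rw [← hd]
  exact finrank_adjoin_le hg (by rw [hx, hy, sub_self])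

theorem additive_adjoin : IsLaurent v κ (adjoinElement A y) y⁻¹ ∧
    Module.finrank A A⟮y⟯ = W.card ∧ ∀ b ∈ adjoinElement A y, v b ≤ 1 →
      ∃ P : (intRing v A)[X], b = P.eval₂ (intRing v A).subtype y⁻¹ := by
  obtain ⟨h1, h2⟩ := additive_finrank_le hS hA hy
  exact hA.adjoin_pole (additive_card_pos hS hA hy) (additive_pow_sub_lt hS hA hy) h2

/-- Since W is a group, the conjugates of y are its translates by constants; they are distinct and
lie in A(y), which is therefore a splitting field of a separable polynomial. -/
theorem additive_isGalois : IsGalois A A⟮y⟯ := by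
  classical
  obtain ⟨g, hg, hd, hx⟩ := additive_exists_polynomial hS hA hy
  have hinj : Function.Injective fun w ↦ y + κ w := fun a b hab ↦ κ.injective (add_left_cancel hab)
  have hmap : g.map (algebraMap A L) = ∏ x ∈ W.image fun w ↦ y + κ w, (X - C x) := by
    refine monic_eq_prod_of_roots (hg.map _) _ ?_ ?_
    · intro x hxW
      obtain ⟨w₀, hw₀, rfl⟩ := Finset.mem_image.1 hxW
      rw [eval_map_algebraMap, hx, sub_eq_zero, ← hy]
      refine Finset.prod_bij (fun w _ ↦ w₀ + w) ?_ ?_ ?_ ?_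
      · intro w hw
        exact (hS _).2 (S.add_mem ((hS _).1 hw₀) ((hS _).1 hw))
      · intro a _ b _ hab
        exact add_left_cancel hab
      · intro b hb
        exact ⟨b - w₀, (hS _).2 (S.sub_mem ((hS _).1 hb) ((hS _).1 hw₀)), by ring⟩
      · intro w _
        rw [map_add]; ring
    · rw [hg.natDegree_map, hd, Finset.card_image_of_injective _ hinj]
  have hsplit : (g.map (algebraMap A L)).Splits := by
    rw [hmap]
    exact Splits.prod fun x _ ↦ Splits.X_sub_C x
  have hsep : g.Separable := by
    rw [← separable_map (algebraMap A L), hmap, separable_prod_X_sub_C_iff']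
    exact fun _ _ _ _ h ↦ h
  have hroots : adjoin A (g.rootSet L) = A⟮y⟯ := by
    refine le_antisymm ?_ ?_
    · rw [adjoin_le_iff]
      intro x hxr
      rw [mem_rootSet, ← eval_map_algebraMap, hmap, eval_prod] at hxr
      obtain ⟨z, hz, hz0⟩ := Finset.prod_eq_zero_iff.1 hxr.2
      obtain ⟨w, -, rfl⟩ := Finset.mem_image.1 hz
      simp only [eval_sub, eval_X, eval_C, sub_eq_zero] at hz0
      rw [hz0]
      exact add_mem (mem_adjoin_simple_self A y) (le_adjoinElement A y (hA.const w))
    · rw [adjoin_simple_le_iff]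
      refine subset_adjoin A _ ((mem_rootSet).2 ⟨hg.ne_zero, ?_⟩)
      rw [hx, hy, sub_self]
  have := adjoin_rootSet_isSplittingField hsplit
  have := IsGalois.of_separable_splitting_field (E := adjoin A (g.rootSet L)) hsep
  rwa [hroots] at this

end Step

/-- Induction on the order of the root group. For a nonzero root w₀, the factors of one coset of 𝔽_p
w₀ multiply to a single factor y₁ + w', with y₁ = y^p - w₀^(p-1) y. So y₁ satisfies an equation of
the same kind with a group smaller by the factor p, and y is obtained from y₁ by one Artin–Schreier
step. -/
theorem additive_chain (p : ℕ) [Fact p.Prime] [CharP K p] [CharP L p] (N : ℕ) :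
    ∀ (S : AddSubgroup K) (W : Finset K) (s y : L), W.card = N → (∀ w, w ∈ W ↔ w ∈ S) →
    IsLaurent v κ A s⁻¹ → ∏ w ∈ W, (y + κ w) = s →
    Relation.ReflTransGen (IsASStep v κ p) A (adjoinElement A y) := by
  classical
  induction N using Nat.strong_induction_on with
  | _ N ih =>
  intro S W s y hN hS hA hy
  have hp : p.Prime := Fact.out
  by_cases hW : ∃ w ∈ W, w ≠ 0
  swap
  · push Not at hW
    have : W = {0} := by
      ext w
      rw [Finset.mem_singleton]
      exact ⟨hW w, fun h ↦ h ▸ (hS 0).2 S.zero_mem⟩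
    rw [this] at hy
    have hyA : y ∈ A := by
      simp at hy
      rw [hy]; simpa using A.inv_mem hA.mem
    have : adjoinElement A y = A :=
      le_antisymm (adjoinElement_le le_rfl hyA) (le_adjoinElement A y)
    rw [this]
  obtain ⟨w₀, hw₀, hne⟩ := hW
  -- The additive map with kernel 𝔽_p w₀; its image on the roots is the root group for y₁.
  let θ : K →+ K :=
    { toFun := fun w ↦ w ^ p - w₀ ^ (p - 1) * w
      map_zero' := by simp [hp.ne_zero]
      map_add' := fun a b ↦ by rw [add_pow_char]; ring }
  have hθ : ∀ w, θ w = w ^ p - w₀ ^ (p - 1) * w := fun _ ↦ rfl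
  have hnat : ∀ (w : K) (i : ℕ), w ∈ W → w - i * w₀ ∈ W := fun w i hw ↦
    (hS _).2 (S.sub_mem ((hS _).1 hw) (by
      rw [← nsmul_eq_mul]; exact S.nsmul_mem ((hS _).1 hw₀) i))
  have hθ0 : θ w₀ = 0 := by
    rw [hθ, ← pow_succ, Nat.sub_add_cancel hp.one_le, sub_self]
  have hθi : ∀ (w : K) (i : ℕ), θ (w - i * w₀) = θ w := by
    intro w i
    rw [map_sub, ← nsmul_eq_mul, map_nsmul, hθ0, nsmul_zero, sub_zero]
  have hinj : ∀ w : K, Set.InjOn (fun i : ℕ ↦ w - i * w₀) (Finset.range p) := by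
    intro w a ha b hb hab
    rw [Finset.coe_range, Set.mem_Iio] at ha hb
    have : (a : K) = b := mul_right_cancel₀ hne (sub_right_injective hab)
    rw [CharP.natCast_eq_natCast K p] at this
    exact Nat.ModEq.eq_of_lt_of_lt this ha hb
  have hfib : ∀ w₁ ∈ W, W.filter (fun w ↦ θ w = θ w₁) =
      (Finset.range p).image fun i : ℕ ↦ w₁ - i * w₀ := by
    intro w₁ hw₁
    ext w
    rw [Finset.mem_filter, Finset.mem_image]
    constructor
    · rintro ⟨hw, heq⟩
      have h0 : θ (w₁ - w) = 0 := by rw [map_sub, heq, sub_self]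
      rw [hθ, ← prod_sub_natCast_mul, Finset.prod_eq_zero_iff] at h0
      obtain ⟨i, hi, hi0⟩ := h0
      exact ⟨i, hi, by linear_combination hi0⟩
    · rintro ⟨i, -, rfl⟩
      exact ⟨hnat _ _ hw₁, hθi _ _⟩
  set y₁ := y ^ p - κ w₀ ^ (p - 1) * y with hy₁
  have hprod : ∏ w' ∈ W.image θ, (y₁ + κ w') = s := by
    rw [← hy, ← Finset.prod_fiberwise_of_maps_to (s := W) (t := W.image θ) (g := θ)
      fun w hw ↦ Finset.mem_image_of_mem _ hw]
    refine Finset.prod_congr rfl fun w' hw' ↦ ?_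
    obtain ⟨w₁, hw₁, rfl⟩ := Finset.mem_image.1 hw'
    rw [hfib w₁ hw₁, Finset.prod_image (hinj w₁)]
    have := prod_sub_natCast_mul p (y + κ w₁) (κ w₀)
    rw [add_pow_char] at this
    rw [hθ, hy₁]
    simp only [map_sub, map_mul, map_pow, map_natCast, ← add_sub_assoc]
    rw [this]; ring
  have hcard : W.card = (W.image θ).card * p := by
    rw [Finset.card_eq_sum_card_fiberwise (s := W) (t := W.image θ) (f := θ)
      fun w hw ↦ Finset.mem_image_of_mem _ hw, Finset.sum_const_nat]
    intro w' hw'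
    obtain ⟨w₁, hw₁, rfl⟩ := Finset.mem_image.1 hw'
    rw [hfib w₁ hw₁, Finset.card_image_of_injOn (hinj w₁), Finset.card_range]
  have hSm : ∀ w, w ∈ W.image θ ↔ w ∈ S.map θ := by
    intro w
    rw [Finset.mem_image, AddSubgroup.mem_map]
    exact ⟨fun ⟨a, h1, h2⟩ ↦ ⟨a, (hS a).1 h1, h2⟩, fun ⟨a, h1, h2⟩ ↦ ⟨a, (hS a).2 h1, h2⟩⟩
  have hcpos := additive_card_pos hSm hA hprod
  have hlt : (W.image θ).card < N := by
    rw [← hN, hcard]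
    exact lt_mul_of_one_lt_right hcpos hp.one_lt
  refine (ih _ hlt (S.map θ) (W.image θ) s y₁ rfl hSm hA hprod).tail ?_
  obtain ⟨hL, -, -⟩ := additive_adjoin hSm hA hprod
  have hκ0 : κ w₀ ≠ 0 := (map_ne_zero κ).2 hne
  have hκm := hL.const w₀
  have hy₁m := self_mem_adjoinElement A y₁
  have hmem : y₁ / κ w₀ ^ p ∈ adjoinElement A y₁ :=
    Subfield.div_mem _ hy₁m (Subfield.pow_mem _ hκm p)
  -- Rescaling by w₀ turns y^p - w₀^(p-1) y = y₁ into an Artin–Schreier equation and multiplies the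
  -- right side by a constant only.
  refine ⟨y / κ w₀, y₁ / κ w₀ ^ p, hL.of_val_eq (Subfield.inv_mem _ hmem) ?_, ?_, ?_⟩
  · rw [map_inv₀, map_div₀, map_pow, hL.val_const _ hne, one_pow, div_one, map_inv₀]
  · have : κ w₀ ^ p = κ w₀ ^ (p - 1) * κ w₀ := by
      rw [← pow_succ]; congr 1; have := hp.one_le; omega
    rw [hy₁, sub_div, div_pow]
    congr 1
    rw [this]
    field_simp
  · refine le_antisymm ?_ ?_
    · refine adjoinElement_le ((le_adjoinElement _ _).trans (le_adjoinElement _ _)) ?_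
      have h1 := self_mem_adjoinElement (adjoinElement A y₁) (y / κ w₀)
      have h2 := Subfield.mul_mem _ h1 (le_adjoinElement _ (y / κ w₀) hκm)
      rwa [div_mul_cancel₀ _ hκ0] at h2
    · have hκy : κ w₀ ∈ adjoinElement A y := le_adjoinElement _ _ (hA.const w₀)
      have hyy := self_mem_adjoinElement A y
      refine adjoinElement_le (adjoinElement_le (le_adjoinElement _ _) ?_) ?_
      · exact Subfield.sub_mem _ (Subfield.pow_mem _ hyy _)
          (Subfield.mul_mem _ (Subfield.pow_mem _ hκy _) hyy)
      · exact Subfield.div_mem _ hyy hκy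

end Local

/-! ### Artin–Schreier steps: diamonds and invariants -/

section Local

open Polynomial IntermediateField

variable {L Γ K : Type*} [Field L] [LinearOrderedCommGroupWithZero Γ] [Field K]
variable {v : Valuation L Γ} {κ : K →+* L} {A B C : Subfield L} {π ϖ : L}

theorem HasExpansions.val_unique (h : HasExpansions v κ A π) {π' : L}
    (h' : HasExpansions v κ A π') : v π = v π' :=
  le_antisymm (h'.val_le_of_lt_one h.mem h.lt_one) (h.val_le_of_lt_one h'.mem h'.lt_one)

theorem HasExpansions.val_le_one_of_lt {s : L} (h : HasExpansions v κ A s⁻¹) {a : L} (ha : a ∈ A)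
    (hlt : v a < v s) : v a ≤ 1 := by
  have hs := (Valuation.pos_iff v).2 h.ne_zero_of_inv
  have h1 : v (a * s⁻¹) < 1 := by
    rw [map_mul, map_inv₀]; exact (mul_inv_lt_iff₀ hs).2 (by rwa [one_mul])
  have h2 := h.val_le_of_lt_one (A.mul_mem ha h.mem) h1
  rw [map_mul] at h2
  exact le_of_mul_le_mul_right (by rwa [one_mul]) ((Valuation.pos_iff v).2 h.ne_zero)

theorem val_le_one_of_pow_sub {y : L} {n : ℕ} (hn : 1 < n) (h : v (y ^ n - y) ≤ 1) : v y ≤ 1 := by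
  by_contra! h1
  have h2 : v y < v (y ^ n) := by
    rw [map_pow]; exact lt_self_pow₀ h1 hn
  rw [Valuation.map_sub_eq_of_lt_left v h2] at h
  exact absurd (h1.trans h2) (not_lt.2 h)

theorem val_pow_sub_of_one_lt {y : L} {n : ℕ} (hn : 1 < n) (h : 1 < v y) :
    v (y ^ n - y) = v y ^ n := by
  rw [Valuation.map_sub_eq_of_lt_left v (by rw [map_pow]; exact lt_self_pow₀ h hn), map_pow]

theorem asStep_adjoin {p : ℕ} (hp : 1 < p) {y s : L} (hA : IsLaurent v κ A s⁻¹)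
    (hy : y ^ p - y = s) :
    IsLaurent v κ (adjoinElement A y) y⁻¹ ∧ Module.finrank A A⟮y⟯ = p ∧ v y ^ p = v s := by
  have hs : s ∈ A := by simpa using A.inv_mem hA.mem
  have hvy : 1 < v y := by
    by_contra! h
    have : v s ≤ 1 := by
      rw [← hy]
      refine (Valuation.map_sub _ _ _).trans (max_le ?_ h)
      rw [map_pow]; exact pow_le_one' h p
    exact absurd hA.one_lt_val (not_lt.2 this)
  have hvs : v y ^ p = v s := by rw [← hy, val_pow_sub_of_one_lt hp hvy]
  have h1 : v (y ^ p - s) < v s := by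
    rw [← hy, sub_sub_cancel, hy, ← hvs]
    exact lt_self_pow₀ hvy hp
  have hdeg : (X + C ⟨s, hs⟩ : A[X]).degree < p := by
    rw [degree_X_add_C]; exact_mod_cast hp
  obtain ⟨h2, h3⟩ := finrank_adjoin_le (y := y) (monic_X_pow_sub (p := X + C (⟨s, hs⟩ : A))
    hdeg) (by
      simp only [map_sub, map_add, map_pow, aeval_X, aeval_C]
      change y ^ p - (y + s) = 0
      rw [← hy]; ring)
  have hnat : (X ^ p - (X + C (⟨s, hs⟩ : A)) : A[X]).natDegree = p := by
    refine natDegree_eq_of_degree_eq_some ?_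
    rw [degree_sub_eq_left_of_degree_lt (by rwa [degree_X_pow]), degree_X_pow]
  rw [hnat] at h3
  obtain ⟨h4, h5, -⟩ := hA.adjoin_pole (by omega) h1 h3
  exact ⟨h4, h5, hvs⟩

theorem adjoinElement_comm (A : Subfield L) (x y : L) :
    adjoinElement (adjoinElement A x) y = adjoinElement (adjoinElement A y) x := by
  have key : ∀ x y : L, adjoinElement (adjoinElement A x) y ≤ adjoinElement (adjoinElement A y) x :=
    fun x y ↦ adjoinElement_le
      (adjoinElement_le ((le_adjoinElement A y).trans (le_adjoinElement _ x))
        (self_mem_adjoinElement _ x)) (le_adjoinElement _ x (self_mem_adjoinElement A y))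
  exact le_antisymm (key x y) (key y x)

theorem adjoinElement_eq_self {y : L} (hy : y ∈ A) : adjoinElement A y = A :=
  le_antisymm (adjoinElement_le le_rfl hy) (le_adjoinElement A y)

theorem adjoinElement_sub {y a : L} (ha : a ∈ A) : adjoinElement A (y - a) = adjoinElement A y := by
  refine le_antisymm (adjoinElement_le (le_adjoinElement A y) (Subfield.sub_mem _
    (self_mem_adjoinElement A y) (le_adjoinElement A y ha))) (adjoinElement_le
    (le_adjoinElement A _) ?_)
  have := Subfield.add_mem _ (self_mem_adjoinElement A (y - a)) (le_adjoinElement A (y - a) ha)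
  rwa [sub_add_cancel] at this

/-- Both right sides have simple poles, so s' - c s is integral for some constant c. With γ^p = c,
the element y' - γ y solves an Artin–Schreier equation over A(y) whose right side is integral plus
(γ - c) y. If γ = c, Hensel's lemma puts it in A(y); otherwise the right side again has a simple
pole, because 1/y is a uniformizer of A(y). -/
theorem asStep_diamond_aux (hL : HasExpansions v κ ⊤ ϖ) [IsAlgClosed K] {p : ℕ} [Fact p.Prime]
    [CharP L p] {y s y' s' : L} (hA : IsLaurent v κ A s⁻¹) (hy : y ^ p - y = s)
    (hA' : IsLaurent v κ A s'⁻¹) (hy' : y' ^ p - y' = s') :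
    Relation.ReflGen (IsASStep v κ p) (adjoinElement A y)
      (adjoinElement (adjoinElement A y) y') := by
  have hp : p.Prime := Fact.out
  obtain ⟨hB, -, hvy⟩ := asStep_adjoin hp.one_lt hA hy
  set B := adjoinElement A y with hBdef
  have hs0 := hA.ne_zero_of_inv
  have hs : s ∈ A := by simpa using A.inv_mem hA.mem
  have hs' : s' ∈ A := by simpa using A.inv_mem hA'.mem
  have hvs0 := (Valuation.pos_iff v).2 hs0
  have hvs : v s' = v s := by
    have := hA.val_unique hA'.toHasExpansions
    rw [map_inv₀, map_inv₀] at this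
    exact (inv_injective this).symm
  obtain ⟨c, hc⟩ := hA.exists_residue (A.div_mem hs' hs)
    (by rw [map_div₀, hvs, div_self hvs0.ne'])
  have h1 : v (s' - κ c * s) ≤ 1 := by
    refine hA.val_le_one_of_lt (A.sub_mem hs' (A.mul_mem (hA.const c) hs)) ?_
    rw [show s' - κ c * s = (s' / s - κ c) * s by field_simp, map_mul]
    exact mul_lt_of_lt_one_left hvs0 hc
  -- Subtracting γ y removes the pole c s at the cost of the much smaller term (γ - c) y.
  obtain ⟨γ, hγ⟩ := IsAlgClosed.exists_pow_nat_eq c hp.pos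
  have hyB : y ∈ B := self_mem_adjoinElement A y
  have hκB := hB.const
  set S := (s' - κ c * s) + κ (γ - c) * y with hS
  have hSB : S ∈ B := B.add_mem (le_adjoinElement A y (A.sub_mem hs' (A.mul_mem (hA.const c) hs)))
    (B.mul_mem (hκB _) hyB)
  have hyS : (y' - κ γ * y) ^ p - (y' - κ γ * y) = S := by
    rw [sub_pow_char, mul_pow, ← map_pow, hγ, hS, ← hy, ← hy', map_sub]; ring
  rw [← adjoinElement_sub (A := B) (B.mul_mem (hκB γ) hyB)]
  have h1y := hB.one_lt_val
  by_cases hγc : γ = c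
  · have hvS : v S ≤ 1 := by
      rw [hS, hγc, sub_self, map_zero, zero_mul, add_zero]; exact h1
    rw [← hyS] at hvS
    have hle := val_le_one_of_pow_sub hp.one_lt hvS
    have hmem : y' - κ γ * y ∈ B := by
      refine hB.mem_of_root hL le_top (X ^ p - X - C ⟨S, hSB, hyS ▸ hvS⟩) (Subfield.mem_top _) hle
        ?_ ?_
      · simp only [eval₂_sub, eval₂_pow, eval₂_X, eval₂_C]
        change _ - S = 0
        rw [hyS, sub_self]
      · simp [derivative_X_pow]
    rw [adjoinElement_eq_self hmem]
  · have hne : γ - c ≠ 0 := sub_ne_zero.2 hγc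
    have h2 : v (κ (γ - c) * y) = v y := by rw [map_mul, hB.val_const _ hne, one_mul]
    have hvS : v S = v y := by
      rw [hS, Valuation.map_add_eq_of_lt_right v (by rw [h2]; exact h1.trans_lt h1y), h2]
    refine Relation.ReflGen.single ⟨_, S, hB.of_val_eq (B.inv_mem hSB) ?_, hyS, rfl⟩
    rw [map_inv₀, map_inv₀, hvS]

/-- The common extension is the compositum. One side takes at most one step, as the Church–Rosser
theorem demands; this replaces a ramification theory for composita of weakly ramified extensions. -/
theorem asStep_diamond (hL : HasExpansions v κ ⊤ ϖ) [IsAlgClosed K] {p : ℕ} [Fact p.Prime]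
    [CharP L p] (hB : IsASStep v κ p A B) (hC : IsASStep v κ p A C) :
    ∃ D, Relation.ReflGen (IsASStep v κ p) B D ∧ Relation.ReflTransGen (IsASStep v κ p) C D := by
  obtain ⟨y, s, hA, hy, rfl⟩ := hB
  obtain ⟨y', s', hA', hy', rfl⟩ := hC
  refine ⟨_, asStep_diamond_aux hL hA hy hA' hy', ?_⟩
  rw [adjoinElement_comm]
  exact (asStep_diamond_aux hL hA' hy' hA hy).to_reflTransGen

/-! ### Derivations -/

section Deriv

variable (D : Derivation ℤ L L) (hDκ : ∀ c, D (κ c) = 0) (hL : HasExpansions v κ ⊤ ϖ)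
  (hD : ∀ a, v (D a) ≤ v a * (v ϖ)⁻¹) (h : HasExpansions v κ A π)

include hDκ h

set_option linter.unusedSectionVars false

theorem val_deriv_monomial {c : K} (hc : c ≠ 0) (m : ℤ) :
    v (D (κ c * π ^ m)) * v π = v (m : L) * (v π ^ m * v (D π)) := by
  have hp := h.pos.ne'
  rw [D.leibniz, hDκ, smul_zero, add_zero, D.leibniz_zpow, zsmul_eq_mul, smul_eq_mul, smul_eq_mul, map_mul, map_mul,
    map_mul, h.val_const c hc, one_mul, map_zpow₀, zpow_sub_one₀ hp]
  rw [mul_assoc, mul_assoc, mul_assoc]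
  congr 2
  rw [mul_comm (v (D π)), inv_mul_cancel_left₀ hp]

theorem val_intCast_le (m : ℤ) : v (m : L) ≤ 1 := by
  rw [← map_intCast κ]; exact h.val_const_le _

include hL hD

/-- A continuous derivation satisfies `v (D a / a) ≤ v (D π / π)` on the subfield `A`. -/
theorem val_deriv_le {a : L} (ha : a ∈ A) : v (D a) * v π ≤ v a * v (D π) := by
  by_cases ha0 : a = 0
  · simp [ha0]
  -- Here b is what remains of a after leading monomials have been removed; the removed monomials
  -- satisfy the bound by the Leibniz rule.
  have key : ∀ N : ℕ, ∃ b ∈ A, v b ≤ v a * v π ^ N ∧ v (D (a - b)) * v π ≤ v a * v (D π) := by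
    intro N
    induction N with
    | zero => exact ⟨a, ha, by simp, by simp⟩
    | succ N ih =>
      obtain ⟨b, hb, hvb, hDb⟩ := ih
      by_cases hb0 : b = 0
      · exact ⟨0, A.zero_mem, by simp, by rwa [hb0] at hDb⟩
      obtain ⟨m, c, hc, hlt, hm⟩ := h.exists_monomial hb hb0
      have hmem := A.sub_mem hb (A.mul_mem (h.const c) (A.zpow_mem h.mem m))
      have hvb0 := (Valuation.pos_iff v).2 hb0
      refine ⟨b - κ c * π ^ m, hmem, ?_, ?_⟩
      · have h1 : v ((b - κ c * π ^ m) / b) < 1 := by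
          rw [map_div₀]; exact (div_lt_one₀ hvb0).2 hlt
        have h2 := h.val_le_of_lt_one (A.div_mem hmem hb) h1
        rw [map_div₀, div_le_iff₀ hvb0] at h2
        refine h2.trans ?_
        rw [pow_succ', mul_left_comm]
        exact mul_le_mul_right hvb _
      · rw [show a - (b - κ c * π ^ m) = (a - b) + κ c * π ^ m by ring, map_add]
        have h3 : v (D (κ c * π ^ m)) * v π ≤ v a * v (D π) := by
          rw [val_deriv_monomial D hDκ h hc, ← hm]
          refine (mul_le_of_le_one_left' (val_intCast_le D hDκ h m)).trans ?_
          refine mul_le_mul_left (hvb.trans ?_) _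
          exact mul_le_of_le_one_right' (pow_le_one' h.lt_one.le N)
        rcases le_max_iff.1 (Valuation.map_add v (D (a - b)) (D (κ c * π ^ m))) with h4 | h4
        · exact (mul_le_mul_left h4 _).trans hDb
        · exact (mul_le_mul_left h4 _).trans h3
  by_cases hDa : D a = 0
  · simp [hDa]
  have hva := (Valuation.pos_iff v).2 ha0
  have hvϖ := hL.pos
  have hne : D a * ϖ / a ≠ 0 := div_ne_zero (mul_ne_zero hDa hL.ne_zero) ha0
  -- For N this large the crude bound `hD` makes D b smaller than D a, so D (a - b) has the value of
  -- D a.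
  obtain ⟨N, hN⟩ := hL.exists_pow_lt (Subfield.mem_top _) hne
  obtain ⟨b, hb, hvb, hDb⟩ := key N
  have h1 : v (D b) < v (D a) := by
    refine (hD b).trans_lt ?_
    have h2 : v π ^ N ≤ v ϖ ^ N :=
      pow_le_pow_left' (hL.val_le_of_lt_one (Subfield.mem_top _) h.lt_one) N
    rw [map_div₀, map_mul, lt_div_iff₀ hva] at hN
    rw [mul_inv_lt_iff₀ hvϖ]
    refine (hvb.trans (mul_le_mul_right h2 _)).trans_lt ?_
    rwa [mul_comm]
  have h2 : v (D (a - b)) = v (D a) := by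
    rw [map_sub, Valuation.map_sub_eq_of_lt_left v h1]
  rwa [h2] at hDb

theorem val_deriv_eq {a : L} (ha : a ∈ A) {m : ℤ} (hm : (m : K) ≠ 0) (hva : v a = v π ^ m) :
    v (D a) * v π = v a * v (D π) := by
  refine le_antisymm (val_deriv_le D hDκ hL hD h ha) ?_
  by_cases hDπ : D π = 0
  · simp [hDπ]
  have ha0 : a ≠ 0 := by rw [← Valuation.ne_zero_iff v, hva]; exact zpow_ne_zero _ h.pos.ne'
  obtain ⟨m', c, hc, hlt, hm'⟩ := h.exists_monomial ha ha0
  have : m' = m := by rw [← h.zpow_inj, ← hm', hva]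
  subst this
  have hvm : v (m' : L) = 1 := by rw [← map_intCast κ]; exact h.val_const _ hm
  have h1 := val_deriv_monomial D hDκ h hc m'
  rw [hvm, one_mul, ← hm'] at h1
  have hDpos := (Valuation.pos_iff v).2 hDπ
  have h2 : v (D (a - κ c * π ^ m')) * v π < v (D (κ c * π ^ m')) * v π := by
    rw [h1]
    refine (val_deriv_le D hDκ hL hD h (A.sub_mem ha (A.mul_mem (h.const c)
      (A.zpow_mem h.mem _)))).trans_lt ?_
    exact mul_lt_mul_of_pos_right hlt hDpos
  have h3 := lt_of_mul_lt_mul_right h2 zero_le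
  rw [map_sub] at h3
  rw [val_eq_of_sub_lt' h3, h1]

/-- The value of D at a simple pole is thus an invariant of A. It is the quantity that
Artin–Schreier steps preserve. -/
theorem val_deriv_pole {s : L} (hs : s ∈ A) (hvs : v s = (v π)⁻¹) : v (D s) = v (D π⁻¹) := by
  have e : ∀ s ∈ A, v s = (v π)⁻¹ → v (D s) * v π = (v π)⁻¹ * v (D π) := fun s hs hvs ↦ by
    rw [val_deriv_eq D hDκ hL hD h hs (m := -1) (by simp) (by rw [hvs, zpow_neg, zpow_one]), hvs]
  have h1 := (e s hs hvs).trans (e π⁻¹ (A.inv_mem h.mem) (map_inv₀ _ _)).symm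
  exact mul_right_cancel₀ h.pos.ne' h1

end Deriv

/-- Invariants of a chain of Artin–Schreier steps. -/
theorem asChain_invariants {p : ℕ} [Fact p.Prime] [CharP L p] (D : Derivation ℤ L L)
    (hDκ : ∀ c, D (κ c) = 0) (hL : HasExpansions v κ ⊤ ϖ) (hD : ∀ a, v (D a) ≤ v a * (v ϖ)⁻¹)
    (hA : IsLaurent v κ A π) (hAB : Relation.ReflTransGen (IsASStep v κ p) A B) :
    A ≤ B ∧ ∃ π', IsLaurent v κ B π' ∧ v (D π'⁻¹) = v (D π⁻¹) ∧ ∃ m : ℕ, v π = v π' ^ p ^ m := by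
  induction hAB with
  | refl => exact ⟨le_rfl, π, hA, rfl, 0, by simp⟩
  | @tail B C _ hBC ih =>
    obtain ⟨hle, π', hB, hDπ, m, hm⟩ := ih
    obtain ⟨y, s, hs, hy, rfl⟩ := hBC
    have hp : p.Prime := Fact.out
    obtain ⟨hC, -, hvy⟩ := asStep_adjoin hp.one_lt hs hy
    have hvs := hs.val_unique hB.toHasExpansions
    have hsB : s ∈ B := by simpa using B.inv_mem hs.mem
    refine ⟨hle.trans (le_adjoinElement B y), y⁻¹, hC, ?_, m + 1, ?_⟩
    -- D kills y^p, hence D y = -D s, while y and s are simple poles of the upper and of the lower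
    -- field.
    · rw [inv_inv, ← hDπ, ← val_deriv_pole D hDκ hL hD hB.toHasExpansions hsB
        (by rw [← hvs, map_inv₀, inv_inv]), ← hy, map_sub, D.leibniz_pow]
      have : (p : ℕ) • (y ^ (p - 1) • D y) = 0 := by
        rw [nsmul_eq_mul, CharP.cast_eq_zero, zero_mul]
      rw [this, zero_sub, Valuation.map_neg]
    · rw [hm, ← hvs, map_inv₀, map_inv₀, ← hvy, pow_succ', inv_pow, inv_pow, pow_mul]

end Local

section Local

open Polynomial

variable {L Γ K : Type*} [Field L] [LinearOrderedCommGroupWithZero Γ] [Field K]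
variable {v : Valuation L Γ} {κ : K →+* L} {ϖ : L}

/-! ### The derivation with respect to a uniformizer -/

/-- The power series `f`, evaluated at `ϖ`, converges to `a`. -/
def IsSeriesSum (v : Valuation L Γ) (κ : K →+* L) (ϖ : L) (f : PowerSeries K) (a : L) : Prop :=
  ∀ n : ℕ, v (a - (f.trunc n).eval₂ κ ϖ) ≤ v ϖ ^ n

section Series

variable (h : HasExpansions v κ ⊤ ϖ)
include h

set_option linter.unusedSectionVars false

theorem val_eval₂_le_of_dvd {P : K[X]} {n : ℕ} (hP : X ^ n ∣ P) : v (P.eval₂ κ ϖ) ≤ v ϖ ^ n := by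
  obtain ⟨Q, rfl⟩ := hP
  rw [eval₂_mul, eval₂_X_pow, map_mul, map_pow]
  refine mul_le_of_le_one_right' ?_
  rw [eval₂_eq_sum_range]
  refine Valuation.map_sum_le v fun i _ ↦ ?_
  rw [map_mul, map_pow]
  exact mul_le_one' (h.val_const_le _) (pow_le_one' h.lt_one.le i)

theorem IsSeriesSum.val_sub_le {f : PowerSeries K} {a : L} (ha : IsSeriesSum v κ ϖ f a) {n : ℕ}
    {P : K[X]} (hP : ∀ m < n, P.coeff m = PowerSeries.coeff m f) :
    v (a - P.eval₂ κ ϖ) ≤ v ϖ ^ n := by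
  have h1 : v ((f.trunc n - P).eval₂ κ ϖ) ≤ v ϖ ^ n := by
    refine val_eval₂_le_of_dvd h (X_pow_dvd_iff.2 fun m hm ↦ ?_)
    rw [coeff_sub, PowerSeries.coeff_trunc, if_pos hm, hP m hm, sub_self]
  rw [show a - P.eval₂ κ ϖ = (a - (f.trunc n).eval₂ κ ϖ) + (f.trunc n - P).eval₂ κ ϖ by
    rw [eval₂_sub]; ring]
  exact (Valuation.map_add _ _ _).trans (max_le (ha n) h1)

theorem IsSeriesSum.of_polynomials {f : PowerSeries K} {a : L}
    (ha : ∀ n, ∃ P : K[X], (∀ m < n, P.coeff m = PowerSeries.coeff m f) ∧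
      v (a - P.eval₂ κ ϖ) ≤ v ϖ ^ n) : IsSeriesSum v κ ϖ f a := by
  intro n
  obtain ⟨P, hP, hn⟩ := ha n
  have h1 : v ((P - f.trunc n).eval₂ κ ϖ) ≤ v ϖ ^ n := by
    refine val_eval₂_le_of_dvd h (X_pow_dvd_iff.2 fun m hm ↦ ?_)
    rw [coeff_sub, PowerSeries.coeff_trunc, if_pos hm, hP m hm, sub_self]
  rw [show a - (f.trunc n).eval₂ κ ϖ = (a - P.eval₂ κ ϖ) + (P - f.trunc n).eval₂ κ ϖ by
    rw [eval₂_sub]; ring]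
  exact (Valuation.map_add _ _ _).trans (max_le hn h1)

theorem IsSeriesSum.val_le_one {f : PowerSeries K} {a : L} (ha : IsSeriesSum v κ ϖ f a) :
    v a ≤ 1 := by
  have := ha.val_sub_le h (n := 0) (P := 0) (by simp)
  simpa using this

theorem IsSeriesSum.add {f g : PowerSeries K} {a b : L} (ha : IsSeriesSum v κ ϖ f a)
    (hb : IsSeriesSum v κ ϖ g b) : IsSeriesSum v κ ϖ (f + g) (a + b) := by
  intro n
  rw [map_add, eval₂_add, add_sub_add_comm]
  exact (Valuation.map_add _ _ _).trans (max_le (ha n) (hb n))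

theorem IsSeriesSum.mul {f g : PowerSeries K} {a b : L} (ha : IsSeriesSum v κ ϖ f a)
    (hb : IsSeriesSum v κ ϖ g b) : IsSeriesSum v κ ϖ (f * g) (a * b) := by
  refine IsSeriesSum.of_polynomials h fun n ↦ ⟨f.trunc n * g.trunc n, fun m hm ↦ ?_, ?_⟩
  · rw [← coeff_coe, coe_mul, ← PowerSeries.coeff_mul_eq_coeff_trunc_mul_trunc f g hm]
  · rw [eval₂_mul, show a * b - (f.trunc n).eval₂ κ ϖ * (g.trunc n).eval₂ κ ϖ =
      a * (b - (g.trunc n).eval₂ κ ϖ) + (a - (f.trunc n).eval₂ κ ϖ) * (g.trunc n).eval₂ κ ϖ by ring]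
    refine (Valuation.map_add _ _ _).trans (max_le ?_ ?_)
    · rw [map_mul]
      exact (mul_le_of_le_one_left' (ha.val_le_one h)).trans (hb n)
    · rw [map_mul]
      refine (mul_le_of_le_one_right' ?_).trans (ha n)
      simpa using val_eval₂_le_of_dvd h (n := 0) (P := g.trunc n) (by simp)

theorem isSeriesSum_coe (P : K[X]) : IsSeriesSum v κ ϖ (P : PowerSeries K) (P.eval₂ κ ϖ) :=
  IsSeriesSum.of_polynomials h fun n ↦ ⟨P, fun m _ ↦ (P.coeff_coe m).symm, by simp⟩

theorem IsSeriesSum.unique {f : PowerSeries K} {a b : L} (ha : IsSeriesSum v κ ϖ f a)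
    (hb : IsSeriesSum v κ ϖ f b) : a = b :=
  sub_eq_zero.1 <| h.eq_zero_of_forall_le (Subfield.mem_top _) fun n ↦ by
    rw [← sub_sub_sub_cancel_right a b ((f.trunc n).eval₂ κ ϖ)]
    exact (Valuation.map_sub _ _ _).trans (max_le (ha n) (hb n))

theorem IsSeriesSum.dvd {f : PowerSeries K} {a : L} (ha : IsSeriesSum v κ ϖ f a) {n : ℕ}
    (hn : v a ≤ v ϖ ^ n) : PowerSeries.X ^ n ∣ f := by
  rw [PowerSeries.X_pow_dvd_iff]
  intro m
  induction m using Nat.strong_induction_on with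
  | _ m ih =>
  intro hm
  by_contra h0
  have h1 := ha.val_sub_le h (n := m + 1) (P := monomial m (PowerSeries.coeff m f)) (by
    intro i hi
    rw [coeff_monomial]
    split_ifs with h2
    · rw [h2]
    · exact (ih i (by omega) (by omega)).symm)
  rw [eval₂_monomial] at h1
  have h2 : v (κ (PowerSeries.coeff m f) * ϖ ^ m) = v ϖ ^ m := by
    rw [map_mul, h.val_const _ h0, one_mul, map_pow]
  have h3 : v ϖ ^ (m + 1) < v ϖ ^ m := pow_lt_pow_right_of_lt_one₀ h.pos h.lt_one m.lt_succ_self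
  have h4 := h1.trans_lt h3
  rw [← h2] at h4
  have h5 := val_eq_of_sub_lt' h4
  rw [h2] at h5
  rw [h5] at hn
  exact absurd (hn.trans (pow_le_pow_right_of_le_one' h.lt_one.le hm)) (not_le.2 h3)

theorem IsSeriesSum.series_unique {f g : PowerSeries K} {a : L} (ha : IsSeriesSum v κ ϖ f a)
    (hb : IsSeriesSum v κ ϖ g a) : f = g := by
  have h1 : IsSeriesSum v κ ϖ (f + (-1 : K[X]) * g) (a + (-1 : K[X]).eval₂ κ ϖ * a) :=
    ha.add h ((isSeriesSum_coe h (-1)).mul h hb)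
  have h2 : a + (-1 : K[X]).eval₂ κ ϖ * a = 0 := by simp
  rw [h2] at h1
  ext n
  have h3 := PowerSeries.X_pow_dvd_iff.1 (h1.dvd h (n := n + 1) (by simp)) n n.lt_succ_self
  simpa [add_neg_eq_zero] using h3

theorem exists_series {a : L} (ha : v a ≤ 1) : ∃ f, IsSeriesSum v κ ϖ f a := by
  let S := {r : L // v r ≤ 1}
  have hstep : ∀ r : S, ∃ c : K, v ((r.1 - κ c) / ϖ) ≤ 1 := fun r ↦ by
    obtain ⟨c, hc⟩ := h.exists_residue (Subfield.mem_top _) r.2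
    refine ⟨c, ?_⟩
    rw [map_div₀]
    exact div_le_one_of_le₀ (h.val_le_of_lt_one (Subfield.mem_top _) hc) zero_le
  choose c hc using hstep
  let r : ℕ → S := fun n ↦ Nat.rec ⟨a, ha⟩ (fun _ r ↦ ⟨_, hc r⟩) n
  have hr : ∀ n, (r (n + 1)).1 = ((r n).1 - κ (c (r n))) / ϖ := fun n ↦ rfl
  refine ⟨PowerSeries.mk fun n ↦ c (r n), fun n ↦ ?_⟩
  have key : a - ((PowerSeries.mk fun n ↦ c (r n)).trunc n).eval₂ κ ϖ = (r n).1 * ϖ ^ n := by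
    induction n with
    | zero => simp [r]
    | succ n ih =>
      have h0 := h.ne_zero
      rw [PowerSeries.trunc_succ, eval₂_add, ← sub_sub, ih, hr, eval₂_monomial,
        PowerSeries.coeff_mk]
      field_simp
      ring
  rw [key, map_mul, map_pow]
  exact mul_le_of_le_one_left' (r n).2

theorem exists_series_sum (hL : IsLaurent v κ ⊤ ϖ) (f : PowerSeries K) :
    ∃ a, IsSeriesSum v κ ϖ f a := by
  obtain ⟨a, -, ha⟩ := hL.complete (fun n ↦ (f.trunc n).eval₂ κ ϖ) (fun _ ↦ Subfield.mem_top _)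
    fun n ↦ by
      rw [PowerSeries.trunc_succ, eval₂_add, add_sub_cancel_left, eval₂_monomial, map_mul, map_pow]
      exact mul_le_of_le_one_left' (h.val_const_le _)
  exact ⟨a, ha⟩

end Series

/-- `b` is the derivative of the integral element `a` with respect to `ϖ`. -/
def IsSeriesDeriv (v : Valuation L Γ) (κ : K →+* L) (ϖ a b : L) : Prop :=
  ∃ f, IsSeriesSum v κ ϖ f a ∧ IsSeriesSum v κ ϖ (PowerSeries.derivative K f) b

section Deriv

variable (h : HasExpansions v κ ⊤ ϖ)
include h

set_option linter.unusedSectionVars false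

theorem IsSeriesDeriv.add {a b a' b' : L} (h1 : IsSeriesDeriv v κ ϖ a b)
    (h2 : IsSeriesDeriv v κ ϖ a' b') : IsSeriesDeriv v κ ϖ (a + a') (b + b') := by
  obtain ⟨f, hf, hf'⟩ := h1
  obtain ⟨g, hg, hg'⟩ := h2
  exact ⟨f + g, hf.add h hg, by rw [map_add]; exact hf'.add h hg'⟩

theorem IsSeriesDeriv.mul {a b a' b' : L} (h1 : IsSeriesDeriv v κ ϖ a b)
    (h2 : IsSeriesDeriv v κ ϖ a' b') : IsSeriesDeriv v κ ϖ (a * a') (a * b' + a' * b) := by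
  obtain ⟨f, hf, hf'⟩ := h1
  obtain ⟨g, hg, hg'⟩ := h2
  refine ⟨f * g, hf.mul h hg, ?_⟩
  rw [Derivation.leibniz, smul_eq_mul, smul_eq_mul]
  exact (hf.mul h hg').add h (hg.mul h hf')

theorem IsSeriesDeriv.unique {a b b' : L} (h1 : IsSeriesDeriv v κ ϖ a b)
    (h2 : IsSeriesDeriv v κ ϖ a b') : b = b' := by
  obtain ⟨f, hf, hf'⟩ := h1
  obtain ⟨g, hg, hg'⟩ := h2
  rw [← hf.series_unique h hg] at hg'
  exact hf'.unique h hg'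

theorem isSeriesDeriv_polynomial (P : K[X]) :
    IsSeriesDeriv v κ ϖ (P.eval₂ κ ϖ) ((derivative P).eval₂ κ ϖ) :=
  ⟨P, isSeriesSum_coe h P, by rw [PowerSeries.derivative_coe]; exact isSeriesSum_coe h _⟩

theorem IsSeriesDeriv.val_le {a b : L} (h1 : IsSeriesDeriv v κ ϖ a b) {n : ℕ}
    (ha : v a ≤ v ϖ ^ (n + 1)) : v b ≤ v ϖ ^ n := by
  obtain ⟨f, hf, hf'⟩ := h1
  have h2 := hf.dvd h ha
  have h3 := hf'.val_sub_le h (n := n) (P := 0) (by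
    intro m hm
    rw [PowerSeries.coeff_derivative, PowerSeries.X_pow_dvd_iff.1 h2 _ (by omega)]; simp)
  simpa using h3

variable (hL : IsLaurent v κ ⊤ ϖ) (p : ℕ) [CharP K p] (hp : 0 < p)
include hL hp

set_option linter.unusedSectionVars false

/-- In characteristic p the power ϖ^(p m) is a constant of the derivation. Multiplying by it reduces
elements with poles to power series. -/
theorem IsSeriesDeriv.shift {a b : L} (h1 : IsSeriesDeriv v κ ϖ a b) (m : ℕ) :
    IsSeriesDeriv v κ ϖ (ϖ ^ (p * m) * a) (ϖ ^ (p * m) * b) := by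
  have h2 := isSeriesDeriv_polynomial h (X ^ (p * m) : K[X])
  rw [derivative_X_pow] at h2
  have : ((p * m : ℕ) : K) = 0 := by rw [Nat.cast_mul, CharP.cast_eq_zero, zero_mul]
  rw [this, C_0, zero_mul, eval₂_zero, eval₂_X_pow] at h2
  have h3 := h2.mul h h1
  rwa [mul_zero, add_zero] at h3

theorem exists_isSeriesDeriv (a : L) :
    ∃ b, ∃ N : ℕ, ∀ m ≥ N, IsSeriesDeriv v κ ϖ (ϖ ^ (p * m) * a) (ϖ ^ (p * m) * b) := by
  have h0 := h.ne_zero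
  obtain ⟨N, hN⟩ : ∃ N : ℕ, v (ϖ ^ (p * N) * a) ≤ 1 := by
    by_cases ha : a = 0
    · exact ⟨0, by simp [ha]⟩
    obtain ⟨m, hm⟩ := h.exists_val (Subfield.mem_top _) ha
    refine ⟨m.natAbs, ?_⟩
    rw [map_mul, map_pow, hm, ← zpow_natCast, ← zpow_add₀ h.pos.ne', ← zpow_zero (v ϖ),
      h.zpow_le_iff]
    push_cast
    have h1 : (1 : ℤ) ≤ p := by exact_mod_cast hp
    have h2 := neg_abs_le m
    have h3 := abs_nonneg m
    nlinarith
  obtain ⟨f, hf⟩ := exists_series h hN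
  obtain ⟨b, hb⟩ := exists_series_sum h hL (PowerSeries.derivative K f)
  refine ⟨(ϖ ^ (p * N))⁻¹ * b, N, fun m hm ↦ ?_⟩
  have h1 := IsSeriesDeriv.shift h hL p hp ⟨f, hf, hb⟩ (m - N)
  have e : p * m = p * (m - N) + p * N := by rw [← mul_add]; congr 1; omega
  rw [e, pow_add, mul_assoc, mul_assoc, mul_inv_cancel_left₀ (pow_ne_zero _ h0)]
  exact h1

/-- The derivation with respect to a uniformizer of a complete field. -/
theorem exists_derivation : ∃ D : Derivation ℤ L L, (∀ c, D (κ c) = 0) ∧ D ϖ = 1 ∧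
    ∀ a, v (D a) ≤ v a * (v ϖ)⁻¹ := by
  have h0 := h.ne_zero
  choose d N hd using exists_isSeriesDeriv h hL p hp
  have huniq : ∀ a b M, IsSeriesDeriv v κ ϖ (ϖ ^ (p * M) * a) (ϖ ^ (p * M) * b) → d a = b := by
    intro a b M hb
    have h1 := IsSeriesDeriv.shift h hL p hp hb (N a)
    rw [← mul_assoc, ← mul_assoc, ← pow_add, ← mul_add] at h1
    have h2 := (hd a (N a + M) (by omega)).unique h h1
    exact mul_left_cancel₀ (pow_ne_zero _ h0) h2
  have hadd : ∀ a b, d (a + b) = d a + d b := fun a b ↦ by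
    have h1 := (hd a (max (N a) (N b)) (le_max_left _ _)).add h
      (hd b (max (N a) (N b)) (le_max_right _ _))
    rw [← mul_add, ← mul_add] at h1
    exact huniq _ _ _ h1
  have hmul : ∀ a b, d (a * b) = a * d b + b * d a := fun a b ↦ by
    have h1 := (hd a _ le_rfl).mul h (hd b _ le_rfl)
    refine huniq _ _ (N a + N b) ?_
    have e : ϖ ^ (p * (N a + N b)) = ϖ ^ (p * N a) * ϖ ^ (p * N b) := by rw [mul_add, pow_add]
    convert h1 using 1 <;> rw [e] <;> ring
  have hconst : ∀ P : K[X], d (P.eval₂ κ ϖ) = (derivative P).eval₂ κ ϖ := fun P ↦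
    huniq _ _ 0 (by simpa using isSeriesDeriv_polynomial h P)
  let D₀ : L →+ L := AddMonoidHom.mk' d hadd
  refine ⟨Derivation.mk' D₀.toIntLinearMap fun a b ↦ hmul a b, fun c ↦ ?_, ?_, fun a ↦ ?_⟩
  · have := hconst (C c)
    rwa [eval₂_C, derivative_C, eval₂_zero] at this
  · have := hconst X
    rwa [eval₂_X, derivative_X, eval₂_one] at this
  · change v (d a) ≤ _
    by_cases ha : a = 0
    · have : d a = 0 := by
        have := hadd 0 0
        rw [add_zero] at this
        rw [ha]; exact left_eq_add.1 this
      simp [this]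
    obtain ⟨m, hm⟩ := h.exists_val (Subfield.mem_top _) ha
    -- M is large enough for the shifted element to have positive order n + 1; differentiation then
    -- costs at most one order.
    obtain ⟨M, hM, n, hn⟩ : ∃ M ≥ N a, ∃ n : ℕ, (p * M : ℤ) + m = n + 1 := by
      have h1 : (1 : ℤ) ≤ p := by exact_mod_cast hp
      have h2 := neg_abs_le m
      have h3 := abs_nonneg m
      have h4 : (1 : ℤ) ≤ (p * (N a + m.natAbs + 1) : ℕ) + m := by
        push_cast; nlinarith
      refine ⟨N a + m.natAbs + 1, by omega, ((p * (N a + m.natAbs + 1) : ℕ) + m - 1).toNat, ?_⟩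
      rw [Int.toNat_of_nonneg (by omega)]; push_cast; ring
    have hp' := h.pos.ne'
    have h1 := (hd a M hM).val_le h (n := n) (by
      rw [map_mul, map_pow, hm, ← zpow_natCast, ← zpow_natCast, ← zpow_add₀ hp']
      push_cast
      rw [hn])
    rw [map_mul, map_pow] at h1
    have h2 : v ϖ ^ n = v ϖ ^ (p * M) * (v a * (v ϖ)⁻¹) := by
      rw [hm, ← zpow_natCast, ← zpow_natCast, ← zpow_sub_one₀ hp', ← zpow_add₀ hp']
      congr 1; push_cast; omega
    rw [h2] at h1
    exact le_of_mul_le_mul_left h1 (pow_pos h.pos _)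

end Deriv

end Local

/-! ### The integral closure at one of its places -/

section Extension

open Polynomial

variable {L Γ K : Type*} [Field L] [LinearOrderedCommGroupWithZero Γ] [Field K]
variable {v : Valuation L Γ} {κ : K →+* L} {A : Subfield L} {π : L}

theorem val_le_one_of_integral {O : Type*} [CommRing O] [Nontrivial O] (φ : O →+* L)
    (hφ : ∀ o, v (φ o) ≤ 1) {P : O[X]} (hP : P.Monic) {x : L} (hx : P.eval₂ φ x = 0) :
    v x ≤ 1 := by
  by_contra! h1
  have hx0 : v x ≠ 0 := (zero_lt_one.trans h1).ne'
  rw [eval₂_eq_sum_range, Finset.sum_range_succ, hP.coeff_natDegree, map_one, one_mul] at hx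
  have h2 : v (∑ i ∈ Finset.range P.natDegree, φ (P.coeff i) * x ^ i) < v (x ^ P.natDegree) := by
    refine Valuation.map_sum_lt v (by rw [map_pow]; exact pow_ne_zero _ hx0) fun i hi ↦ ?_
    rw [map_mul, map_pow, map_pow]
    refine (mul_le_of_le_one_left' (hφ _)).trans_lt ?_
    exact pow_lt_pow_right₀ h1 (Finset.mem_range.1 hi)
  rw [eq_neg_of_add_eq_zero_left hx, Valuation.map_neg] at h2
  exact lt_irrefl _ h2

/-- The reduction Q of the monic equation splits over K, and Q(x) has value below 1 because P(x) =
0. If x were near no root of Q, every linear factor would have value at least 1. -/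
theorem HasExpansions.residue_of_integral [IsAlgClosed K] (h : HasExpansions v κ A π) {O : Type*}
    [CommRing O] [Nontrivial O] (φ : O →+* L) (hφA : ∀ o, φ o ∈ A) (hφ : ∀ o, v (φ o) ≤ 1)
    {P : O[X]} (hP : P.Monic) {x : L} (hx : P.eval₂ φ x = 0) : ∃ c, v (x - κ c) < 1 := by
  have hvx := val_le_one_of_integral φ hφ hP hx
  choose c hc using fun o ↦ h.exists_residue (hφA o) (hφ o)
  set Q : K[X] := ∑ l ∈ Finset.range (P.natDegree + 1), C (c (P.coeff l)) * X ^ l with hQ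
  have hQx : v (Q.eval₂ κ x) < 1 := by
    have : Q.eval₂ κ x = Q.eval₂ κ x - P.eval₂ φ x := by rw [hx, sub_zero]
    rw [this, hQ, eval₂_finsetSum, eval₂_eq_sum_range, ← Finset.sum_sub_distrib]
    refine Valuation.map_sum_lt v one_ne_zero fun l _ ↦ ?_
    rw [eval₂_mul, eval₂_C, eval₂_X_pow, ← sub_mul, map_mul, map_pow, Valuation.map_sub_swap]
    exact (mul_le_of_le_one_right' (pow_le_one' hvx l)).trans_lt (hc _)
  have hQn : Q.coeff P.natDegree = 1 := by
    rw [hQ, finsetSum_coeff, Finset.sum_eq_single P.natDegree]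
    · rw [coeff_C_mul_X_pow, if_pos rfl, hP.coeff_natDegree]
      refine h.residue_unique (hc 1) ?_
      simp
    · intro l _ hl
      rw [coeff_C_mul_X_pow, if_neg hl.symm]
    · simp
  have hQ0 : Q ≠ 0 := by rintro h0; rw [h0] at hQn; simp at hQn
  by_contra! hcon
  rw [(IsAlgClosed.splits Q).eq_prod_roots] at hQx
  rw [eval₂_mul, eval₂_C, map_mul, h.val_const _ (leadingCoeff_ne_zero.2 hQ0), one_mul] at hQx
  refine absurd hQx (not_lt.2 ?_)
  induction Q.roots using Multiset.induction_on with
  | empty => simp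
  | cons r s ih =>
    rw [Multiset.map_cons, Multiset.prod_cons, eval₂_mul, map_mul]
    refine one_le_mul ?_ ih
    rw [eval₂_sub, eval₂_X, eval₂_C]
    exact hcon r

theorem deriv_eval₂ {O : Type*} [CommRing O] (φ : O →+* L) (D : Derivation ℤ L L) (P : O[X])
    (y : L) : D (P.eval₂ φ y) =
      (∑ l ∈ Finset.range (P.natDegree + 1), D (φ (P.coeff l)) * y ^ l) +
        (derivative P).eval₂ φ y * D y := by
  have h1 : (derivative P).eval₂ φ y =
      ∑ l ∈ Finset.range (P.natDegree + 1), φ (P.coeff l) * (l * y ^ (l - 1)) := by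
    rw [derivative_apply, sum_over_range' _ (by simp) (P.natDegree + 1) (Nat.lt_succ_self _),
      eval₂_finsetSum]
    refine Finset.sum_congr rfl fun l _ ↦ ?_
    rw [eval₂_mul, eval₂_C, eval₂_X_pow, map_mul, map_natCast, mul_assoc]
  rw [h1, Finset.sum_mul, ← Finset.sum_add_distrib, eval₂_eq_sum_range, map_sum]
  refine Finset.sum_congr rfl fun l _ ↦ ?_
  rw [D.leibniz, D.leibniz_pow, smul_eq_mul, smul_eq_mul, smul_eq_mul, nsmul_eq_mul]
  ring

section

variable {F F' O : Type*} [Field F] [Field F'] [Algebra F F'] [CommRing O] [IsDomain O]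
  [Algebra O F] [IsFractionRing O F] [Algebra O F'] [IsScalarTower O F F']
  {i : F' →+* L} {ϖ : F}

/-- A generator of the prime ideal, below the valuation of `L`, of the integral closure. -/
structure IsLocalGenerator (v : Valuation L Γ) (i : F' →+* L) (O : Type*) [CommRing O]
    [Algebra O F'] (α : F') : Prop where
  isIntegral : IsIntegral O α
  ne_zero : α ≠ 0
  val_lt_one : v (i α) < 1
  dvd : ∀ b : F', IsIntegral O b → v (i b) < 1 → ∃ b', IsIntegral O b' ∧ b = α * b'

variable (hO : ∀ a : F, v (i (algebraMap F F' a)) ≤ 1 ↔ ∃ o : O, algebraMap O F o = a)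
  (hF : HasExpansions v κ (i.comp (algebraMap F F')).fieldRange (i (algebraMap F F' ϖ)))
include hO hF

set_option linter.unusedSectionVars false

theorem val_algebraMap_le (o : O) : v (i (algebraMap O F' o)) ≤ 1 := by
  rw [IsScalarTower.algebraMap_apply O F F']
  exact (hO _).2 ⟨o, rfl⟩

theorem val_le_one_of_isIntegral {b : F'} (hb : IsIntegral O b) : v (i b) ≤ 1 := by
  obtain ⟨P, hP, hPb⟩ := hb
  refine val_le_one_of_integral (i.comp (algebraMap O F')) (val_algebraMap_le hO hF) hP ?_
  rw [← hom_eval₂, hPb, map_zero]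

theorem residue_of_isIntegral [IsAlgClosed K] {b : F'} (hb : IsIntegral O b) :
    ∃ c, v (i b - κ c) < 1 := by
  obtain ⟨P, hP, hPb⟩ := hb
  refine hF.residue_of_integral (i.comp (algebraMap O F')) (fun o ↦ ?_)
    (val_algebraMap_le hO hF) hP (x := i b) ?_
  · exact ⟨algebraMap O F o, by simp [IsScalarTower.algebraMap_apply O F F']⟩
  · rw [← hom_eval₂, hPb, map_zero]

theorem exists_const (c : K) : ∃ o : O, i (algebraMap O F' o) = κ c := by
  obtain ⟨a, ha⟩ := hF.const c
  rw [RingHom.comp_apply] at ha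
  obtain ⟨o, rfl⟩ := (hO a).1 (by rw [ha]; exact hF.val_const_le c)
  exact ⟨o, by rw [IsScalarTower.algebraMap_apply O F F', ha]⟩

theorem base_uniformizer_ne_zero : ϖ ≠ 0 := by
  rintro rfl
  exact hF.ne_zero (by simp)

theorem base_exists_val {a : F} (ha : a ≠ 0) :
    ∃ m : ℤ, v (i (algebraMap F F' a)) = v (i (algebraMap F F' ϖ)) ^ m :=
  hF.exists_val ⟨a, rfl⟩ (by simpa using ha)

theorem base_isDVR : IsDiscreteValuationRing O := by
  have hinj : Function.Injective (algebraMap O F) := IsFractionRing.injective O F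
  obtain ⟨t, ht⟩ := (hO ϖ).1 hF.lt_one.le
  have hval : ∀ o : O, v (i (algebraMap F F' (algebraMap O F o))) ≤ 1 := fun o ↦ (hO _).2 ⟨o, rfl⟩
  have hunit : ∀ o : O, v (i (algebraMap F F' (algebraMap O F o))) = 1 → IsUnit o := by
    intro o ho
    have h0 : algebraMap O F o ≠ 0 := by rintro h0; simp [h0] at ho
    obtain ⟨o', ho'⟩ := (hO (algebraMap O F o)⁻¹).1 (by simp [ho])
    refine IsUnit.of_mul_eq_one o' (hinj ?_)
    rw [map_mul, ho', mul_inv_cancel₀ h0, map_one]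
  have hnonunit : ∀ o : O, ¬ IsUnit o → v (i (algebraMap F F' (algebraMap O F o))) < 1 :=
    fun o ho ↦ lt_of_le_of_ne (hval o) fun h ↦ ho (hunit o h)
  refine IsDiscreteValuationRing.ofHasUnitMulPowIrreducibleFactorization ⟨t, ⟨?_, ?_⟩, ?_⟩
  · intro hu
    obtain ⟨s, hs⟩ := hu.exists_right_inv
    have h1 := congrArg (fun o ↦ v (i (algebraMap F F' (algebraMap O F o)))) hs
    simp only [map_mul, map_one, ht] at h1
    exact ((mul_le_of_le_one_right' (hval s)).trans_lt hF.lt_one).ne h1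
  · intro a b hab
    by_contra! hcon
    have ha := hF.val_le_of_lt_one ⟨algebraMap O F a, rfl⟩ (hnonunit a hcon.1)
    have h1 := congrArg (fun o ↦ v (i (algebraMap F F' (algebraMap O F o)))) hab
    simp only [map_mul, ht] at h1
    have h2 := mul_lt_of_lt_one_right hF.pos (hnonunit b hcon.2)
    exact absurd (h1.le.trans (mul_le_mul_left ha _)) (not_le.2 h2)
  · intro x hx
    have hx0 : algebraMap O F x ≠ 0 := by rwa [Ne, map_eq_zero_iff _ hinj]
    obtain ⟨m, hm⟩ := base_exists_val hO hF hx0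
    have hm0 : 0 ≤ m := by
      have := hval x
      rw [hm, ← zpow_zero (v _), hF.zpow_le_iff] at this
      exact this
    obtain ⟨n, rfl⟩ := Int.eq_ofNat_of_zero_le hm0
    have hϖ := base_uniformizer_ne_zero hO hF
    have hquot : v (i (algebraMap F F' (algebraMap O F x / ϖ ^ n))) = 1 := by
      rw [map_div₀, map_div₀, map_div₀, hm, map_pow, map_pow, map_pow, zpow_natCast]
      exact div_self (pow_ne_zero _ hF.pos.ne')
    obtain ⟨y, hy⟩ := (hO _).1 hquot.le
    obtain ⟨u, hu⟩ := hunit y (by rw [hy]; exact hquot)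
    refine ⟨n, u, hinj ?_⟩
    rw [map_mul, map_pow, ht, hu, hy, mul_div_cancel₀ _ (pow_ne_zero _ hϖ)]

variable [FiniteDimensional F F'] [Algebra.IsSeparable F F']

/-- All maximal ideals of the integral closure lie over the one of O, so there are finitely many of
them; a Dedekind domain with this property is principal. This yields an integral generator although
the integral closure need not be local. -/
theorem exists_isLocalGenerator : ∃ α : F', IsLocalGenerator v i O α := by
  have := base_isDVR hO hF
  have hϖ := base_uniformizer_ne_zero hO hF
  let B := integralClosure O F'
  have hB : IsDedekindDomain B := integralClosure.isDedekindDomain O F F'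
  have hinjO : Function.Injective (algebraMap O F') := by
    rw [IsScalarTower.algebraMap_eq O F F']
    exact (algebraMap F F').injective.comp (IsFractionRing.injective O F)
  have htf : Module.IsTorsionFree O B := by
    refine Module.isTorsionFree_iff_algebraMap_injective.2 fun a b hab ↦ hinjO ?_
    exact congrArg Subtype.val hab
  let M := IsLocalRing.maximalIdeal O
  have hM0 : M ≠ ⊥ := IsDiscreteValuationRing.not_a_field O
  have hfin : {I : Ideal B | I.IsMaximal}.Finite := by
    refine (IsDedekindDomain.primesOver_finite M B).subset fun I hI ↦ ⟨hI.isPrime, ⟨?_⟩⟩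
    have hI' : I.IsMaximal := hI
    have : (I.under O).IsMaximal := Ideal.isMaximal_comap_of_isIntegral_of_isMaximal I
    exact (IsLocalRing.eq_maximalIdeal this).symm
  have hPID : IsPrincipalIdealRing B := IsPrincipalIdealRing.of_finite_maximals hfin
  let 𝔭 : Ideal B :=
    { carrier := {b | v (i b) < 1}
      add_mem' := fun {a b} ha hb ↦ by
        change v (i (a + b : F')) < 1
        rw [map_add]; exact Valuation.map_add_lt v ha hb
      zero_mem' := by change v (i (0 : F')) < 1; simp
      smul_mem' := fun c b hb ↦ by
        change v (i (c * b : F')) < 1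
        rw [map_mul, map_mul]
        exact (mul_le_of_le_one_left' (val_le_one_of_isIntegral hO hF c.2)).trans_lt hb }
  have hmem : ∀ b : B, b ∈ 𝔭 ↔ v (i b) < 1 := fun _ ↦ Iff.rfl
  obtain ⟨α, hα⟩ := (hPID.principal 𝔭).principal
  have hspan : ∀ b : B, v (i b) < 1 ↔ ∃ b' : B, b' * α = b := fun b ↦ by
    rw [← hmem, hα, Submodule.mem_span_singleton]; rfl
  refine ⟨α, α.2, ?_, ?_, ?_⟩
  · intro h0
    obtain ⟨t, ht⟩ := (hO ϖ).1 hF.lt_one.le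
    obtain ⟨b', hb'⟩ := (hspan (algebraMap O B t)).1 (by
      change v (i (algebraMap O F' t)) < 1
      rw [IsScalarTower.algebraMap_apply O F F', ht]; exact hF.lt_one)
    have h1 := congrArg Subtype.val hb'
    change (b' : F') * α = algebraMap O F' t at h1
    rw [h0, mul_zero, IsScalarTower.algebraMap_apply O F F', ht] at h1
    exact hϖ (by simpa using h1.symm)
  · exact (hspan α).2 ⟨1, one_mul _⟩
  · intro b hb hvb
    obtain ⟨b', hb'⟩ := (hspan ⟨b, hb⟩).1 hvb
    exact ⟨b', b'.2, by rw [mul_comm]; exact (congrArg Subtype.val hb').symm⟩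

/-- A nonzero integral element is a power of α times an integral element outside the prime; the
latter has a nonzero residue in K. Fractions of such elements then have leading monomials. -/
theorem IsLocalGenerator.hasExpansions [IsAlgClosed K] {α : F'} (hα : IsLocalGenerator v i O α) :
    HasExpansions v κ i.fieldRange (i α) := by
  have := base_isDVR hO hF
  let B := integralClosure O F'
  have hB : IsDedekindDomain B := integralClosure.isDedekindDomain O F F'
  have hfrac : IsFractionRing B F' := integralClosure.isFractionRing_of_finite_extension F F'
  have hα0 := hα.ne_zero
  have key : ∀ b : B, b ≠ 0 → ∃ (n : ℕ) (c : K) (y : F'), c ≠ 0 ∧ v (i y - κ c) < 1 ∧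
      (b : F') = α ^ n * y := by
    intro b hb
    have hnu : ¬ IsUnit (⟨α, hα.isIntegral⟩ : B) := by
      intro hu
      obtain ⟨s, hs⟩ := hu.exists_right_inv
      have h1 := congrArg (fun b : B ↦ v (i b)) hs
      change v (i (α * s)) = v (i 1) at h1
      rw [map_mul, map_mul, map_one, map_one] at h1
      exact ((mul_le_of_le_one_right' (val_le_one_of_isIntegral hO hF s.2)).trans_lt
        hα.val_lt_one).ne h1
    obtain ⟨y, hy, hny⟩ := (FiniteMultiplicity.of_not_isUnit hnu hb).exists_eq_pow_mul_and_not_dvd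
    have hvy : ¬ v (i y) < 1 := fun h ↦ by
      obtain ⟨b', hb', hyb⟩ := hα.dvd y y.2 h
      exact hny ⟨⟨b', hb'⟩, Subtype.ext hyb⟩
    obtain ⟨c, hc⟩ := residue_of_isIntegral hO hF y.2
    refine ⟨_, c, y, ?_, hc, by simpa using congrArg Subtype.val hy⟩
    rintro rfl
    simp at hc
    exact hvy hc
  refine ⟨hF.val_const, fun c ↦ ?_, ⟨α, rfl⟩, by simpa using hα0, hα.val_lt_one, ?_⟩
  · obtain ⟨a, ha⟩ := hF.const c
    exact ⟨_, ha⟩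
  · rintro _ ⟨f, rfl⟩ hf0
    have hf : f ≠ 0 := by rintro rfl; simp at hf0
    obtain ⟨b, s, hs, rfl⟩ := IsFractionRing.div_surjective (A := B) f
    have hs0 : s ≠ 0 := nonZeroDivisors.ne_zero hs
    have hb0 : b ≠ 0 := by rintro rfl; simp at hf
    obtain ⟨n, c, y, hc, hy, hbn⟩ := key b hb0
    obtain ⟨m, d, w, hd, hw, hsm⟩ := key s hs0
    have hiα : i α ≠ 0 := by simpa using hα0
    have hr := residue_mul hF.val_const hc hy (inv_ne_zero hd) (residue_inv hF.val_const hd hw)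
    have hfe : i (algebraMap B F' b / algebraMap B F' s) = i y * (i w)⁻¹ * i α ^ (n - m : ℤ) := by
      change i ((b : F') / s) = _
      rw [hbn, hsm, map_div₀, map_mul, map_mul, map_pow, map_pow, zpow_sub₀ hiα, zpow_natCast,
        zpow_natCast]
      have hw0 : i w ≠ 0 := by
        intro h0
        have hs1 : i (s : F') = 0 := by rw [hsm, map_mul, h0, mul_zero]
        rw [map_eq_zero] at hs1
        exact hs0 (Subtype.ext hs1)
      field_simp
    refine ⟨n - m, c * d⁻¹, ?_⟩
    have hv1 : v (i y * (i w)⁻¹) = 1 := by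
      have hcd := hF.val_const (c * d⁻¹) (mul_ne_zero hc (inv_ne_zero hd))
      rw [← hcd] at hr ⊢
      exact val_eq_of_sub_lt' hr
    rw [hfe, ← sub_mul, Valuation.map_mul, Valuation.map_mul v (i y * (i w)⁻¹), hv1, one_mul]
    exact mul_lt_of_lt_one_left (by
      rw [map_zpow₀]; exact zpow_pos ((Valuation.pos_iff v).2 hiα) _) hr

end

end Extension

/-! ### The complementary module and a derivation -/

section Different

open Polynomial

variable {L Γ K : Type*} [Field L] [LinearOrderedCommGroupWithZero Γ] [Field K]
variable {v : Valuation L Γ} {κ : K →+* L}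

variable {F F' O : Type*} [Field F] [Field F'] [Algebra F F'] [CommRing O] [IsDomain O]
  [Algebra O F] [IsFractionRing O F] [Algebra O F'] [IsScalarTower O F F']
  {i : F' →+* L} {ϖ : F} {α : F'}

variable (hO : ∀ a : F, v (i (algebraMap F F' a)) ≤ 1 ↔ ∃ o : O, algebraMap O F o = a)
  (hF : HasExpansions v κ (i.comp (algebraMap F F')).fieldRange (i (algebraMap F F' ϖ)))
  [FiniteDimensional F F'] [Algebra.IsSeparable F F'] [IsAlgClosed K]
  (hα : IsLocalGenerator v i O α)
include hO hF hα

set_option linter.unusedSectionVars false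

/-- Every integral element is congruent to a constant modulo α, since residues lie in K. Nakayama's
lemma over O[α], for the ideal (α) and the quotient of the integral closure by O[α], gives an
element congruent to 1 modulo α that carries the integral closure into O[α]. It is a unit at the
place, so O[α] may replace the integral closure there. -/
theorem exists_conductor : ∃ s ∈ Algebra.adjoin O {α}, ∀ b : F', IsIntegral O b →
    (1 + s * α) * b ∈ Algebra.adjoin O {α} := by
  have := base_isDVR hO hF
  let R := Algebra.adjoin O {α}
  let B : Submodule O F' := Subalgebra.toSubmodule (integralClosure O F')
  have hBfg : B.FG := by
    have : Module.Finite O (integralClosure O F') := IsIntegralClosure.finite O F F' _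
    exact Module.Finite.iff_fg.1 this
  let N : Submodule R F' := 1
  let B' : Submodule R F' := Submodule.span R (B : Set F')
  have hB'fg : B'.FG := by
    obtain ⟨S, hS⟩ := hBfg
    refine ⟨S, le_antisymm (Submodule.span_mono (by rw [← hS]; exact Submodule.subset_span)) ?_⟩
    refine Submodule.span_le.2 ?_
    rw [← hS]
    exact Submodule.span_le_restrictScalars O R (S : Set F')
  have hαR : α ∈ R := Algebra.subset_adjoin rfl
  let I : Ideal R := Ideal.span {⟨α, hαR⟩}
  have hle : B'.map N.mkQ ≤ I • B'.map N.mkQ := by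
    rw [← Submodule.map_smul'', Submodule.map_le_iff_le_comap, Submodule.span_le]
    intro b hb
    obtain ⟨c, hc⟩ := residue_of_isIntegral hO hF (b := b) hb
    obtain ⟨o, ho⟩ := exists_const hO hF c
    have hint : IsIntegral O (b - algebraMap O F' o) := IsIntegral.sub hb isIntegral_algebraMap
    obtain ⟨b', hb', hbb⟩ := hα.dvd _ hint (by rw [map_sub, ho]; exact hc)
    refine ⟨α * b', Submodule.smul_mem_smul (r := (⟨α, hαR⟩ : R))
      (Ideal.subset_span rfl) (Submodule.subset_span hb'), ?_⟩
    rw [← hbb, map_sub, sub_eq_self, Submodule.mkQ_apply, Submodule.Quotient.mk_eq_zero]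
    exact Submodule.mem_one.2 ⟨algebraMap O R o, rfl⟩
  obtain ⟨r, hr, hrN⟩ := Submodule.exists_sub_one_mem_and_smul_eq_zero_of_fg_of_le_smul I _
    (hB'fg.map _) hle
  obtain ⟨s, hs⟩ := Ideal.mem_span_singleton'.1 hr
  refine ⟨s, s.2, fun b hb ↦ ?_⟩
  have h1 := hrN (N.mkQ b) ⟨b, Submodule.subset_span hb, rfl⟩
  rw [← map_smul, Submodule.mkQ_apply, Submodule.Quotient.mk_eq_zero] at h1
  obtain ⟨y, hy⟩ := Submodule.mem_one.1 h1
  have h2 : (1 + (s : F') * α) = r := by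
    have := congrArg Subtype.val hs
    change (s : F') * α = r - 1 at this
    rw [this]; ring
  rw [h2]
  have : (r : F') * b = y := hy.symm
  rw [this]
  exact y.2

theorem val_adjoin_le {b : F'} (hb : b ∈ Algebra.adjoin O {α}) : v (i b) ≤ 1 :=
  val_le_one_of_isIntegral hO hF
    (Algebra.adjoin_le (S := integralClosure O F') (Set.singleton_subset_iff.2 hα.isIntegral) hb)

theorem val_one_add_mul {s : F'} (hs : s ∈ Algebra.adjoin O {α}) : v (i (1 + s * α)) = 1 := by
  have h1 : v (i (1 + s * α) - 1) < v 1 := by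
    rw [map_add, map_one, add_sub_cancel_left, map_mul, map_mul, map_one]
    exact (mul_le_of_le_one_left' (val_adjoin_le hO hF hα hs)).trans_lt hα.val_lt_one
  rw [val_eq_of_sub_lt' h1, map_one]

theorem adjoin_generator_eq_top : Algebra.adjoin F {α} = ⊤ := by
  obtain ⟨s, hs, hr⟩ := exists_conductor hO hF hα
  have hsub : ∀ b ∈ Algebra.adjoin O {α}, b ∈ IntermediateField.adjoin F {α} := by
    intro b hb
    refine Algebra.adjoin_le
      (S := (IntermediateField.adjoin F {α}).toSubalgebra.restrictScalars O) ?_ hb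
    simp
  have htop : IntermediateField.adjoin F {α} = ⊤ := by
    refine eq_top_iff.2 fun f _ ↦ ?_
    have halg : IsAlgebraic O f := (IsFractionRing.isAlgebraic_iff O F F').2
      (Algebra.IsAlgebraic.isAlgebraic f)
    obtain ⟨o, ho, hof⟩ := halg.exists_integral_multiple
    have h1 := hsub _ (hr _ hof)
    have h2 := hsub (1 + s * α) (add_mem (one_mem _) (mul_mem hs (Algebra.subset_adjoin rfl)))
    have h3 : (1 + s * α) ≠ 0 := by
      intro h0
      have := val_one_add_mul hO hF hα hs
      rw [h0] at this
      simp at this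
    have h4 : algebraMap O F' o ∈ IntermediateField.adjoin F {α} :=
      hsub _ (Subalgebra.algebraMap_mem _ o)
    have h5 : algebraMap O F' o ≠ 0 := by
      rw [IsScalarTower.algebraMap_apply O F F']
      simpa using ho
    have h6 : f = ((1 + s * α) * o • f) / ((1 + s * α) * algebraMap O F' o) := by
      rw [Algebra.smul_def]
      field_simp
    rw [h6]
    exact div_mem h1 (mul_mem h2 h4)
  rw [← IntermediateField.adjoin_simple_toSubalgebra_of_isAlgebraic
    (Algebra.IsAlgebraic.isAlgebraic α), htop, IntermediateField.top_toSubalgebra]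

theorem aeval_derivative_minpoly_ne_zero : aeval α (derivative (minpoly F α)) ≠ 0 :=
  (Algebra.IsSeparable.isSeparable F α).aeval_derivative_ne_zero (minpoly.aeval F α)

/-- The dual of the integral closure is contained in that of O[α], which is O[α] divided by f'(α),
for f the minimal polynomial of α. -/
theorem mem_traceDual_le {z : F'}
    (hz : z ∈ Submodule.traceDual O F (1 : Submodule (integralClosure O F') F')) :
    v (i (z * aeval α (derivative (minpoly F α)))) ≤ 1 := by
  have := base_isDVR hO hF
  have hne := aeval_derivative_minpoly_ne_zero hO hF hα
  have h1 : z ∈ (Algebra.traceForm F F').dualSubmodule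
      (Subalgebra.toSubmodule (Algebra.adjoin O {α})) := by
    rw [LinearMap.BilinForm.mem_dualSubmodule]
    intro y hy
    have hy' : y ∈ integralClosure O F' :=
      Algebra.adjoin_le (S := integralClosure O F') (Set.singleton_subset_iff.2 hα.isIntegral) hy
    exact Submodule.mem_one.2 (Submodule.mem_traceDual.1 hz y (Submodule.mem_one.2 ⟨⟨y, hy'⟩, rfl⟩))
  rw [traceForm_dualSubmodule_adjoin O F (adjoin_generator_eq_top hO hF hα) hα.isIntegral] at h1
  obtain ⟨y, hy, rfl⟩ := h1
  refine val_adjoin_le hO hF hα (b := _) ?_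
  convert hy using 1
  simp [mul_comm, hne]

/-- The inverse of f'(α) is dual to O[α] only; multiplied by the unit 1 + s α of `exists_conductor`
it becomes dual to the whole integral closure. -/
theorem exists_mem_traceDual : ∃ z ∈ Submodule.traceDual O F
    (1 : Submodule (integralClosure O F') F'),
    v (i (z * aeval α (derivative (minpoly F α)))) = 1 := by
  have := base_isDVR hO hF
  have hne := aeval_derivative_minpoly_ne_zero hO hF hα
  obtain ⟨s, hs, hr⟩ := exists_conductor hO hF hα
  refine ⟨(aeval α (derivative (minpoly F α)))⁻¹ * (1 + s * α), ?_, ?_⟩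
  · rw [Submodule.mem_traceDual]
    intro b hb
    obtain ⟨b, rfl⟩ := Submodule.mem_one.1 hb
    have h1 : (aeval α (derivative (minpoly F α)))⁻¹ * ((1 + s * α) * b) ∈
        (Algebra.traceForm F F').dualSubmodule
          (Subalgebra.toSubmodule (Algebra.adjoin O {α})) := by
      rw [traceForm_dualSubmodule_adjoin O F (adjoin_generator_eq_top hO hF hα) hα.isIntegral]
      exact ⟨_, hr _ b.2, rfl⟩
    rw [LinearMap.BilinForm.mem_dualSubmodule] at h1
    obtain ⟨o, ho⟩ := Submodule.mem_one.1 (h1 1 (one_mem (Algebra.adjoin O {α})))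
    refine ⟨o, ho.trans ?_⟩
    rw [Algebra.traceForm_apply, Algebra.traceForm_apply, mul_one, mul_assoc]
    rfl
  · rw [mul_right_comm, inv_mul_cancel₀ hne, one_mul]
    exact val_one_add_mul hO hF hα hs

/-- The constant coefficient divides a uniformizer t of O, because t is a product of α with an
element of O[α]; and it is α times an integral element, so it is not a unit. -/
theorem val_coeff_zero_minpoly :
    v (i (algebraMap O F' ((minpoly O α).coeff 0))) = v (i (algebraMap F F' ϖ)) := by
  have := base_isDVR hO hF
  obtain ⟨s, hs, hr⟩ := exists_conductor hO hF hα
  obtain ⟨t, ht⟩ := (hO ϖ).1 hF.lt_one.le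
  have hinj : Function.Injective (algebraMap O F') := by
    rw [IsScalarTower.algebraMap_eq O F F']
    exact (algebraMap F F').injective.comp (IsFractionRing.injective O F)
  have htf : Module.IsTorsionFree O F' :=
    Module.isTorsionFree_iff_algebraMap_injective.2 hinj
  have ht' : algebraMap O F' t = algebraMap F F' ϖ := by
    rw [IsScalarTower.algebraMap_apply O F F', ht]
  have hαR : α ∈ Algebra.adjoin O {α} := Algebra.subset_adjoin rfl
  have hvt : v (i (algebraMap O F' t)) < 1 := by rw [ht']; exact hF.lt_one
  obtain ⟨b, hb, hbt⟩ := hα.dvd _ isIntegral_algebraMap hvt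
  -- With t = α b, this element times α equals t (1 + s α) - s α t = t.
  have h1 : (1 + s * α) * b - s * algebraMap O F' t ∈ Algebra.adjoin O {α} :=
    sub_mem (hr b hb) (mul_mem hs (Subalgebra.algebraMap_mem _ _))
  rw [Algebra.adjoin_singleton_eq_range_aeval] at h1
  obtain ⟨P, hP⟩ := h1
  have hroot : aeval α (X * P - C t) = 0 := by
    rw [map_sub, map_mul, aeval_X, aeval_C]
    change α * (aeval α).toRingHom P - _ = 0
    rw [show (aeval α).toRingHom P = _ from hP, hbt]
    ring
  obtain ⟨Q, hQ⟩ := minpoly.isIntegrallyClosed_dvd hα.isIntegral hroot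
  have h2 : -t = (minpoly O α).coeff 0 * Q.coeff 0 := by
    have := congrArg (fun P ↦ coeff P 0) hQ
    simpa [mul_coeff_zero] using this
  have hle : v (i (algebraMap F F' ϖ)) ≤ v (i (algebraMap O F' ((minpoly O α).coeff 0))) := by
    have h3 := congrArg (fun o ↦ v (i (algebraMap O F' o))) h2
    simp only [map_neg, map_mul, Valuation.map_neg, ht'] at h3
    rw [h3]
    exact mul_le_of_le_one_right' (val_algebraMap_le hO hF _)
  refine le_antisymm ?_ hle
  rw [IsScalarTower.algebraMap_apply O F F']
  refine hF.val_le_of_lt_one ⟨_, rfl⟩ ?_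
  rw [← IsScalarTower.algebraMap_apply O F F']
  have h4 := minpoly.aeval O α
  rw [← divX_mul_X_add (minpoly O α), map_add, map_mul, aeval_X, aeval_C] at h4
  rw [eq_neg_of_add_eq_zero_right h4, map_neg, Valuation.map_neg, map_mul, map_mul]
  refine (mul_le_of_le_one_left' (val_adjoin_le hO hF hα ?_)).trans_lt hα.val_lt_one
  rw [Algebra.adjoin_singleton_eq_range_aeval]
  exact ⟨_, rfl⟩

/-- Apply D to g(α) = 0. Among the derivatives of the coefficients, the one of the constant
coefficient dominates: it has the value of D at a uniformizer, and the others are no larger and are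
multiplied by powers of α. So f'(α) D(α) has the value of D at a uniformizer of the base. -/
theorem val_derivative_mul_deriv {ℓ : L} (D : Derivation ℤ L L) (hDκ : ∀ c, D (κ c) = 0)
    (hL : HasExpansions v κ ⊤ ℓ) (hD : ∀ a, v (D a) ≤ v a * (v ℓ)⁻¹) :
    v (i (aeval α (derivative (minpoly F α)))) * v (D (i α)) =
      v (D (i (algebraMap F F' ϖ))) := by
  have := base_isDVR hO hF
  have hπ := hF.pos
  set π := i (algebraMap F F' ϖ) with hπdef
  set g := minpoly O α with hg
  have hmem : ∀ o : O, i (algebraMap O F' o) ∈ (i.comp (algebraMap F F')).fieldRange := fun o ↦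
    ⟨algebraMap O F o, by simp [IsScalarTower.algebraMap_apply O F F']⟩
  have hder : i (aeval α (derivative (minpoly F α))) =
      (derivative g).eval₂ (i.comp (algebraMap O F')) (i α) := by
    rw [minpoly.isIntegrallyClosed_eq_field_fractions' F hα.isIntegral, derivative_map,
      aeval_map_algebraMap, aeval_def, hom_eval₂]
  have h0 : D (g.eval₂ (i.comp (algebraMap O F')) (i α)) = 0 := by
    rw [← hom_eval₂, ← aeval_def, minpoly.aeval, map_zero, map_zero]
  rw [deriv_eval₂, Finset.sum_range_succ', pow_zero, mul_one, ← hder, add_assoc] at h0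
  have hcoeff : v (D (i (algebraMap O F' (g.coeff 0)))) = v (D π) := by
    have h1 := val_coeff_zero_minpoly hO hF hα
    have h2 := val_deriv_eq D hDκ hL hD hF (hmem (g.coeff 0)) (m := 1) (by simp)
      (by rw [zpow_one]; exact h1)
    rw [h1, mul_comm] at h2
    exact mul_left_cancel₀ hπ.ne' h2
  have hint : ∀ o : O, v (D (i (algebraMap O F' o))) ≤ v (D π) := by
    intro o
    obtain ⟨c, hc⟩ := hF.exists_residue (hmem o) (val_algebraMap_le hO hF o)
    have h1 : v (i (algebraMap O F' o) - κ c) ≤ v π :=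
      hF.val_le_of_lt_one (sub_mem (hmem o) (hF.const c)) hc
    have h2 := val_deriv_le D hDκ hL hD hF (sub_mem (hmem o) (hF.const c))
    rw [map_sub, hDκ, sub_zero] at h2
    have h3 := h2.trans (mul_le_mul_left h1 (v (D π)))
    rw [mul_comm] at h3
    exact (mul_le_mul_iff_right₀ hπ).1 h3
  rcases eq_or_ne (v (D π)) 0 with hz | hz
  · have hDz : ∀ o : O, D (i (algebraMap O F' o)) = 0 := fun o ↦ by
      have := hint o
      rw [hz] at this
      exact (Valuation.zero_iff v).1 (le_antisymm this zero_le)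
    simp only [RingHom.comp_apply, hDz, zero_mul, Finset.sum_const_zero, zero_add] at h0
    rw [← map_mul, h0, hz, map_zero]
  · have hsmall : v (∑ l ∈ Finset.range g.natDegree,
        D ((i.comp (algebraMap O F')) (g.coeff (l + 1))) * i α ^ (l + 1)) < v (D π) := by
      refine Valuation.map_sum_lt v hz fun l _ ↦ ?_
      rw [map_mul, map_pow]
      refine (mul_le_mul_left (hint _) _).trans_lt (mul_lt_of_lt_one_right (zero_lt_iff.2 hz) ?_)
      exact pow_lt_one₀ zero_le hα.val_lt_one (Nat.succ_ne_zero l)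
    have h5 := eq_neg_of_add_eq_zero_left h0
    rw [h5, Valuation.map_neg, add_comm] at hsmall
    rw [RingHom.comp_apply, ← hcoeff] at hsmall
    have h6 := val_eq_of_sub_lt (v := v) (x := -D (i (algebraMap O F' (g.coeff 0))))
      (y := i (aeval α (derivative (minpoly F α))) * D (i α)) (by
        rw [← Valuation.map_neg v, Valuation.map_neg v (D _)]
        convert hsmall using 2; ring)
    rw [← map_mul, h6, Valuation.map_neg, hcoeff]

end Different

/-! ### From values in L to ramification index and different exponent -/

section Invariants

variable {L Γ K : Type*} [Field L] [LinearOrderedCommGroupWithZero Γ] [Field K]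
variable {v : Valuation L Γ} {κ : K →+* L}
variable {F F' : Type*} [Field F] [Field F'] [Algebra F F'] {i : F' →+* L} {ϖ : F} {β : F'}
variable {O' : ValuationSubring F'}

theorem valuation_le_iff (hO' : ∀ x, x ∈ O' ↔ v (i x) ≤ 1) (x y : F') :
    O'.valuation x ≤ O'.valuation y ↔ v (i x) ≤ v (i y) := by
  have h : (O'.valuation).IsEquiv (v.comap i) := by
    rw [Valuation.isEquiv_iff_valuationSubring, ValuationSubring.valuationSubring_valuation]
    ext x
    exact hO' x
  exact h x y

theorem valuation_eq_iff (hO' : ∀ x, x ∈ O' ↔ v (i x) ≤ 1) (x y : F') :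
    O'.valuation x = O'.valuation y ↔ v (i x) = v (i y) := by
  rw [le_antisymm_iff, valuation_le_iff hO', valuation_le_iff hO', ← le_antisymm_iff]

theorem isUnit_iff_val_eq_one (hO' : ∀ x, x ∈ O' ↔ v (i x) ≤ 1) (x : O') :
    IsUnit x ↔ v (i x) = 1 := by
  rw [ValuationSubring.valuation_eq_one_iff O' x, ← map_one (O'.valuation), valuation_eq_iff hO',
    map_one, map_one]

theorem irreducible_iff_val_eq (hO' : ∀ x, x ∈ O' ↔ v (i x) ≤ 1)
    (h : HasExpansions v κ i.fieldRange (i β)) (τ : O') :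
    Irreducible τ ↔ v (i τ) = v (i β) := by
  have hβ : β ∈ O' := (hO' β).2 h.lt_one.le
  have hβ0 : β ≠ 0 := by rintro rfl; exact h.ne_zero (map_zero i)
  have hlt : ∀ x : O', ¬ IsUnit x → v (i x) < 1 := fun x hx ↦
    lt_of_le_of_ne ((hO' x).1 x.2) fun h1 ↦ hx ((isUnit_iff_val_eq_one hO' x).2 h1)
  have hdiv : ∀ x : O', v (i x) < 1 → ∃ y : O', x = ⟨β, hβ⟩ * y := by
    intro x hx
    have hle := h.val_le_of_lt_one ⟨(x : F'), rfl⟩ hx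
    refine ⟨⟨β⁻¹ * x, (hO' _).2 ?_⟩, Subtype.ext ?_⟩
    · rw [map_mul, map_mul, map_inv₀, map_inv₀]
      exact (mul_le_mul_right hle _).trans (inv_mul_cancel₀ h.pos.ne').le
    · change (x : F') = β * (β⁻¹ * x)
      rw [mul_inv_cancel_left₀ hβ0]
  constructor
  · intro hτ
    obtain ⟨y, hy⟩ := hdiv τ (hlt τ hτ.not_isUnit)
    rcases hτ.isUnit_or_isUnit hy with h1 | h1
    · exact absurd ((isUnit_iff_val_eq_one hO' _).1 h1) h.lt_one.ne
    · have h2 := congrArg (fun x : O' ↦ v (i x)) hy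
      change _ = v (i (β * y)) at h2
      rwa [map_mul, map_mul, (isUnit_iff_val_eq_one hO' _).1 h1, mul_one] at h2
  · intro hτ
    refine ⟨fun hu ↦ ?_, fun x y hxy ↦ ?_⟩
    · rw [isUnit_iff_val_eq_one hO', hτ] at hu
      exact h.lt_one.ne hu
    · by_contra! hcon
      have h1 := h.val_le_of_lt_one ⟨(x : F'), rfl⟩ (hlt x hcon.1)
      have h2 := congrArg (fun x : O' ↦ v (i x)) hxy
      change _ = v (i (x * y : F')) at h2
      rw [map_mul, map_mul, hτ] at h2
      have h3 : v (i x) * v (i y) < v (i β) :=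
        (mul_le_mul_left h1 _).trans_lt (mul_lt_of_lt_one_right h.pos (hlt y hcon.2))
      exact h3.ne h2.symm

theorem hasOrder_iff (hO' : ∀ x, x ∈ O' ↔ v (i x) ≤ 1)
    (h : HasExpansions v κ i.fieldRange (i β)) (f : F') (n : ℤ) :
    HasOrder O' f n ↔ v (i f) = v (i β) ^ n := by
  have key : ∀ τ : O', v (i τ) = v (i β) →
      (O'.valuation f = O'.valuation (τ : F') ^ n ↔ v (i f) = v (i β) ^ n) := by
    intro τ hτ
    rw [← map_zpow₀, valuation_eq_iff hO', map_zpow₀, map_zpow₀, hτ]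
  constructor
  · rintro ⟨τ, hτ, h1⟩
    exact (key τ ((irreducible_iff_val_eq hO' h τ).1 hτ)).1 h1
  · intro h1
    exact ⟨⟨β, (hO' β).2 h.lt_one.le⟩, (irreducible_iff_val_eq hO' h _).2 rfl,
      (key _ rfl).2 h1⟩

theorem comp_comap_iff (hO' : ∀ x, x ∈ O' ↔ v (i x) ≤ 1) (a : F) :
    v (i (algebraMap F F' a)) ≤ 1 ↔
      ∃ o : O'.comap (algebraMap F F'), algebraMap (O'.comap (algebraMap F F')) F o = a := by
  rw [← hO']
  exact ⟨fun h ↦ ⟨⟨a, h⟩, rfl⟩, by rintro ⟨o, rfl⟩; exact o.2⟩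

theorem hasRamificationIndex_of_val (hO' : ∀ x, x ∈ O' ↔ v (i x) ≤ 1)
    (hF : HasExpansions v κ (i.comp (algebraMap F F')).fieldRange (i (algebraMap F F' ϖ)))
    (h : HasExpansions v κ i.fieldRange (i β)) {e : ℕ}
    (he : v (i (algebraMap F F' ϖ)) = v (i β) ^ e) : HasRamificationIndex F O' e := by
  have hc : ∀ a : F, a ∈ O'.comap (algebraMap F F') ↔
      v ((i.comp (algebraMap F F')) a) ≤ 1 := fun a ↦ hO' _
  refine ⟨⟨ϖ, (hc ϖ).2 hF.lt_one.le⟩,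
    (irreducible_iff_val_eq (i := i.comp (algebraMap F F')) hc hF _).2 rfl, ?_⟩
  rw [hasOrder_iff hO' h, zpow_natCast]
  exact he

variable [FiniteDimensional F F'] [Algebra.IsSeparable F F'] [IsAlgClosed K]

theorem exists_hasDifferentExponent (hO' : ∀ x, x ∈ O' ↔ v (i x) ≤ 1)
    (hF : HasExpansions v κ (i.comp (algebraMap F F')).fieldRange (i (algebraMap F F' ϖ)))
    {ℓ : L} (D : Derivation ℤ L L) (hDκ : ∀ c, D (κ c) = 0)
    (hL : HasExpansions v κ ⊤ ℓ) (hD : ∀ a, v (D a) ≤ v a * (v ℓ)⁻¹) :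
    ∃ β : F', HasExpansions v κ i.fieldRange (i β) ∧ ∃ d : ℕ, HasDifferentExponent F O' d ∧
      v (i β) ^ d * v (D (i β)) = v (D (i (algebraMap F F' ϖ))) := by
  have hO := comp_comap_iff (F := F) hO'
  obtain ⟨α, hα⟩ := exists_isLocalGenerator hO hF
  have hE := hα.hasExpansions hO hF
  set f' := Polynomial.aeval α (Polynomial.derivative (minpoly F α)) with hf'
  have hne : f' ≠ 0 := aeval_derivative_minpoly_ne_zero hO hF hα
  have hine : i f' ≠ 0 := by simpa using hne
  have hle : v (i f') ≤ 1 := by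
    have := base_isDVR hO hF
    rw [hf', minpoly.isIntegrallyClosed_eq_field_fractions' F hα.isIntegral,
      Polynomial.derivative_map, Polynomial.aeval_map_algebraMap]
    refine val_adjoin_le hO hF hα ?_
    rw [Algebra.adjoin_singleton_eq_range_aeval]
    exact ⟨_, rfl⟩
  obtain ⟨m, hm⟩ := hE.exists_val ⟨f', rfl⟩ hine
  have hm0 : 0 ≤ m := by
    rw [hm, ← zpow_zero (v _), hE.zpow_le_iff] at hle
    exact hle
  obtain ⟨d, rfl⟩ := Int.eq_ofNat_of_zero_le hm0
  refine ⟨α, hE, d, ⟨?_, ?_⟩, ?_⟩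
  · obtain ⟨z, hz, hz1⟩ := exists_mem_traceDual hO hF hα
    refine ⟨z, hz, (hasOrder_iff hO' hE _ _).2 ?_⟩
    rw [map_mul, map_mul, hm] at hz1
    rw [zpow_neg]
    exact eq_inv_of_mul_eq_one_left hz1
  · intro z hz n hn
    rw [hasOrder_iff hO' hE] at hn
    have h1 := mem_traceDual_le hO hF hα hz
    rw [map_mul, map_mul, hm, hn, ← zpow_add₀ hE.pos.ne', ← zpow_zero (v _),
      hE.zpow_le_iff] at h1
    omega
  · rw [← zpow_natCast, ← hm]
    exact val_derivative_mul_deriv hO hF hα D hDκ hL hD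

/-- D takes the same value at any two uniformizers of the upper field, so the exponent can be read
off from any one of them, provided that D does not vanish there. -/
theorem hasDifferentExponent_of_val (hO' : ∀ x, x ∈ O' ↔ v (i x) ≤ 1)
    (hF : HasExpansions v κ (i.comp (algebraMap F F')).fieldRange (i (algebraMap F F' ϖ)))
    (h : HasExpansions v κ i.fieldRange (i β))
    {ℓ : L} (D : Derivation ℤ L L) (hDκ : ∀ c, D (κ c) = 0)
    (hL : HasExpansions v κ ⊤ ℓ) (hD : ∀ a, v (D a) ≤ v a * (v ℓ)⁻¹) {d : ℕ}
    (hd : v (i β) ^ d * v (D (i β)) = v (D (i (algebraMap F F' ϖ)))) (hDβ : D (i β) ≠ 0) :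
    HasDifferentExponent F O' d := by
  obtain ⟨γ, hγ, d', hd', hv⟩ := exists_hasDifferentExponent hO' hF D hDκ hL hD
  have hγβ : v (i γ) = v (i β) :=
    le_antisymm (h.val_le_of_lt_one hγ.mem hγ.lt_one) (hγ.val_le_of_lt_one h.mem h.lt_one)
  have h1 := val_deriv_eq D hDκ hL hD h hγ.mem (m := 1) (by simp) (by rw [zpow_one]; exact hγβ)
  rw [hγβ, mul_comm] at h1
  have h2 := mul_left_cancel₀ h.pos.ne' h1
  rw [h2, hγβ, ← hd] at hv
  have h3 := mul_right_cancel₀ ((Valuation.ne_zero_iff v).2 hDβ) hv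
  rw [← zpow_natCast, ← zpow_natCast] at h3
  have h4 := h.zpow_inj.1 h3
  rw [Nat.cast_inj] at h4
  rwa [← h4]

end Invariants

/-! ### Invariants of Kummer steps and of additive steps -/

section LocalSteps

open Polynomial IntermediateField

variable {L Γ K : Type*} [Field L] [LinearOrderedCommGroupWithZero Γ] [Field K] [IsAlgClosed K]
variable {v : Valuation L Γ} {κ : K →+* L} {A B : Subfield L} {π π' ϖ : L}
variable {O : ValuationSubring L}

set_option linter.unusedSectionVars false

theorem IsLaurent.adjoin_root {m : ℕ} (hm : (m : K) ≠ 0) (hA : IsLaurent v κ A π) {t : L}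
    (ht : t ^ m = π) : FiniteDimensional A A⟮t⟯ ∧ IsLaurent v κ (adjoinElement A t) t ∧
      Module.finrank A A⟮t⟯ = m := by
  have hm0 : m ≠ 0 := by rintro rfl; simp at hm
  have hmpos := Nat.pos_of_ne_zero hm0
  obtain ⟨hfd, hle⟩ := finrank_adjoin_le (A := A) (y := t) (g := X ^ m - C ⟨π, hA.mem⟩)
    (monic_X_pow_sub_C _ hm0) (by rw [map_sub, aeval_X_pow, aeval_C, ht]; exact sub_self π)
  rw [natDegree_X_pow_sub_C] at hle
  have h1 : v (t ^ m - κ 1 * π) < v π := by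
    rw [ht, map_one, one_mul, sub_self, map_zero]
    exact hA.pos
  have hvt : v t ^ m = v π := by rw [← map_pow, ht]
  exact ⟨hfd, IsLaurent.adjoin hA.toHasExpansions hmpos hvt hA one_ne_zero h1 hle,
    le_antisymm hle (HasExpansions.le_finrank hA.toHasExpansions hmpos hvt)⟩

variable (hO : ∀ x, x ∈ O ↔ v x ≤ 1)
  (D : Derivation ℤ L L) (hDκ : ∀ c, D (κ c) = 0) (hL : HasExpansions v κ ⊤ ϖ)
  (hD : ∀ a, v (D a) ≤ v a * (v ϖ)⁻¹)

include hO hDκ hL hD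

theorem hasInvariants_of_val (hAB : A ≤ B) [FiniteDimensional A (Subfield.extendScalars hAB)]
    [Algebra.IsSeparable A (Subfield.extendScalars hAB)] (hA : HasExpansions v κ A π)
    (hB : HasExpansions v κ B π') {e d : ℕ} (he : v π = v π' ^ e)
    (hd : v π' ^ d * v (D π') = v (D π)) (hDπ : D π' ≠ 0) :
    HasRamificationIndex A (O.comap (algebraMap (Subfield.extendScalars hAB) L)) e ∧
    HasDifferentExponent A (O.comap (algebraMap (Subfield.extendScalars hAB) L)) d := by
  set i : Subfield.extendScalars hAB →+* L := algebraMap (Subfield.extendScalars hAB) L with hi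
  have hO' : ∀ x, x ∈ O.comap i ↔ v (i x) ≤ 1 := fun x ↦ hO (i x)
  have hrA : (i.comp (algebraMap A (Subfield.extendScalars hAB))).fieldRange = A := by
    ext x
    exact ⟨by rintro ⟨a, rfl⟩; exact a.2, fun hx ↦ ⟨⟨x, hx⟩, rfl⟩⟩
  have hrB : i.fieldRange = B := by
    ext x
    exact ⟨by rintro ⟨a, rfl⟩; exact a.2, fun hx ↦ ⟨⟨x, hx⟩, rfl⟩⟩
  have hF : HasExpansions v κ (i.comp (algebraMap A (Subfield.extendScalars hAB))).fieldRange
      (i (algebraMap A (Subfield.extendScalars hAB) ⟨π, hA.mem⟩)) := by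
    rw [hrA]; exact hA
  have hE : HasExpansions v κ i.fieldRange (i ⟨π', hB.mem⟩) := by
    rw [hrB]; exact hB
  exact ⟨hasRamificationIndex_of_val hO' hF hE he,
    hasDifferentExponent_of_val hO' hF hE D hDκ hL hD hd hDπ⟩

/-- A tamely ramified Kummer extension. -/
theorem kummer_step {m : ℕ} (hm : (m : K) ≠ 0) (hA : IsLaurent v κ A π) {t : L} (ht : t ^ m = π)
    (hDπ : D π ≠ 0) :
    IsLaurent v κ (adjoinElement A t) t ∧ IsFiniteCyclic A (adjoinElement A t) ∧
      HasInvariants O A (adjoinElement A t) m m (m - 1) ∧ D t ≠ 0 := by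
  have hmpos : 0 < m := Nat.pos_of_ne_zero (by rintro rfl; simp at hm)
  obtain ⟨hfd, hBt, hrank⟩ := hA.adjoin_root hm ht
  have hvt : v t ^ m = v π := by rw [← map_pow, ht]
  have hroots : (primitiveRoots (Module.finrank A A⟮t⟯) A).Nonempty := by
    have : NeZero (m : K) := ⟨hm⟩
    obtain ⟨ζ, hζ⟩ := HasEnoughRootsOfUnity.exists_primitiveRoot K m
    have hζ' : IsPrimitiveRoot (κ ζ) m := hζ.map_of_injective κ.injective
    refine ⟨⟨κ ζ, hA.const ζ⟩, ?_⟩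
    rw [hrank, mem_primitiveRoots hmpos]
    exact IsPrimitiveRoot.of_map_of_injective (f := A.subtype) hζ' A.subtype.injective
  have hcyc : IsGalois A A⟮t⟯ ∧ IsCyclic (A⟮t⟯ ≃ₐ[A] A⟮t⟯) := by
    have htfae := (isCyclic_tfae A A⟮t⟯ hroots).out 0 2
    refine htfae.2 ⟨⟨t, mem_adjoin_simple_self A t⟩, ?_, ?_⟩
    · refine ⟨⟨π, hA.mem⟩, Subtype.ext ?_⟩
      rw [hrank]
      exact ht.symm
    · apply IntermediateField.lift_injective
      rw [lift_adjoin_simple, lift_top]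
  have := hcyc.1
  have hDt : D π = m * t ^ (m - 1) * D t := by
    rw [← ht, D.leibniz_pow, smul_eq_mul, nsmul_eq_mul, mul_assoc]
  have hvm : v (m : L) = 1 := hA.val_natCast hm
  have hDt0 : D t ≠ 0 := by rintro h0; rw [h0, mul_zero] at hDt; exact hDπ hDt
  refine ⟨hBt, ⟨le_adjoinElement A t, hfd, hcyc⟩, ⟨le_adjoinElement A t, hrank, ?_⟩, hDt0⟩
  have : FiniteDimensional A (Subfield.extendScalars (le_adjoinElement A t)) := hfd
  have : Algebra.IsSeparable A (Subfield.extendScalars (le_adjoinElement A t)) :=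
    IsGalois.to_isSeparable (F := A) (E := A⟮t⟯)
  refine hasInvariants_of_val hO D hDκ hL hD (le_adjoinElement A t) hA.toHasExpansions
    hBt.toHasExpansions hvt.symm ?_ hDt0
  rw [hDt, map_mul, map_mul, hvm, one_mul, map_pow]

/-- The step is a chain of Artin–Schreier steps, so D has the same value at simple poles below and
above. Passing from a pole to its inverse multiplies D by the square of a uniformizer; the two
squares differ by the factor of order 2(N - 1). -/
theorem additive_step {p : ℕ} [Fact p.Prime] [CharP K p] [CharP L p] {N r : ℕ} {y : L}
    (hN : N = p ^ r) {t : L} (hA : IsLaurent v κ A t) (hDt : D t ≠ 0)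
    (h : IsAdditiveStep v κ A B N y) :
    IsLaurent v κ B y⁻¹ ∧ IsFiniteGalois A B ∧ HasInvariants O A B N N (2 * (N - 1)) ∧
      IsWeaklyRamified p O A B ∧ D y⁻¹ ≠ 0 := by
  obtain ⟨S, W, s, hS, hW, hs, hy, rfl⟩ := h
  obtain ⟨hB, hrank, -⟩ := additive_adjoin hS hs hy
  rw [hW] at hrank
  have hNpos : 0 < N := by rw [hN]; exact pow_pos (Fact.out : p.Prime).pos r
  have hgal := additive_isGalois hS hs hy
  have hfd := (additive_finrank_le hS hs hy).1
  have hchain := additive_chain p N S W s y hW hS hs hy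
  obtain ⟨-, π', hπ', hDπ', -⟩ := asChain_invariants D hDκ hL hD hs hchain
  have hvy : v y ^ N = v s := by
    have := val_eq_of_sub_lt' (additive_pow_sub_lt hS hs hy)
    rwa [hW, map_pow] at this
  have hy0 : y ≠ 0 := hB.ne_zero_of_inv
  have hs0 : s ≠ 0 := hs.ne_zero_of_inv
  have hvy0 := (Valuation.ne_zero_iff v).2 hy0
  have hvs0 := (Valuation.ne_zero_iff v).2 hs0
  have hDy : v (D y) = v (D s) := by
    rw [inv_inv] at hDπ'
    rw [← hDπ']
    refine val_deriv_pole D hDκ hL hD hπ'.toHasExpansions (self_mem_adjoinElement A y) ?_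
    rw [hπ'.val_unique hB.toHasExpansions, map_inv₀, inv_inv]
  have hinv : ∀ a : L, v (D a⁻¹) = (v a)⁻¹ ^ 2 * v (D a) := fun a ↦ by
    rw [Derivation.leibniz_inv, smul_eq_mul, map_mul, Valuation.map_neg, map_pow, map_inv₀]
  have hDs : D s ≠ 0 := by
    intro h0
    have h1 := val_deriv_eq D hDκ hL hD hs.toHasExpansions hA.mem (m := 1) (by simp)
      (by rw [zpow_one]; exact hA.val_unique hs.toHasExpansions)
    rw [hinv, h0, map_zero, mul_zero, mul_zero] at h1
    rcases mul_eq_zero.1 h1 with h2 | h2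
    · exact hDt ((Valuation.zero_iff v).1 h2)
    · exact hs.pos.ne' h2
  have hDy0 : D y⁻¹ ≠ 0 := by
    rw [← Valuation.ne_zero_iff v, hinv, hDy]
    exact mul_ne_zero (pow_ne_zero _ (inv_ne_zero hvy0)) ((Valuation.ne_zero_iff v).2 hDs)
  have hAB := le_adjoinElement A y
  have i1 : FiniteDimensional A (Subfield.extendScalars hAB) := hfd
  have i2 : IsGalois A (Subfield.extendScalars hAB) := hgal
  have i3 : Algebra.IsSeparable A (Subfield.extendScalars hAB) := IsGalois.to_isSeparable
  have hinv := hasInvariants_of_val hO D hDκ hL hD hAB hs.toHasExpansions hB.toHasExpansions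
    (e := N) (d := 2 * (N - 1)) (by rw [map_inv₀, map_inv₀, ← hvy, inv_pow]) (by
      rw [hinv, hinv, hDy, ← mul_assoc, ← hvy, map_inv₀, ← pow_add, ← inv_pow, ← pow_mul]
      congr 2
      omega) hDy0
  refine ⟨hB, ⟨hAB, i1, i2⟩, ⟨hAB, hrank, hinv⟩, ⟨hAB, i1, i3, ?_, N, _, hinv.1, hinv.2, ?_⟩, hDy0⟩
  -- The extension is itself a Galois p-extension, so a chain of length one suffices; the
  -- decomposition served for the different only.
  · refine ⟨1, fun r ↦ if r = 0 then A else adjoinElement A y, by simp, by simp, ?_⟩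
    intro r' hr
    obtain rfl : r' = 0 := by omega
    simp only [↓reduceIte, zero_add, one_ne_zero]
    exact ⟨hAB, i1, i2, r, by rw [← hN]; exact hrank⟩
  · push_cast [Nat.cast_sub (show 1 ≤ N by omega)]
    ring

end LocalSteps

/-! ### Trace polynomials and the Euclidean algorithm -/

section TraceAlgebra

theorem tr_zero {R : Type*} [Semiring R] {q : ℕ} (x : R) : Tr q 0 x = 0 := by simp [Tr]

theorem tr_one {R : Type*} [Semiring R] {q : ℕ} (x : R) : Tr q 1 x = x := by simp [Tr]

theorem tr_map {R S : Type*} [Semiring R] [Semiring S] (f : R →+* S) (q m : ℕ) (x : R) :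
    f (Tr q m x) = Tr q m (f x) := by
  simp [Tr]

variable {R : Type*} [CommRing R] {p a q : ℕ} [Fact p.Prime] [CharP R p] (hq : q = p ^ a)
include hq

theorem add_pow_pow (r : ℕ) (x y : R) : (x + y) ^ q ^ r = x ^ q ^ r + y ^ q ^ r := by
  rw [hq, ← pow_mul, add_pow_char_pow]

theorem sub_pow_pow (r : ℕ) (x y : R) : (x - y) ^ q ^ r = x ^ q ^ r - y ^ q ^ r := by
  rw [hq, ← pow_mul, sub_pow_char_pow]

theorem neg_pow_pow (r : ℕ) (x : R) : (-x) ^ q ^ r = -x ^ q ^ r := by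
  have h0 : (0 : R) ^ q ^ r = 0 := by
    refine zero_pow (pow_ne_zero _ ?_)
    rw [hq]
    exact pow_ne_zero _ (Fact.out : p.Prime).ne_zero
  rw [← zero_sub, sub_pow_pow hq, h0, zero_sub]

theorem sum_pow_pow {ι : Type*} (s : Finset ι) (f : ι → R) (r : ℕ) :
    (∑ i ∈ s, f i) ^ q ^ r = ∑ i ∈ s, f i ^ q ^ r := by
  rw [hq, ← pow_mul, sum_pow_char_pow]

theorem tr_add (m : ℕ) (x y : R) : Tr q m (x + y) = Tr q m x + Tr q m y := by
  simp only [Tr, add_pow_pow hq, Finset.sum_add_distrib]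

theorem tr_sub (m : ℕ) (x y : R) : Tr q m (x - y) = Tr q m x - Tr q m y := by
  simp only [Tr, sub_pow_pow hq, Finset.sum_sub_distrib]

theorem tr_pow_pow (m r : ℕ) (x : R) : Tr q m x ^ q ^ r = Tr q m (x ^ q ^ r) := by
  rw [Tr, sum_pow_pow hq, Tr]
  exact Finset.sum_congr rfl fun i _ ↦ by rw [← pow_mul, ← pow_mul, mul_comm]

theorem tr_add_index (m r : ℕ) (x : R) : Tr q (m + r) x = Tr q m x + Tr q r x ^ q ^ m := by
  rw [Tr, Finset.sum_range_add, Tr, Tr, sum_pow_pow hq]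
  congr 1
  exact Finset.sum_congr rfl fun i _ ↦ by rw [← pow_mul, pow_add, mul_comm]

/-- `Tr_j ∘ (φ ^ k - 1) = Tr_k ∘ (φ ^ j - 1)`, where `φ` is the `q`-Frobenius. -/
theorem tr_pow_sub_tr (j k : ℕ) (x : R) :
    Tr q k x ^ q ^ j - Tr q k x = Tr q j x ^ q ^ k - Tr q j x := by
  have h1 := tr_add_index hq j k x
  have h2 := tr_add_index hq k j x
  rw [add_comm k j] at h2
  linear_combination h1.symm.trans h2

/-- For coprime `j` and `k`, the element `x` is a combination of `Tr_j x` and `Tr_k x`. -/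
theorem mem_of_tr_mem {G : Type*} [SetLike G R] [AddSubgroupClass G R] (S : G)
    (hS : ∀ x ∈ S, ∀ r, x ^ q ^ r ∈ S) {x : R} (n : ℕ) : ∀ j k : ℕ, j + k = n → j.Coprime k →
    Tr q j x ∈ S → Tr q k x ∈ S → x ∈ S := by
  induction n using Nat.strong_induction_on with
  | _ n ih =>
  have key : ∀ j k : ℕ, j ≤ k → j + k = n → j.Coprime k → Tr q j x ∈ S → Tr q k x ∈ S →
      x ∈ S := by
    intro j k hle hn hjk hj hk
    rcases Nat.eq_zero_or_pos j with rfl | hj0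
    · rw [Nat.coprime_zero_left] at hjk
      subst hjk
      rwa [tr_one] at hk
    · refine ih k (by omega) j (k - j) (by omega) (Nat.coprime_sub_self_right hle |>.2 hjk) hj ?_
      -- Tr_k = Tr_(k-j) + Tr_j^(q^(k-j)) is one step of the Euclidean algorithm.
      have h := tr_add_index hq (k - j) j x
      rw [Nat.sub_add_cancel hle] at h
      rw [eq_sub_of_add_eq h.symm]
      exact sub_mem hk (hS _ hj _)
  intro j k hn hjk hj hk
  rcases le_total j k with h | h
  · exact key j k h hn hjk hj hk
  · exact key k j h (by omega) hjk.symm hk hj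

theorem eq_zero_of_tr_eq_zero {j k : ℕ} (hjk : j.Coprime k) {x : R} (hj : Tr q j x = 0)
    (hk : Tr q k x = 0) : x = 0 := by
  have hq0 : q ≠ 0 := by rw [hq]; exact pow_ne_zero _ (Fact.out : p.Prime).ne_zero
  have := mem_of_tr_mem hq (⊥ : AddSubgroup R) (fun x hx r ↦ by
    rw [AddSubgroup.mem_bot] at hx ⊢
    rw [hx, zero_pow (pow_ne_zero _ hq0)]) _ j k rfl hjk hj hk
  simpa using this

/-- The Euclidean algorithm on (j, k) carries the system to a smaller one and the compatibility
condition along with it. The set S is closed under q-powers, so the solution stays in it. -/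
theorem exists_tr_eq {G : Type*} [SetLike G R] [AddSubgroupClass G R] (S : G)
    (hS : ∀ x ∈ S, ∀ r, x ^ q ^ r ∈ S) (n : ℕ) : ∀ j k : ℕ, j + k = n → j.Coprime k →
    ∀ x ∈ S, ∀ z ∈ S, Tr q j x = Tr q k z → ∃ u ∈ S, Tr q k u = x ∧ Tr q j u = z := by
  induction n using Nat.strong_induction_on with
  | _ n ih =>
  have key : ∀ j k : ℕ, j ≤ k → j + k = n → j.Coprime k → ∀ x ∈ S, ∀ z ∈ S,
      Tr q j x = Tr q k z → ∃ u ∈ S, Tr q k u = x ∧ Tr q j u = z := by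
    intro j k hle hn hjk x hx z hz hxz
    rcases Nat.eq_zero_or_pos j with rfl | hj0
    · rw [Nat.coprime_zero_left] at hjk
      subst hjk
      rw [tr_one, tr_zero] at hxz
      exact ⟨x, hx, tr_one x, by rw [tr_zero, hxz]⟩
    · have h := fun y : R ↦ tr_add_index hq (k - j) j y
      simp only [Nat.sub_add_cancel hle] at h
      obtain ⟨u, hu, hux, huz⟩ := ih k (by omega) j (k - j) (by omega)
        (Nat.coprime_sub_self_right hle |>.2 hjk) (x - z ^ q ^ (k - j)) (sub_mem hx (hS _ hz _))
        z hz (by rw [tr_sub hq, hxz, h, tr_pow_pow hq]; ring)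
      exact ⟨u, hu, by rw [h, hux, huz]; ring, huz⟩
  intro j k hn hjk x hx z hz hxz
  rcases le_total j k with h | h
  · exact key j k h hn hjk x hx z hz hxz
  · obtain ⟨u, hu, h1, h2⟩ := key k j h (by omega) hjk.symm z hz x hx hxz.symm
    exact ⟨u, hu, h2, h1⟩

end TraceAlgebra

/-! ### Additive polynomials with constant coefficients -/

section AdditivePolynomials

open Polynomial

variable {L Γ K : Type*} [Field L] [LinearOrderedCommGroupWithZero Γ] [Field K] [IsAlgClosed K]
variable {v : Valuation L Γ} {κ : K →+* L} {A B E : Subfield L} {π ϖ : L}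

/-- A monic additive separable polynomial with constant coefficients. -/
structure IsAdditivePoly (κ : K →+* L) (P : K[X]) : Prop where
  monic : P.Monic
  derivative_eq : ∃ c, c ≠ 0 ∧ derivative P = C c
  eval_add : ∀ x y : L, P.eval₂ κ (x + y) = P.eval₂ κ x + P.eval₂ κ y

namespace IsAdditivePoly

variable {P : K[X]} (hP : IsAdditivePoly κ P)
include hP

set_option linter.unusedSectionVars false

theorem natDegree_pos : 0 < P.natDegree := by
  obtain ⟨c, hc, h⟩ := hP.derivative_eq
  rw [Nat.pos_iff_ne_zero]
  intro h0
  rw [eq_C_of_natDegree_eq_zero h0, derivative_C] at h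
  exact hc (by simpa using h.symm)

theorem eval_zero : P.eval₂ κ 0 = 0 := by
  simpa using hP.eval_add 0 0

theorem eval_neg (x : L) : P.eval₂ κ (-x) = -P.eval₂ κ x := by
  have := hP.eval_add x (-x)
  rw [add_neg_cancel, hP.eval_zero] at this
  exact (neg_eq_of_add_eq_zero_right this.symm).symm

theorem eval_sub (x y : L) : P.eval₂ κ (x - y) = P.eval₂ κ x - P.eval₂ κ y := by
  rw [sub_eq_add_neg, hP.eval_add, hP.eval_neg, sub_eq_add_neg]

/-- A nonzero constant derivative makes P separable, so P has as many roots in K as its degree. The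
sign in y + w is harmless because the roots form a group. -/
theorem exists_roots : ∃ (S : AddSubgroup K) (W : Finset K), (∀ w, w ∈ W ↔ w ∈ S) ∧
    W.card = P.natDegree ∧ ∀ y : L, ∏ w ∈ W, (y + κ w) = P.eval₂ κ y := by
  classical
  have hκ : ∀ w, P.eval w = 0 ↔ P.eval₂ κ (κ w) = 0 := fun w ↦ by
    rw [eval₂_at_apply, map_eq_zero]
  let S : AddSubgroup K :=
    { carrier := {w | P.eval w = 0}
      add_mem' := fun {a b} ha hb ↦ by
        rw [Set.mem_ofPred_eq, hκ] at *
        rw [map_add, hP.eval_add, ha, hb, add_zero]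
      zero_mem' := by rw [Set.mem_ofPred_eq, hκ, map_zero, hP.eval_zero]
      neg_mem' := fun {a} ha ↦ by
        rw [Set.mem_ofPred_eq, hκ] at *
        rw [map_neg, hP.eval_neg, ha, neg_zero] }
  have hS : ∀ w, w ∈ P.roots.toFinset ↔ w ∈ S := fun w ↦ by
    rw [Multiset.mem_toFinset, mem_roots hP.monic.ne_zero]
    rfl
  have hsep : P.Separable := by
    obtain ⟨c, hc, h⟩ := hP.derivative_eq
    rw [separable_def, h]
    exact ⟨0, C c⁻¹, by rw [zero_mul, zero_add, ← C_mul, inv_mul_cancel₀ hc, C_1]⟩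
  have hcard : P.roots.toFinset.card = P.natDegree := by
    rw [Multiset.toFinset_card_of_nodup (nodup_roots hsep)]
    exact (IsAlgClosed.splits P).natDegree_eq_card_roots.symm
  refine ⟨S, P.roots.toFinset, hS, hcard, fun y ↦ ?_⟩
  have hprod := monic_eq_prod_of_roots hP.monic P.roots.toFinset (fun x hx ↦ (hS x).1 hx) hcard.symm
  conv_rhs => rw [hprod, eval₂_finsetProd]
  refine Finset.prod_bij (fun w _ ↦ -w) ?_ ?_ ?_ ?_
  · intro w hw
    rw [hS] at hw ⊢
    exact S.neg_mem hw
  · intro w _ w' _ h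
    exact neg_injective h
  · intro w hw
    refine ⟨-w, ?_, neg_neg w⟩
    rw [hS] at hw ⊢
    exact S.neg_mem hw
  · intro w _
    rw [eval₂_sub, eval₂_X, eval₂_C, map_neg, sub_neg_eq_add]

/-- The residue has a preimage in the algebraically closed K, and Hensel's lemma lifts it, as the
derivative is a constant unit. -/
theorem exists_eval_eq (hA : IsLaurent v κ A π) {b : L} (hb : b ∈ A) (hvb : v b ≤ 1) :
    ∃ ε ∈ A, v ε ≤ 1 ∧ P.eval₂ κ ε = b := by
  obtain ⟨c, hc⟩ := hA.exists_residue hb hvb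
  let κ' : K →+* intRing v A := κ.codRestrict (intRing v A) fun c ↦ ⟨hA.const c, hA.val_const_le c⟩
  have hdeg : (P - C c).degree ≠ 0 := by
    have h := hP.natDegree_pos
    rw [degree_sub_C (natDegree_pos_iff_degree_pos.1 h)]
    exact (natDegree_pos_iff_degree_pos.1 h).ne'
  obtain ⟨c₀, hc₀⟩ := IsAlgClosed.exists_root _ hdeg
  have hc₀' : P.eval c₀ = c := by
    rw [IsRoot.def, Polynomial.eval_sub, eval_C] at hc₀
    exact sub_eq_zero.1 hc₀
  obtain ⟨u, hu, hPu⟩ := hP.derivative_eq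
  let f : (intRing v A)[X] := P.map κ' - C ⟨b, hb, hvb⟩
  have hfe : ∀ x : intRing v A, (↑(f.eval x) : L) = P.eval₂ κ x - b := fun x ↦ by
    change (intRing v A).subtype (f.eval x) = _
    rw [Polynomial.eval_sub, eval_C, eval_map, map_sub, hom_eval₂]
    rfl
  obtain ⟨ε, hε, -⟩ := hA.hensel f (κ' c₀) (by
    rw [hfe, show ((κ' c₀ : intRing v A) : L) = κ c₀ from rfl, eval₂_at_apply, hc₀',
      Valuation.map_sub_swap]
    exact hc) (by
    change v ((intRing v A).subtype (f.derivative.eval (κ' c₀))) = 1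
    rw [derivative_sub, derivative_C, sub_zero, derivative_map, hPu, map_C, eval_C]
    exact hA.val_const u hu)
  refine ⟨ε, ε.2.1, ε.2.2, ?_⟩
  have := hfe ε
  rw [hε] at this
  exact (sub_eq_zero.1 this.symm)

/-- A variable whose image under an additive polynomial has the same polar part as an inverse
uniformizer. -/
theorem exists_isAdditiveStep (hA : IsLaurent v κ A π) (hE : IsLaurent v κ E ϖ) {y b c : L}
    (hc : c ∈ A) (hvc : v c = (v π)⁻¹) (hb : b ∈ E) (hvb : v b ≤ 1)
    (hy : P.eval₂ κ y = c + b) : ∃ ε ∈ E, v ε ≤ 1 ∧ P.eval₂ κ (y - ε) = c ∧ P.eval₂ κ ε = b ∧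
      IsAdditiveStep v κ A (adjoinElement A (y - ε)) P.natDegree (y - ε) ∧
      v y = v (y - ε) ∧ IsLaurent v κ (adjoinElement A (y - ε)) (y - ε)⁻¹ ∧
      v (y - ε) ^ P.natDegree = (v π)⁻¹ := by
  obtain ⟨ε, hε, hvε, hPε⟩ := hP.exists_eval_eq hE hb hvb
  obtain ⟨S, W, hS, hW, hprod⟩ := hP.exists_roots
  have h1 : P.eval₂ κ (y - ε) = c := by rw [hP.eval_sub, hy, hPε, add_sub_cancel_right]
  have hAc : IsLaurent v κ A c⁻¹ := hA.of_val_eq (inv_mem hc) (by rw [map_inv₀, hvc, inv_inv])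
  have h2 : ∏ w ∈ W, (y - ε + κ w) = c := by rw [hprod, h1]
  obtain ⟨h3, -, -⟩ := additive_adjoin hS hAc h2
  have h4 : 1 < v (y - ε) := additive_one_lt hS hAc h2
  refine ⟨ε, hε, hvε, h1, hPε, ⟨S, W, c, hS, hW, hAc, h2, rfl⟩, ?_, h3, ?_⟩
  · refine val_eq_of_sub_lt' ?_
    rw [sub_sub_cancel]
    exact hvε.trans_lt h4
  · have := val_eq_of_sub_lt' (additive_pow_sub_lt hS hAc h2)
    rwa [hW, map_pow, hvc] at this

end IsAdditivePoly

variable {p a q : ℕ} [Fact p.Prime] [CharP K p] [CharP L p] (hq : q = p ^ a) (ha : 1 ≤ a)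
include hq ha

set_option linter.unusedSectionVars false

theorem natCast_pow_eq_zero {R : Type*} [CommRing R] [CharP R p] {r : ℕ} (hr : 1 ≤ r) :
    ((q ^ r : ℕ) : R) = 0 := by
  rw [CharP.cast_eq_zero_iff R p, hq]
  exact dvd_pow (dvd_pow_self p (by omega)) (by omega)

theorem two_le_pow {r : ℕ} (hr : 1 ≤ r) : 2 ≤ q ^ r := by
  have hp : 2 ≤ p := (Fact.out : p.Prime).two_le
  have h1 : p ^ 1 ≤ p ^ (a * r) := Nat.pow_le_pow_right (by omega) (Nat.mul_pos ha hr)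
  rw [hq, ← pow_mul]
  rw [pow_one] at h1
  omega

theorem isAdditivePoly_artinSchreier {j : ℕ} (hj : 1 ≤ j) :
    IsAdditivePoly κ (X ^ q ^ j - X : K[X]) ∧ (X ^ q ^ j - X : K[X]).natDegree = q ^ j := by
  have h2 := two_le_pow hq ha hj (p := p)
  have hdeg : (X : K[X]).degree < (q ^ j : ℕ) := by
    rw [degree_X]
    exact_mod_cast h2
  refine ⟨⟨monic_X_pow_sub hdeg, ⟨-1, by simp, ?_⟩, fun x y ↦ ?_⟩, ?_⟩
  · rw [derivative_sub, derivative_X_pow, natCast_pow_eq_zero hq ha hj, derivative_X]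
    simp
  · simp only [eval₂_sub, eval₂_X_pow, eval₂_X]
    rw [add_pow_pow hq]
    ring
  · exact FiniteField.X_pow_card_sub_X_natDegree_eq K h2

theorem isAdditivePoly_tr {k : ℕ} (hk : 1 ≤ k) :
    IsAdditivePoly κ (Tr q k X : K[X]) ∧ (Tr q k X : K[X]).natDegree = q ^ (k - 1) ∧
      ∀ y, (Tr q k X : K[X]).eval₂ κ y = Tr q k y := by
  have heval : ∀ y, (Tr q k X : K[X]).eval₂ κ y = Tr q k y := fun y ↦ by
    have := tr_map (eval₂RingHom κ y) q k X
    simpa using this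
  obtain ⟨m, rfl⟩ : ∃ m, k = m + 1 := ⟨k - 1, by omega⟩
  have hdeg : (∑ r ∈ Finset.range m, (X : K[X]) ^ q ^ r).degree < (q ^ m : ℕ) := by
    refine (degree_sum_le _ _).trans_lt ?_
    rw [Finset.sup_lt_iff (by exact WithBot.bot_lt_coe _)]
    intro r hr
    rw [degree_X_pow]
    have h2 := two_le_pow hq ha le_rfl (p := p) (r := 1)
    have := Nat.pow_lt_pow_right (a := q) (by rw [pow_one] at h2; omega) (Finset.mem_range.1 hr)
    exact_mod_cast this
  have hTr : (Tr q (m + 1) X : K[X]) = X ^ q ^ m + ∑ r ∈ Finset.range m, (X : K[X]) ^ q ^ r := by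
    rw [Tr, Finset.sum_range_succ, add_comm]
  refine ⟨⟨?_, ⟨1, one_ne_zero, ?_⟩, fun x y ↦ ?_⟩, ?_, heval⟩
  · rw [hTr]; exact monic_X_pow_add hdeg
  · rw [Tr, Finset.sum_range_succ', derivative_add, derivative_sum, Finset.sum_eq_zero]
    · simp
    · intro r _
      rw [derivative_X_pow, natCast_pow_eq_zero hq ha (by omega)]
      simp
  · rw [heval, heval, heval, tr_add hq]
  · rw [hTr, Nat.add_sub_cancel, add_comm, natDegree_add_eq_right_of_degree_lt]
    · simp
    · rw [degree_X_pow]; exact hdeg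

end AdditivePolynomials

/-! ### The two local steps of the tower: at a pole of u, and beyond it -/

section TowerSteps

open Polynomial IntermediateField

variable {L Γ K : Type*} [Field L] [LinearOrderedCommGroupWithZero Γ] [Field K] [IsAlgClosed K]
variable {v : Valuation L Γ} {κ : K →+* L} {A B E : Subfield L} {π ϖ : L}

theorem val_pow_sub_of_lt_one {h : L} {n : ℕ} (hn : 1 < n) (hh : v h < 1) :
    v (h ^ n - h) = v h := by
  rcases eq_or_ne h 0 with rfl | h0
  · rw [zero_pow (by omega), sub_zero]
  have hpos := (Valuation.pos_iff v).2 h0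
  have hlt : v (h ^ n) < v h := by
    rw [map_pow]
    exact pow_lt_self_of_lt_one₀ hpos hh hn
  exact Valuation.map_sub_eq_of_lt_right v hlt

variable {p a q : ℕ} [Fact p.Prime] [CharP K p] [CharP L p] (hq : q = p ^ a) (ha : 1 ≤ a)
include hq ha

set_option linter.unusedSectionVars false

/-- An element with `h ^ (q ^ m) - h` small has a residue in `𝔽_{q ^ m}`. -/
theorem exists_residue_pow {m : ℕ} (hm : 1 ≤ m) (hE : HasExpansions v κ E ϖ) {w : L} (hw : w ∈ E)
    (hvw : v w = 1) (hlt : v (w ^ q ^ m - w) < 1) :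
    ∃ c : K, c ≠ 0 ∧ v (w - κ c) < 1 ∧ κ c ^ q ^ m = κ c ∧
      (w - κ c) ^ q ^ m - (w - κ c) = w ^ q ^ m - w ∧ v (w - κ c) = v (w ^ q ^ m - w) := by
  have h2 := two_le_pow hq ha hm (p := p)
  obtain ⟨c, hc⟩ := hE.exists_residue hw hvw.le
  have hsub : (w - κ c) ^ q ^ m - (w - κ c) = w ^ q ^ m - w - (κ c ^ q ^ m - κ c) := by
    rw [sub_pow_pow hq]; ring
  have hval := val_pow_sub_of_lt_one (n := q ^ m) (by omega) hc
  have hcc : c ^ q ^ m - c = 0 := by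
    refine hE.eq_zero_of_val_lt ?_
    rw [map_sub, map_pow]
    have : κ c ^ q ^ m - κ c = (w ^ q ^ m - w) - ((w - κ c) ^ q ^ m - (w - κ c)) := by
      rw [hsub]; ring
    rw [this]
    exact Valuation.map_sub_lt v hlt (hval ▸ hc)
  have hcc' : κ c ^ q ^ m = κ c := by rw [← map_pow, sub_eq_zero.1 hcc]
  have hsub' : (w - κ c) ^ q ^ m - (w - κ c) = w ^ q ^ m - w := by
    rw [hsub, hcc', sub_self, sub_zero]
  refine ⟨c, ?_, hc, hcc', hsub', by rw [← hsub', hval]⟩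
  rintro rfl
  rw [map_zero, sub_zero, hvw] at hc
  exact lt_irrefl _ hc

theorem val_tr_add {m : ℕ} (hm : 1 ≤ m) (hκ : ∀ c, v (κ c) ≤ 1) {u : L} (hu : 1 < v u) (c : K) :
    v (Tr q m u + κ c) = v u ^ q ^ (m - 1) := by
  obtain ⟨hP, hdeg, heval⟩ := isAdditivePoly_tr (κ := κ) hq ha hm
  obtain ⟨S, W, hS, hW, hprod⟩ := hP.exists_roots
  have h1 := val_prod_add_sub_pow hκ W hu
  rw [hprod, heval, hW, hdeg] at h1
  have h2 : v (κ c) < v (u ^ q ^ (m - 1)) := by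
    rw [map_pow]
    refine (hκ c).trans_lt (one_lt_pow₀ hu (pow_ne_zero _ ?_))
    rw [hq]
    exact pow_ne_zero _ (Fact.out : p.Prime).ne_zero
  rw [← map_pow]
  refine val_eq_of_sub_lt' ?_
  rw [add_sub_right_comm]
  exact Valuation.map_add_lt v h1 h2

variable {j k : ℕ} (hj : 1 ≤ j) (hk : 1 ≤ k) {u X Z t : L} {α β : K}
  (hX : X = Tr q k u + κ α) (hZ : Z = Tr q j u + κ β) (hXZ : X ^ q ^ j - X = Z ^ q ^ k - Z)
include hj hk hX hZ hXZ

/-- The step below the field generated by a pole `u`. -/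
theorem pole_step (hE : IsLaurent v κ E u⁻¹) (htE : t ∈ E) (ht : t ^ (q ^ j - 1) * Z ^ q ^ k = X)
    (hA : IsLaurent v κ A t) (hAE : A ≤ E) : ∃ y, IsAdditiveStep v κ A E (q ^ (k - 1)) y := by
  have hu := hE.one_lt_val
  have huE : u ∈ E := by simpa using inv_mem hE.mem
  have hvX := val_tr_add hq ha hk hE.val_const_le hu α
  have hvZ := val_tr_add hq ha hj hE.val_const_le hu β
  rw [← hX] at hvX
  rw [← hZ] at hvZ
  have h2j := two_le_pow hq ha hj (p := p)
  have h2k := two_le_pow hq ha hk (p := p)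
  have hq2 : 2 ≤ q := by simpa using two_le_pow hq ha le_rfl (p := p)
  have hU0 : 0 < v u := zero_lt_one.trans hu
  have hX0 : 0 < v X := by rw [hvX]; exact pow_pos hU0 _
  have hZ0 : 0 < v Z := by rw [hvZ]; exact pow_pos hU0 _
  have hkk : q ^ k = q * q ^ (k - 1) := by rw [← pow_succ']; congr 1; omega
  have hjj : q ^ j = q * q ^ (j - 1) := by rw [← pow_succ']; congr 1; omega
  have hXq : v X ^ q ^ j = v Z ^ q ^ k := by
    rw [hvX, hvZ, ← pow_mul, ← pow_mul, hkk, hjj]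
    congr 1; ring
  have hvt := congrArg v ht
  rw [map_mul, map_pow, map_pow] at hvt
  -- The values of X^(q^j) and Z^(q^k) agree, so the equation for t makes the (q^j - 1)-th power of
  -- t X a unit.
  have hω : v t * v X = 1 := by
    have h1 : (v t * v X) ^ (q ^ j - 1) = 1 := by
      refine mul_right_cancel₀ hX0.ne' ?_
      rw [mul_pow, mul_assoc, ← pow_succ, Nat.sub_add_cancel (by omega), hXq, hvt, one_mul]
    exact (pow_left_inj₀ zero_le zero_le (by omega)).1 (h1.trans (one_pow _).symm)
  have hXE : X ∈ E := by
    rw [hX]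
    exact add_mem (sum_mem fun r _ ↦ pow_mem huE _) (hE.const α)
  have hωq : (t * X) ^ q ^ j - t * X = t ^ q ^ j * (X - Z) := by
    have h1 : t * X = t ^ q ^ j * Z ^ q ^ k := by
      rw [← ht, ← mul_assoc, ← pow_succ', Nat.sub_add_cancel (by omega)]
    have h2 : X - Z = X ^ q ^ j - Z ^ q ^ k := by linear_combination -hXZ
    rw [h2, mul_sub, ← h1, mul_pow]
  have hZt : v t ^ (q ^ j - 1) * v Z ≤ 1 := by
    have h1 : v t ^ (q ^ j - 1) * v Z * v Z ^ (q ^ k - 1) = v X := by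
      rw [mul_assoc, ← pow_succ', Nat.sub_add_cancel (by omega), hvt]
    have h3 : v X ≤ v Z ^ (q ^ k - 1) := by
      rw [hvX, hvZ, ← pow_mul]
      refine pow_le_pow_right₀ hu.le ?_
      have h4 : 1 ≤ q ^ (j - 1) := Nat.one_le_pow _ _ (by omega)
      have h5 : 1 ≤ q ^ (k - 1) := Nat.one_le_pow _ _ (by omega)
      have h6 : q ^ (k - 1) ≤ q ^ k - 1 := by
        have := Nat.mul_le_mul_right (q ^ (k - 1)) hq2
        omega
      exact h6.trans (Nat.le_mul_of_pos_left _ h4)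
    rw [← h1] at h3
    have h4 : 0 < v Z ^ (q ^ k - 1) := pow_pos hZ0 _
    exact (mul_le_iff_le_one_left h4).1 h3
  have hsmall : v ((t * X) ^ q ^ j - t * X) ≤ v t := by
    have h1 : v t ^ q ^ j = v t ^ (q ^ j - 1) * v t := by
      rw [← pow_succ, Nat.sub_add_cancel (by omega)]
    rw [hωq, map_mul, map_pow, h1]
    rcases le_total (v X) (v Z) with h | h
    · refine (mul_le_mul_right ((Valuation.map_sub v X Z).trans (max_le h le_rfl)) _).trans ?_
      rw [mul_right_comm]
      exact mul_le_of_le_one_left' hZt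
    · refine (mul_le_mul_right ((Valuation.map_sub v X Z).trans (max_le le_rfl h)) _).trans ?_
      rw [mul_assoc, hω, mul_one]
      exact pow_le_of_le_one zero_le hA.lt_one.le (by omega)
  -- So t X is a constant c of 𝔽_(q^j) up to an error no larger than t; that is, X = c/t plus an
  -- integral element.
  obtain ⟨c, hc, hlt, -, -, hres⟩ := exists_residue_pow hq ha hj hE.toHasExpansions
    (mul_mem htE hXE) (by rw [map_mul]; exact hω) (hsmall.trans_lt hA.lt_one)
  have ht0 : t ≠ 0 := hA.ne_zero
  obtain ⟨hP, hdeg, heval⟩ := isAdditivePoly_tr (κ := κ) hq ha hk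
  obtain ⟨ε, hεE, -, -, -, hstep, hvy, hB, -⟩ := hP.exists_isAdditiveStep hA hE (y := u)
    (c := κ c * t⁻¹) (b := (t * X - κ c) * t⁻¹ - κ α) (mul_mem (hA.const c) (inv_mem hA.mem))
    (by rw [map_mul, hA.val_const c hc, one_mul, map_inv₀])
    (sub_mem (mul_mem (sub_mem (mul_mem htE hXE) (hE.const c)) (inv_mem htE)) (hE.const α))
    (by
      refine (Valuation.map_sub v _ _).trans (max_le ?_ (hE.val_const_le α))
      rw [map_mul, hres, map_inv₀]
      exact (mul_le_mul_left hsmall _).trans (mul_inv_cancel₀ hA.pos.ne').le)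
    (by
      rw [heval, eq_sub_of_add_eq hX.symm]
      field_simp
      ring)
  rw [hdeg] at hstep
  -- Removing the integral ε leaves the value of u unchanged, so the complete subfield generated by
  -- u - ε contains a uniformizer of E.
  have hBE : adjoinElement A (u - ε) = E := hB.eq_of_le hE.toHasExpansions
    (adjoinElement_le hAE (sub_mem huE hεE)) (by rw [map_inv₀, map_inv₀, hvy])
  rw [hBE] at hstep
  exact ⟨_, hstep⟩

variable (hjk : j.Coprime k)
include hjk

/-- The step at a place where `Z` is a unit and `X` vanishes. -/
theorem unit_step (hq1 : ((q ^ j - 1 : ℕ) : K) ≠ 0) (hL : IsLaurent v κ ⊤ ϖ) (hA : IsLaurent v κ A t)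
    (ht : X ^ q ^ j = t ^ (q ^ j - 1) * Z) (hvZ : v Z = 1) :
    (∃ y, IsAdditiveStep v κ A (adjoinElement A u) (q ^ j) y) ∧
      ∃ t' ∈ adjoinElement A u, IsLaurent v κ (adjoinElement A u) t' ∧
        t' ^ (q ^ j - 1) * Z ^ q ^ k = X := by
  have h2j := two_le_pow hq ha hj (p := p)
  have h2k := two_le_pow hq ha hk (p := p)
  have ht0 : t ≠ 0 := hA.ne_zero
  have hZ0 : Z ≠ 0 := by rintro rfl; simp at hvZ
  have hvXq : v X ^ q ^ j = v t ^ (q ^ j - 1) := by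
    rw [← map_pow, ht, map_mul, hvZ, mul_one, map_pow]
  have hvX : v X < 1 := by
    by_contra! h
    have h1 : v t ^ (q ^ j - 1) < 1 := pow_lt_one₀ zero_le hA.lt_one (by omega)
    rw [← hvXq] at h1
    exact absurd (one_le_pow₀ h) (not_le.2 h1)
  have hvXX := val_pow_sub_of_lt_one (n := q ^ j) (by omega) hvX
  obtain ⟨c, hc, hlt, hcc, hhk, hvh⟩ := exists_residue_pow hq ha hk hL.toHasExpansions
    (Subfield.mem_top Z) hvZ (by rw [← hXZ, hvXX]; exact hvX)
  set h := Z - κ c with hh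
  rw [← hXZ, hvXX] at hvh
  -- The small elements h and X have the same value, and both powers on the right are bounded by t,
  -- since X^(q^j) has the value of t^(q^j - 1).
  have hsub : h - X = h ^ q ^ k - X ^ q ^ j := by linear_combination hXZ - hhk
  have hvsub : v (h - X) ≤ v t := by
    rw [hsub]
    refine (Valuation.map_sub v _ _).trans (max_le ?_ ?_)
    · rw [map_pow, hvh]
      refine (pow_le_pow_iff_left₀ zero_le zero_le (show q ^ j ≠ 0 by omega)).1 ?_
      rw [← pow_mul, mul_comm, pow_mul, hvXq, ← pow_mul]
      refine pow_le_pow_right_of_le_one' hA.lt_one.le ?_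
      calc q ^ j ≤ (q ^ j - 1) * 2 := by omega
        _ ≤ _ := Nat.mul_le_mul_left _ h2k
    · rw [map_pow, hvXq]
      exact pow_le_of_le_one zero_le hA.lt_one.le (by omega)
  set χ := X / t with hχ
  have hXχ : X = t * χ := by rw [hχ, mul_div_cancel₀ _ ht0]
  have hχq : χ ^ q ^ j = Z * t⁻¹ := by
    have h1 : t ^ q ^ j = t ^ (q ^ j - 1) * t := by
      rw [← pow_succ, Nat.sub_add_cancel (by omega)]
    rw [hχ, div_pow, ht, h1]
    field_simp
  have hZχ : Z = t * χ ^ q ^ j := by rw [hχq]; field_simp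
  obtain ⟨hP, hdeg⟩ := isAdditivePoly_artinSchreier (κ := κ) hq ha hj
  have heval : ∀ y, (Polynomial.X ^ q ^ j - Polynomial.X : K[X]).eval₂ κ y = y ^ q ^ j - y :=
    fun y ↦ by simp
  have hcA : κ c * t⁻¹ ∈ A := mul_mem (hA.const c) (inv_mem hA.mem)
  have hvc : v (κ c * t⁻¹) = (v t)⁻¹ := by
    rw [map_mul, hA.val_const c hc, one_mul, map_inv₀]
  -- χ^(q^j) - χ = (Z - X)/t splits into the polar part c/t and the integral part (h - X)/t;
  -- correspondingly χ = y + ε. At this point ε is only known to lie in L.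
  obtain ⟨ε, -, hvε, hPy, hPε, hstep, hvy, hB, hvyq⟩ := hP.exists_isAdditiveStep hA hL (y := χ)
    (c := κ c * t⁻¹) (b := (h - X) * t⁻¹) hcA hvc (Subfield.mem_top _)
    (by
      rw [map_mul, map_inv₀]
      exact (mul_le_mul_left hvsub _).trans (mul_inv_cancel₀ hA.pos.ne').le)
    (by
      rw [heval, hχq, hh, hχ]
      field_simp
      ring)
  rw [hdeg] at hstep hvyq
  rw [heval] at hPy hPε
  set y := χ - ε with hy
  set B := adjoinElement A y with hBdef
  have hAB : A ≤ B := le_adjoinElement A y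
  have hyB : y ∈ B := self_mem_adjoinElement A y
  have htB : t ∈ B := hAB hA.mem
  have hvt : v t ≤ 1 := hA.lt_one.le
  have hχy : χ = y + ε := by rw [hy]; ring
  -- Substitute X = t χ, Z = t χ^(q^j) and χ = y + ε in the relation between X and Z and divide by
  -- t: the result is an equation for ε with coefficients in A(y).
  have hroot : ε ^ q ^ j - ε + (κ c * t⁻¹ - t ^ (q ^ k - 1) * y ^ q ^ (j + k) +
      t ^ (q ^ j - 1) * y ^ q ^ j) - t ^ (q ^ k - 1) * ε ^ q ^ (j + k) +
      t ^ (q ^ j - 1) * ε ^ q ^ j = 0 := by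
    have h1 : t ^ (q ^ k - 1) * χ ^ q ^ (j + k) * t = Z ^ q ^ k := by
      rw [hZχ, mul_pow, ← pow_mul, ← pow_add, mul_right_comm, ← pow_succ,
        Nat.sub_add_cancel (by omega)]
    have h2 : t ^ (q ^ j - 1) * χ ^ q ^ j * t = X ^ q ^ j := by
      rw [hXχ, mul_pow, mul_right_comm, ← pow_succ, Nat.sub_add_cancel (by omega)]
    have h3 : χ ^ q ^ (j + k) = y ^ q ^ (j + k) + ε ^ q ^ (j + k) := by
      rw [hχy, add_pow_pow hq]
    have h4 : χ ^ q ^ j = y ^ q ^ j + ε ^ q ^ j := by rw [hχy, add_pow_pow hq]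
    refine mul_right_cancel₀ ht0 ?_
    rw [hPε]
    rw [h3] at h1
    rw [h4] at h2
    have h5 : t⁻¹ * t = 1 := inv_mul_cancel₀ ht0
    linear_combination -h1 + h2 + (h - X + κ c) * h5 + hXZ + hh
  -- The constant coefficient is integral because all other terms of the equation are. The
  -- derivative is -1, so ε is a simple root.
  have hεB : ε ∈ B := by
    have hb1 : κ c * t⁻¹ - t ^ (q ^ k - 1) * y ^ q ^ (j + k) + t ^ (q ^ j - 1) * y ^ q ^ j ∈
        intRing v B := by
      refine ⟨add_mem (sub_mem (hAB hcA) (mul_mem (pow_mem htB _) (pow_mem hyB _)))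
        (mul_mem (pow_mem htB _) (pow_mem hyB _)), ?_⟩
      have h1 := eq_neg_of_add_eq_zero_left hroot
      have h2 : κ c * t⁻¹ - t ^ (q ^ k - 1) * y ^ q ^ (j + k) + t ^ (q ^ j - 1) * y ^ q ^ j =
          ε - ε ^ q ^ j + t ^ (q ^ k - 1) * ε ^ q ^ (j + k) - t ^ (q ^ j - 1) * ε ^ q ^ j := by
        linear_combination h1
      rw [h2]
      have hε : ε ∈ v.integer := hvε
      have ht' : t ∈ v.integer := hvt
      exact sub_mem (add_mem (sub_mem hε (pow_mem hε _)) (mul_mem (pow_mem ht' _) (pow_mem hε _)))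
        (mul_mem (pow_mem ht' _) (pow_mem hε _))
    have htI : t ∈ intRing v B := ⟨htB, hvt⟩
    let τ : intRing v B := ⟨t, htI⟩
    let f : (intRing v B)[X] := Polynomial.X ^ q ^ j - Polynomial.X + C ⟨_, hb1⟩ -
      C (τ ^ (q ^ k - 1)) * Polynomial.X ^ q ^ (j + k) + C (τ ^ (q ^ j - 1)) * Polynomial.X ^ q ^ j
    refine hB.mem_of_root hL.toHasExpansions le_top f (y := ε) (Subfield.mem_top _) hvε ?_ ?_
    · simp only [f, eval₂_add, eval₂_sub, eval₂_mul, eval₂_X_pow, eval₂_X, eval₂_C]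
      exact hroot
    · have h0 : ∀ r, 1 ≤ r → ((q ^ r : ℕ) : L) = 0 := fun r hr ↦ natCast_pow_eq_zero hq ha hr
      have h1 : f.derivative.eval₂ (intRing v B).subtype ε = -1 := by
        simp only [f, derivative_add, derivative_sub, derivative_mul, derivative_X_pow,
          derivative_C, derivative_X, eval₂_add, eval₂_sub, eval₂_mul, eval₂_C, map_natCast, eval₂_natCast,
          eval₂_one, eval₂_X_pow, eval₂_zero, h0 j hj, h0 (j + k) (by omega)]
        ring
      rw [h1, Valuation.map_neg, map_one]
  have hχB : χ ∈ B := by rw [hχy]; exact add_mem hyB hεB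
  -- Both traces of u lie in B, and j and k are coprime.
  have huB : u ∈ B := by
    refine mem_of_tr_mem hq B (fun x hx r ↦ pow_mem hx _) _ j k rfl hjk ?_ ?_
    · rw [eq_sub_of_add_eq hZ.symm, hZχ]
      exact sub_mem (mul_mem htB (pow_mem hχB _)) (hB.const β)
    · rw [eq_sub_of_add_eq hX.symm, hXχ]
      exact sub_mem (mul_mem htB hχB) (hB.const α)
  have huA := self_mem_adjoinElement A u
  have hAu := le_adjoinElement A u
  have hXu : X ∈ adjoinElement A u := by
    rw [hX]; exact add_mem (sum_mem fun r _ ↦ pow_mem huA _) (hAu (hA.const α))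
  have hZu : Z ∈ adjoinElement A u := by
    rw [hZ]; exact add_mem (sum_mem fun r _ ↦ pow_mem huA _) (hAu (hA.const β))
  have hle1 : adjoinElement A χ ≤ adjoinElement A u :=
    adjoinElement_le hAu (div_mem hXu (hAu hA.mem))
  have hle2 : adjoinElement A u ≤ B := adjoinElement_le hAB huB
  -- χ has the value of y, so it generates an equally ramified subfield of B; and χ = X/t lies in
  -- A(u).
  have hBχ : adjoinElement A χ = B := by
    obtain ⟨S, W, s, hS, hW, hs, hys, -⟩ := hstep
    obtain ⟨hfd, hfr⟩ := additive_finrank_le hS hs hys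
    have hle : A⟮χ⟯ ≤ A⟮y⟯ := adjoin_simple_le_iff.2 hχB
    have hfdχ : FiniteDimensional A A⟮χ⟯ :=
      Module.Finite.of_injective (inclusion hle).toLinearMap (inclusion_injective hle)
    have hfrχ : Module.finrank A A⟮χ⟯ ≤ q ^ j := by
      rw [← hW]
      exact (LinearMap.finrank_le_finrank_of_injective (f := (inclusion hle).toLinearMap)
        (inclusion_injective hle)).trans hfr
    have hA' : IsLaurent v κ A (κ c * t⁻¹)⁻¹ :=
      hA.of_val_eq (inv_mem hcA) (by rw [map_inv₀, hvc, inv_inv])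
    have h1 := (hA'.adjoin_pole (y := χ) (e := q ^ j) (by omega) (by
      rw [hχq, hvc, ← sub_mul, map_mul, map_inv₀]
      exact mul_lt_of_lt_one_left (by rw [← map_inv₀]; exact (Valuation.pos_iff v).2 (inv_ne_zero ht0)) hlt) hfrχ).1
    exact h1.eq_of_le hB.toHasExpansions (adjoinElement_le hAB hχB) (by rw [map_inv₀, map_inv₀, hvy])
  have hBu : adjoinElement A u = B := le_antisymm hle2 (hBχ ▸ hle1)
  rw [hBu]
  refine ⟨⟨y, hstep⟩, ?_⟩
  rw [hBu] at hXu hZu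
  -- X = t χ, where χ has the value of y and 1/t the value of y^(q^j). So a (q^j - 1)-th root is
  -- again a uniformizer and the step can be repeated.
  have hvX' : v (X / Z ^ q ^ k) = v y⁻¹ ^ (((q ^ j - 1 : ℕ) : ℤ) * 1) := by
    have hy0 : v y ≠ 0 := (Valuation.ne_zero_iff v).2 hB.ne_zero_of_inv
    have hvt' : v t = (v y ^ (q ^ j - 1) * v y)⁻¹ := by
      rw [← pow_succ, Nat.sub_add_cancel (by omega), hvyq, inv_inv]
    rw [mul_one, zpow_natCast, map_div₀, map_pow, hvZ, one_pow, div_one, hXχ, map_mul, hvy,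
      map_inv₀, inv_pow, hvt', mul_inv, mul_assoc, inv_mul_cancel₀ hy0, mul_one]
  obtain ⟨t', ht'B, ht'⟩ := hB.exists_pow_eq hq1 (div_mem hXu (pow_mem hZu _)) hvX'
  refine ⟨t', ht'B, hB.of_val_eq ht'B ?_, ?_⟩
  · have h1 : v t' ^ (q ^ j - 1) = v y⁻¹ ^ (q ^ j - 1) := by
      rw [← map_pow, ht', hvX', mul_one, zpow_natCast]
    exact (pow_left_inj₀ zero_le zero_le (by omega)).1 h1
  · rw [ht', div_mul_cancel₀ _ (pow_ne_zero _ hZ0)]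

end TowerSteps

/-! ### Closures in a complete valued field -/

section Topology

open Filter Topology

variable {L Γ K : Type*} [Field L] [LinearOrderedCommGroupWithZero Γ] [Valued L Γ] [Field K]
variable {κ : K →+* L} {A : Subfield L} {π ϖ : L}

theorem valued_mem_nhds {s : Set L} {x : L} :
    s ∈ 𝓝 x ↔ ∃ b : L, b ≠ 0 ∧ {y | Valued.v (y - x) < Valued.v b} ⊆ s := by
  rw [Valued.mem_nhds]
  constructor
  · rintro ⟨γ, h⟩
    obtain ⟨b, hb⟩ := MonoidWithZeroHom.ValueGroup₀.restrict₀_surjective _ γ.1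
    refine ⟨b, ?_, fun y hy ↦ h ?_⟩
    · rintro rfl
      exact γ.ne_zero (by rw [← hb]; simp)
    · change Valued.v.restrict (y - x) < γ.1
      rw [← hb]
      exact Valued.v.restrict_lt_iff.2 hy
  · rintro ⟨b, hb, h⟩
    have h0 : Valued.v.restrict b ≠ 0 := by simp [hb]
    exact ⟨Units.mk0 _ h0, fun y hy ↦ h (Valued.v.restrict_lt_iff.1 hy)⟩

theorem valued_mem_closure {s : Set L} {x : L} :
    x ∈ closure s ↔ ∀ b : L, b ≠ 0 → ∃ y ∈ s, Valued.v (y - x) < Valued.v b := by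
  rw [mem_closure_iff_nhds]
  constructor
  · intro h b hb
    obtain ⟨y, hy, hys⟩ := h _ (valued_mem_nhds.2 ⟨b, hb, subset_rfl⟩)
    exact ⟨y, hys, hy⟩
  · intro h t ht
    obtain ⟨b, hb, hbt⟩ := valued_mem_nhds.1 ht
    obtain ⟨y, hy, hyb⟩ := h b hb
    exact ⟨y, hbt hyb, hy⟩

/-- A nonzero element of the closure shares its leading monomial with a sufficiently near element of
A. -/
theorem HasExpansions.closure (h : HasExpansions Valued.v κ A π) :
    HasExpansions Valued.v κ A.topologicalClosure π where
  val_const := h.val_const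
  const c := A.le_topologicalClosure (h.const c)
  mem := A.le_topologicalClosure h.mem
  ne_zero := h.ne_zero
  lt_one := h.lt_one
  approx a ha h0 := by
    obtain ⟨x, hx, hxa⟩ := valued_mem_closure.1 ha a h0
    have hv := val_eq_of_sub_lt' hxa
    have hx0 : x ≠ 0 := by rwa [← Valuation.ne_zero_iff Valued.v, hv, Valuation.ne_zero_iff]
    obtain ⟨m, c, hc⟩ := h.approx x hx hx0
    refine ⟨m, c, ?_⟩
    have : a - κ c * π ^ m = (x - κ c * π ^ m) - (x - a) := by ring
    rw [this]
    exact Valuation.map_sub_lt _ (hv ▸ hc) hxa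

theorem exists_limit [CompleteSpace L] {f : ℕ → L} (hL : HasExpansions Valued.v κ ⊤ ϖ)
    (hπ : Valued.v π < (1 : Γ))
    (hf : ∀ n, Valued.v (f (n + 1) - f n) ≤ Valued.v π ^ n) :
    ∃ a, Tendsto f atTop (𝓝 a) ∧ ∀ n, Valued.v (a - f n) ≤ Valued.v π ^ n := by
  have hmono : ∀ n m, n ≤ m → Valued.v (f m - f n) ≤ Valued.v π ^ n := by
    intro n m hnm
    induction m, hnm using Nat.le_induction with
    | base => simp
    | succ m hnm ih =>
      rw [← sub_add_sub_cancel (f (m + 1)) (f m)]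
      exact (Valuation.map_add _ _ _).trans
        (max_le ((hf m).trans (pow_le_pow_right_of_le_one' hπ.le hnm)) ih)
  have hsmall : ∀ b : L, b ≠ 0 → ∃ N, Valued.v π ^ N < Valued.v b := by
    intro b hb
    obtain ⟨N, hN⟩ := hL.exists_pow_lt (Subfield.mem_top b) hb
    exact ⟨N, (pow_le_pow_left₀ zero_le
      (hL.val_le_of_lt_one (Subfield.mem_top π) hπ) N).trans_lt hN⟩
  have hcauchy : CauchySeq f := by
    refine Valued.cauchy_iff.2 ⟨inferInstance, fun γ ↦ ?_⟩
    obtain ⟨b, hb⟩ := MonoidWithZeroHom.ValueGroup₀.restrict₀_surjective _ γ.1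
    have hb0 : b ≠ 0 := by
      rintro rfl
      exact γ.ne_zero (by rw [← hb]; simp)
    obtain ⟨N, hN⟩ := hsmall b hb0
    refine ⟨f '' Set.Ici N, image_mem_map (Ici_mem_atTop N), ?_⟩
    rintro _ ⟨n, hn, rfl⟩ _ ⟨m, hm, rfl⟩
    rw [← hb]
    refine Valued.v.restrict_lt_iff.2 ?_
    rw [← sub_sub_sub_cancel_right _ _ (f N)]
    exact Valuation.map_sub_lt _ ((hmono N m hm).trans_lt hN) ((hmono N n hn).trans_lt hN)
  obtain ⟨a, ha⟩ := cauchySeq_tendsto_of_complete hcauchy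
  refine ⟨a, ha, fun n ↦ ?_⟩
  by_cases hfa : a - f n = 0
  · rw [hfa, map_zero]; exact zero_le
  obtain ⟨m, hm, hnm⟩ := ((ha.eventually (valued_mem_nhds.2 ⟨a - f n, hfa, subset_rfl⟩)).and
    (eventually_ge_atTop n)).exists
  have h1 : Valued.v (f m - f n) = Valued.v (a - f n) := by
    refine val_eq_of_sub_lt' ?_
    rw [sub_sub_sub_cancel_right]
    exact hm
  rw [← h1]
  exact hmono n m hnm

theorem HasExpansions.isLaurent_closure [CompleteSpace L] (hL : HasExpansions Valued.v κ ⊤ ϖ)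
    (h : HasExpansions Valued.v κ A π) : IsLaurent Valued.v κ A.topologicalClosure π where
  toHasExpansions := h.closure
  complete f hfA hf := by
    obtain ⟨a, ha, hn⟩ := exists_limit hL h.lt_one hf
    exact ⟨a, A.isClosed_topologicalClosure.mem_of_tendsto ha (Eventually.of_forall hfA), hn⟩

end Topology

/-! ### Expansions of rational functions -/

section Rational

open Polynomial

variable {L Γ K F : Type*} [Field L] [LinearOrderedCommGroupWithZero Γ] [Field K] [Field F]
  [Algebra K F] {v : Valuation L Γ}

theorem exists_residue_eval {κ : K →+* L} (hκ : ∀ c, c ≠ 0 → v (κ c) = 1) {s : L}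
    (hs : v s < 1) {P : K[X]} (hP : P ≠ 0) : ∃ (m : ℕ) (c : K) (y : L), c ≠ 0 ∧
      v (y - κ c) < 1 ∧ P.eval₂ κ s = y * s ^ m := by
  have hκ' : ∀ c, v (κ c) ≤ 1 := fun c ↦ by
    rcases eq_or_ne c 0 with rfl | hc
    · simp
    · exact (hκ c hc).le
  obtain ⟨Q, hQ⟩ := X_pow_dvd_iff.2 fun d (hd : d < P.natTrailingDegree) ↦
    coeff_eq_zero_of_lt_natTrailingDegree hd
  refine ⟨P.natTrailingDegree, Q.coeff 0, Q.eval₂ κ s, ?_, ?_, ?_⟩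
  · have h1 : P.coeff P.natTrailingDegree = Q.coeff 0 := by
      conv_lhs => rw [hQ]
      rw [coeff_X_pow_mul', if_pos]
      · simp [← hQ]
      · rw [← hQ]
    rw [← h1]
    exact (trailingCoeff_nonzero_iff_nonzero).2 hP
  · rw [← divX_mul_X_add Q]
    simp only [eval₂_add, eval₂_mul, eval₂_X, eval₂_C, coeff_add, mul_coeff_zero, coeff_X_zero,
      mul_zero, coeff_C_zero, zero_add, add_sub_cancel_right, map_mul]
    refine (mul_le_of_le_one_left' ?_).trans_lt hs
    rw [eval₂_eq_sum_range]
    refine Valuation.map_sum_le v fun l _ ↦ ?_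
    rw [map_mul, map_pow]
    exact mul_le_one' (hκ' _) (pow_le_one' hs.le l)
  · conv_lhs => rw [hQ]
    rw [eval₂_mul, eval₂_X_pow, mul_comm]

theorem hasExpansions_adjoin {i : F →+* L} {κ : K →+* L} (hi : ∀ c, i (algebraMap K F c) = κ c)
    (hκ : ∀ c, c ≠ 0 → v (κ c) = 1) {s : F} (hs0 : s ≠ 0) (hs : v (i s) < 1) :
    HasExpansions v κ ((IntermediateField.adjoin K {s}).toSubfield.map i) (i s) where
  val_const := hκ
  const c := ⟨algebraMap K F c, (IntermediateField.adjoin K {s}).algebraMap_mem c, hi c⟩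
  mem := ⟨s, IntermediateField.mem_adjoin_simple_self K s, rfl⟩
  ne_zero := by simpa using hs0
  lt_one := hs
  approx := by
    rintro _ ⟨f, hf, rfl⟩ hf0
    obtain ⟨P, Q, rfl⟩ := IntermediateField.mem_adjoin_simple_iff K f |>.1 hf
    have hev : ∀ P : K[X], i (aeval s P) = P.eval₂ κ (i s) := fun P ↦ by
      rw [aeval_def, hom_eval₂]
      congr 1
      ext c
      exact hi c
    have his : i s ≠ 0 := by simpa using hs0
    rw [map_div₀, hev, hev] at hf0 ⊢
    have hP : P ≠ 0 := by rintro rfl; simp at hf0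
    have hQ : Q ≠ 0 := by rintro rfl; simp at hf0
    obtain ⟨m, c, y, hc, hy, hPy⟩ := exists_residue_eval hκ hs hP
    obtain ⟨n, d, w, hd, hw, hQw⟩ := exists_residue_eval hκ hs hQ
    have hr := residue_mul hκ hc hy (inv_ne_zero hd) (residue_inv hκ hd hw)
    have hw0 : w ≠ 0 := by
      rintro rfl
      rw [hQw, zero_mul, div_zero] at hf0
      exact hf0 rfl
    have hfe : P.eval₂ κ (i s) / Q.eval₂ κ (i s) = y * w⁻¹ * i s ^ (m - n : ℤ) := by
      rw [hPy, hQw, zpow_sub₀ his, zpow_natCast, zpow_natCast]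
      field_simp
    refine ⟨m - n, c * d⁻¹, ?_⟩
    have hv1 : v (y * w⁻¹) = 1 := by
      have hcd := hκ (c * d⁻¹) (mul_ne_zero hc (inv_ne_zero hd))
      rw [← hcd] at hr ⊢
      exact val_eq_of_sub_lt' hr
    rw [hfe, ← sub_mul, Valuation.map_mul, Valuation.map_mul v (y * w⁻¹), hv1, one_mul]
    exact mul_lt_of_lt_one_left (by
      rw [map_zpow₀]; exact zpow_pos ((Valuation.pos_iff v).2 his) _) hr

end Rational

/-! ### The completion at a place -/

section Completion

variable {K F : Type*} [Field K] [Field F] [Algebra K F] {O : ValuationSubring F}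

theorem val_toCompl (O : ValuationSubring F) (x : F) :
    (Valued.v (toCompl O x) : O.ValueGroup) = O.valuation x :=
  Valued.valuedCompletion_apply (K := WithVal O.valuation) _

theorem topologicalClosure_fieldRange_toCompl (O : ValuationSubring F) :
    (toCompl O).fieldRange.topologicalClosure = ⊤ := by
  refine eq_top_iff.2 fun x _ ↦ ?_
  have h : DenseRange (toCompl O) :=
    (UniformSpace.Completion.denseRange_coe (α := WithVal O.valuation)).comp
      (WithVal.equiv O.valuation).symm.surjective.denseRange
      (UniformSpace.Completion.continuous_coe _)
  exact h x

theorem mem_complRing_iff (x : Compl O) : x ∈ complRing O ↔ Valued.v x ≤ (1 : O.ValueGroup) :=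
  Iff.rfl

/-- The constants in the completion. -/
def constCompl (K : Type*) [Field K] [Algebra K F] (O : ValuationSubring F) : K →+* Compl O :=
  (toCompl O).comp (algebraMap K F)

theorem val_constCompl (hO : ∀ c : K, algebraMap K F c ∈ O) (c : K) (hc : c ≠ 0) :
    (Valued.v (constCompl K O c) : O.ValueGroup) = 1 := by
  have hle : ∀ c : K, (Valued.v (constCompl K O c) : O.ValueGroup) ≤ 1 := fun c ↦ by
    rw [constCompl, RingHom.comp_apply, val_toCompl]
    exact (O.valuation_le_one_iff _).2 (hO c)
  refine le_antisymm (hle c) ?_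
  have h1 : (Valued.v (constCompl K O c) : O.ValueGroup) * Valued.v (constCompl K O c⁻¹) = 1 := by
    rw [← map_mul, ← map_mul, mul_inv_cancel₀ hc, map_one, map_one]
  rw [← h1]
  exact mul_le_of_le_one_right' (hle _)

theorem hasExpansions_toCompl_adjoin (hO : ∀ c : K, algebraMap K F c ∈ O) {s : F} (hs0 : s ≠ 0)
    (hs : O.valuation s < 1) : HasExpansions (Valued.v : Valuation (Compl O) O.ValueGroup)
      (constCompl K O) ((IntermediateField.adjoin K {s}).toSubfield.map (toCompl O))
      (toCompl O s) :=
  hasExpansions_adjoin (fun _ ↦ rfl) (val_constCompl hO) hs0 (by rw [val_toCompl]; exact hs)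

theorem isLaurent_hat_adjoin {ϖ : Compl O} (hL : HasExpansions
      (Valued.v : Valuation (Compl O) O.ValueGroup) (constCompl K O) ⊤ ϖ)
    (hO : ∀ c : K, algebraMap K F c ∈ O) {s : F} (hs0 : s ≠ 0)
    (hs : O.valuation s < 1) : IsLaurent (Valued.v : Valuation (Compl O) O.ValueGroup)
      (constCompl K O) (hat O (IntermediateField.adjoin K {s})) (toCompl O s) :=
  hL.isLaurent_closure (hasExpansions_toCompl_adjoin hO hs0 hs)

theorem adjoin_inv_singleton (s : F) :
    IntermediateField.adjoin K {s⁻¹} = IntermediateField.adjoin K {s} := by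
  refine le_antisymm ?_ ?_ <;> rw [IntermediateField.adjoin_simple_le_iff]
  · exact inv_mem (IntermediateField.mem_adjoin_simple_self K s)
  · have := inv_mem (IntermediateField.mem_adjoin_simple_self K s⁻¹)
    rwa [inv_inv] at this

theorem isLaurent_top {ϖ : F} (h : HasExpansions (Valued.v : Valuation (Compl O) O.ValueGroup)
    (constCompl K O) (toCompl O).fieldRange (toCompl O ϖ)) :
    IsLaurent (Valued.v : Valuation (Compl O) O.ValueGroup) (constCompl K O) ⊤ (toCompl O ϖ) := by
  have h1 := h.closure
  rw [topologicalClosure_fieldRange_toCompl] at h1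
  have h2 := h1.isLaurent_closure h
  rwa [topologicalClosure_fieldRange_toCompl] at h2

end Completion

/-! ### Identities between consecutive generators -/

section Relation

variable {R : Type*} [Field R] {q j k : ℕ}

/-- The element `u` attached to two consecutive generators `x` and `x'` of the tower. -/
structure TowerRelation (q j k : ℕ) (x x' u : R) : Prop where
  ne_zero : x ≠ 0
  ne_zero' : x' ≠ 0
  tr_k : Tr q k u + (j : R)⁻¹ = x' / x ^ q ^ k
  tr_j : Tr q j u = -(x' ^ q ^ j / x)

theorem TowerRelation.map {S : Type*} [Field S] (i : R →+* S) {x x' u : R}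
    (h : TowerRelation q j k x x' u) : TowerRelation q j k (i x) (i x') (i u) where
  ne_zero := by simpa using h.ne_zero
  ne_zero' := by simpa using h.ne_zero'
  tr_k := by
    have := congrArg i h.tr_k
    simpa [tr_map] using this
  tr_j := by
    have := congrArg i h.tr_j
    simpa [tr_map] using this

/-- `X` and `Z` are the two traces of `u`, up to constants. -/
structure IsTraceSystem {K : Type*} [Field K] (κ : K →+* R) (q j k : ℕ) (u X Z : R) : Prop where
  left : ∃ α, X = Tr q k u + κ α
  right : ∃ β, Z = Tr q j u + κ β
  eq : X ^ q ^ j - X = Z ^ q ^ k - Z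

theorem IsTraceSystem.symm {K : Type*} [Field K] {κ : K →+* R} {u X Z : R}
    (h : IsTraceSystem κ q j k u X Z) : IsTraceSystem κ q k j u Z X :=
  ⟨h.right, h.left, h.eq.symm⟩

theorem TowerRelation.tr_k_ne_zero {x x' u : R} (h : TowerRelation q j k x x' u) :
    x' / x ^ q ^ k ≠ 0 := div_ne_zero h.ne_zero' (pow_ne_zero _ h.ne_zero)

theorem TowerRelation.tr_j_ne_zero {x x' u : R} (h : TowerRelation q j k x x' u) :
    -(x' ^ q ^ j / x) ≠ 0 := neg_ne_zero.2 (div_ne_zero (pow_ne_zero _ h.ne_zero') h.ne_zero)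

variable {p a : ℕ} [Fact p.Prime] [CharP R p] (hq : q = p ^ a)
include hq

theorem natCast_inv_pow_pow (r : ℕ) : ((j : R)⁻¹) ^ q ^ r = (j : R)⁻¹ := by
  rw [inv_pow, hq, ← pow_mul]
  congr 1
  have := map_natCast (iterateFrobenius R p (a * r)) j
  rwa [iterateFrobenius_def] at this

namespace TowerRelation

variable {x x' u : R} (h : TowerRelation q j k x x' u)
include h

theorem isTraceSystem {K : Type*} [Field K] (κ : K →+* R) :
    IsTraceSystem κ q j k u (x' / x ^ q ^ k) (-(x' ^ q ^ j / x)) where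
  left := ⟨(j : K)⁻¹, by rw [map_inv₀, map_natCast, h.tr_k]⟩
  right := ⟨0, by rw [map_zero, add_zero, h.tr_j]⟩
  eq := by
    rw [← h.tr_k, ← h.tr_j, add_pow_pow hq, natCast_inv_pow_pow hq]
    linear_combination tr_pow_sub_tr hq j k u

set_option linter.unusedSectionVars false

theorem mul_eq_tr_j (hn : q ^ (j + k) ≠ 0) :
    (x' / x ^ q ^ k) ^ q ^ j * -x ^ (q ^ (j + k) - 1) = -(x' ^ q ^ j / x) := by
  have hx := h.ne_zero
  obtain ⟨m, hm⟩ : ∃ m, q ^ (j + k) = m + 1 := ⟨q ^ (j + k) - 1, by omega⟩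
  rw [div_pow, ← pow_mul, ← pow_add, add_comm k j, hm, Nat.add_sub_cancel, pow_succ]
  field_simp

theorem mul_eq_tr_j_pow (hn : q ^ (j + k) ≠ 0) :
    -x' ^ (q ^ (j + k) - 1) * (x' / x ^ q ^ k) = (-(x' ^ q ^ j / x)) ^ q ^ k := by
  have hx := h.ne_zero
  obtain ⟨m, hm⟩ : ∃ m, q ^ (j + k) = m + 1 := ⟨q ^ (j + k) - 1, by omega⟩
  rw [neg_pow_pow hq, div_pow, ← pow_mul, ← pow_add, hm, Nat.add_sub_cancel, pow_succ]
  field_simp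

/-- Tr_j and Tr_k commute, so the contributions of u cancel and only Tr_j(α) = j α = 1 remains. -/
theorem tr_sub_tr (hj : (j : R) ≠ 0) :
    Tr q j (x' / x ^ q ^ k) - Tr q k (-(x' ^ q ^ j / x)) = 1 := by
  have hcomm : Tr q j (Tr q k u) = Tr q k (Tr q j u) := by
    change ∑ r ∈ Finset.range j, Tr q k u ^ q ^ r = ∑ r ∈ Finset.range k, Tr q j u ^ q ^ r
    simp only [tr_pow_pow hq]
    simp only [Tr]
    rw [Finset.sum_comm]
    refine Finset.sum_congr rfl fun r _ ↦ Finset.sum_congr rfl fun s _ ↦ ?_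
    rw [← pow_mul, ← pow_mul, mul_comm]
  have hα : Tr q j (j : R)⁻¹ = 1 := by
    simp only [Tr, natCast_inv_pow_pow hq, Finset.sum_const, Finset.card_range, nsmul_eq_mul]
    exact mul_inv_cancel₀ hj
  rw [← h.tr_k, ← h.tr_j, tr_add hq, hα, hcomm, add_sub_cancel_left]

end TowerRelation

end Relation

/-! ### Behaviour over zeros and poles -/

section Places

variable {L Γ K : Type*} [Field L] [LinearOrderedCommGroupWithZero Γ] [Field K] [IsAlgClosed K]
variable {v : Valuation L Γ} {κ : K →+* L} {A B E : Subfield L} {π ϖ : L}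
variable {p a q j k : ℕ} [Fact p.Prime] [CharP K p] [CharP L p] (hq : q = p ^ a) (ha : 1 ≤ a)
  (hj : 1 ≤ j) (hk : 1 ≤ k)
include hq ha hj hk

set_option linter.unusedSectionVars false

theorem val_trace_le {m : ℕ} (hκ : ∀ c, v (κ c) ≤ 1) {u : L} (hu : v u ≤ 1) (c : K) :
    v (Tr q m u + κ c) ≤ 1 := by
  have hu' : u ∈ v.integer := hu
  have hc' : κ c ∈ v.integer := hκ c
  exact add_mem (sum_mem fun r _ ↦ pow_mem hu' _) hc'

/-- At a zero of `z`, with `X ^ (q ^ j) * z = Z`, either `u` has a pole, and `Z ^ (q ^ k) / X` has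
one, or `X` is a unit and `Z` vanishes. -/
theorem IsTraceSystem.of_zero (hκ : ∀ c, v (κ c) ≤ 1) {u X Z z z' : L}
    (h : IsTraceSystem κ q j k u X Z) (hX0 : X ≠ 0) (hz : X ^ q ^ j * z = Z)
    (hz' : z' * X = Z ^ q ^ k) (hvz : v z < 1) :
    (1 < v u ∧ 1 < v z') ∨ (v u ≤ 1 ∧ v X = 1 ∧ v Z < 1 ∧ v z' < 1) := by
  obtain ⟨α, hX⟩ := h.left
  obtain ⟨β, hZ⟩ := h.right
  have h2j := two_le_pow hq ha hj (p := p)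
  have h2k := two_le_pow hq ha hk (p := p)
  have hq2 : 2 ≤ q := by simpa using two_le_pow hq ha le_rfl (p := p)
  have hvX0 : 0 < v X := (Valuation.pos_iff v).2 hX0
  have hvz' := congrArg v hz'
  rw [map_mul, map_pow] at hvz'
  rcases lt_or_ge 1 (v u) with hu | hu
  · refine Or.inl ⟨hu, ?_⟩
    have hvX := val_tr_add hq ha hk hκ hu α
    have hvZ := val_tr_add hq ha hj hκ hu β
    rw [← hX] at hvX
    rw [← hZ] at hvZ
    by_contra! hcon
    have h1 : v Z ^ q ^ k ≤ v X := by
      rw [← hvz']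
      exact mul_le_of_le_one_left' hcon
    rw [hvX, hvZ, ← pow_mul, pow_le_pow_iff_right₀ hu] at h1
    have hkk : q ^ k = q * q ^ (k - 1) := by rw [← pow_succ']; congr 1; omega
    have h3 : 1 ≤ q ^ (j - 1) := Nat.one_le_pow _ _ (by omega)
    have h4 : 1 ≤ q ^ (k - 1) := Nat.one_le_pow _ _ (by omega)
    have h5 : q ^ k ≤ q ^ (j - 1) * q ^ k := Nat.le_mul_of_pos_left _ h3
    have h6 := Nat.mul_le_mul_right (q ^ (k - 1)) hq2
    omega
  · refine Or.inr ⟨hu, ?_⟩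
    have hvX : v X ≤ 1 := by rw [hX]; exact val_trace_le hq ha hj hk hκ hu α
    have hvZX : v Z < v X := by
      rw [← hz, map_mul, map_pow]
      exact (mul_lt_of_lt_one_right (pow_pos hvX0 _) hvz).trans_le
        (pow_le_of_le_one zero_le hvX (by omega))
    have hvZ : v Z < 1 := hvZX.trans_le hvX
    -- If X vanished, X^(q^j) - X = Z^(q^k) - Z would give X and Z equal values, but Z is strictly
    -- smaller.
    have hX1 : v X = 1 := by
      refine le_antisymm hvX (not_lt.1 fun hlt ↦ ?_)
      have h1 := val_pow_sub_of_lt_one (n := q ^ j) (by omega) hlt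
      rw [h.eq, val_pow_sub_of_lt_one (by omega) hvZ] at h1
      exact hvZX.ne h1
    refine ⟨hX1, hvZ, ?_⟩
    rw [hX1, mul_one] at hvz'
    rw [hvz']
    exact pow_lt_one₀ zero_le hvZ (by omega)

/-- A pole of u would give X^(q^j) a pole at least as large as that of Z, against Z = X^(q^j) z.
With u integral, Z is integral too, so X vanishes. Hence Z cannot vanish, by the normalization
Tr_j(X) - Tr_k(Z) = 1. -/
theorem IsTraceSystem.of_pole (hκ : ∀ c, v (κ c) ≤ 1) {u X Z z z' : L}
    (h : IsTraceSystem κ q j k u X Z) (hX0 : X ≠ 0) (hz : X ^ q ^ j * z = Z)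
    (hz' : z' * X = Z ^ q ^ k) (h1 : Tr q j X - Tr q k Z = 1) (hvz : 1 < v z) :
    v u ≤ 1 ∧ v Z = 1 ∧ v X < 1 ∧ 1 < v z' := by
  have h2j := two_le_pow hq ha hj (p := p)
  have h2k := two_le_pow hq ha hk (p := p)
  obtain ⟨α, hX⟩ := h.left
  obtain ⟨β, hZ⟩ := h.right
  have hu : v u ≤ 1 := by
    by_contra! hu
    have hvX := val_tr_add hq ha hk hκ hu α
    have hvZ := val_tr_add hq ha hj hκ hu β
    rw [← hX] at hvX
    rw [← hZ] at hvZ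
    have h1 : v X ^ q ^ j < v Z := by
      rw [← hz, map_mul, map_pow]
      refine lt_mul_of_one_lt_right (pow_pos ((Valuation.pos_iff v).2 hX0) _) hvz
    rw [hvX, hvZ, ← pow_mul, pow_lt_pow_iff_right₀ hu] at h1
    have hjj : q ^ (j - 1) ≤ q ^ j := Nat.pow_le_pow_right
      (Nat.pos_of_ne_zero (by rintro rfl; rw [zero_pow (by omega)] at h2j; omega)) (by omega)
    have h4 : 1 ≤ q ^ (k - 1) := Nat.one_le_pow _ _
      (Nat.pos_of_ne_zero (by rintro rfl; rw [zero_pow (by omega)] at h2j; omega))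
    have h5 : q ^ j ≤ q ^ (k - 1) * q ^ j := Nat.le_mul_of_pos_left _ h4
    omega
  have hvZ : v Z ≤ 1 := by rw [hZ]; exact val_trace_le hq ha hj hk hκ hu β
  have hvX : v X < 1 := by
    by_contra! hcon
    have h1 : 1 < v Z := by
      rw [← hz, map_mul, map_pow]
      exact one_lt_mul_of_le_of_lt (one_le_pow₀ hcon) hvz
    exact absurd hvZ (not_le.2 h1)
  have hZ1 : v Z = 1 := by
    refine le_antisymm hvZ (not_lt.1 fun hlt ↦ ?_)
    have hmem : ∀ m, ∀ y : L, v y < 1 → v (Tr q m y) < 1 := fun m y hy ↦ by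
      refine Valuation.map_sum_lt v one_ne_zero fun r _ ↦ ?_
      rw [map_pow]
      refine pow_lt_one₀ zero_le hy (pow_ne_zero _ ?_)
      rintro rfl
      rw [zero_pow (by omega)] at h2j
      omega
    have h2 := Valuation.map_sub_lt v (hmem j X hvX) (hmem k Z hlt)
    rw [h1, map_one] at h2
    exact lt_irrefl _ h2
  refine ⟨hu, hZ1, hvX, ?_⟩
  have hvz' := congrArg v hz'
  rw [map_mul, map_pow, hZ1, one_pow] at hvz'
  by_contra! hcon
  have := mul_lt_of_le_one_of_lt hcon hvX
  rw [hvz'] at this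
  exact lt_irrefl _ this

theorem natCast_pow_sub_one_ne_zero {r : ℕ} (hr : 1 ≤ r) : ((q ^ r - 1 : ℕ) : K) ≠ 0 := by
  have h2 := two_le_pow hq ha hr (p := p)
  rw [Nat.cast_sub (by omega), natCast_pow_eq_zero hq ha hr, Nat.cast_one, zero_sub]
  exact neg_ne_zero.2 one_ne_zero

theorem unit_step' (hjk : j.Coprime k) (hL : IsLaurent v κ ⊤ ϖ) {u X Z z z' t : L}
    (h : IsTraceSystem κ q j k u X Z) (hX0 : X ≠ 0) (hz : X ^ q ^ j * z = Z)
    (hz' : z' * X = Z ^ q ^ k) (hvZ : v Z = 1) (hA : IsLaurent v κ A t)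
    (ht : t ^ (q ^ j - 1) * z = 1) :
    (∃ y, IsAdditiveStep v κ A (adjoinElement A u) (q ^ j) y) ∧
      ∃ t' ∈ adjoinElement A u, IsLaurent v κ (adjoinElement A u) t' ∧
        t' ^ (q ^ j - 1) * z' = 1 := by
  obtain ⟨α, hX⟩ := h.left
  obtain ⟨β, hZ⟩ := h.right
  obtain ⟨h1, t', ht'A, ht', h2⟩ := unit_step hq ha hj hk hX hZ h.eq hjk
    (natCast_pow_sub_one_ne_zero hq ha hj hk hj) hL hA (by
      rw [← hz]; linear_combination -X ^ q ^ j * ht) hvZ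
  refine ⟨h1, t', ht'A, ht', mul_right_cancel₀ hX0 ?_⟩
  rw [mul_assoc, hz', h2, one_mul]

/-- Each step returns a uniformizer t' with t'^(q^j - 1) z' = 1, which is the input of the next one;
the steps are then refined to Artin–Schreier steps. -/
theorem unit_chain (hjk : j.Coprime k) (hL : IsLaurent v κ ⊤ ϖ) {u X Z z : ℕ → L} {t : L}
    (hA : IsLaurent v κ A t) (ht : t ^ (q ^ j - 1) * z 0 = 1) : ∀ m : ℕ,
    (∀ s < m, IsTraceSystem κ q j k (u s) (X s) (Z s) ∧ X s ≠ 0 ∧ X s ^ q ^ j * z s = Z s ∧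
      z (s + 1) * X s = Z s ^ q ^ k ∧ v (Z s) = 1) →
    ∃ B, Relation.ReflTransGen (IsASStep v κ p) A B ∧ (∀ s < m, u s ∈ B) ∧
      ∃ t', IsLaurent v κ B t' ∧ t' ^ (q ^ j - 1) * z m = 1 := by
  intro m
  induction m with
  | zero => exact fun _ ↦ ⟨A, Relation.ReflTransGen.refl, by simp, t, hA, ht⟩
  | succ m ih =>
    intro hs
    obtain ⟨B, hAB, hu, t', hB, ht'⟩ := ih fun s hsm ↦ hs s (by omega)
    obtain ⟨h1, h2, h3, h4, h5⟩ := hs m (by omega)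
    obtain ⟨⟨y, S, W, s, hS, hW, hsA, hy, hBu⟩, t'', -, hB', ht''⟩ :=
      unit_step' hq ha hj hk hjk hL h1 h2 h3 h4 h5 hB ht'
    refine ⟨adjoinElement B (u m), hAB.trans ?_, fun s hsm ↦ ?_, t'', hB', ht''⟩
    · rw [hBu]
      exact additive_chain p _ S W s y rfl hS hsA hy
    · rcases Nat.lt_succ_iff_lt_or_eq.1 hsm with h | rfl
      · exact le_adjoinElement B _ (hu s h)
      · exact self_mem_adjoinElement B _

end Places

/-! ### Separability of the tower and existence of the u_s -/

section Global

open Polynomial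

theorem TowerRelation.of_map {R S : Type*} [Field R] [Field S] {q j k : ℕ} (i : R →+* S)
    {x x' u : R} (h : TowerRelation q j k (i x) (i x') (i u)) : TowerRelation q j k x x' u where
  ne_zero := by simpa using h.ne_zero
  ne_zero' := by simpa using h.ne_zero'
  tr_k := i.injective (by have := h.tr_k; simpa [tr_map] using this)
  tr_j := i.injective (by have := h.tr_j; simpa [tr_map] using this)

variable {p a q j k : ℕ} [Fact p.Prime] (hq : q = p ^ a) (ha : 1 ≤ a) (hj : 1 ≤ j) (hk : 1 ≤ k)
include hq ha hj hk

set_option linter.unusedSectionVars false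

theorem derivative_tr {R : Type*} [CommRing R] [CharP R p] {m : ℕ} (hm : 1 ≤ m) :
    derivative (Tr q m X : R[X]) = 1 := by
  obtain ⟨m, rfl⟩ : ∃ m', m = m' + 1 := ⟨m - 1, by omega⟩
  rw [Tr, Finset.sum_range_succ', derivative_add, derivative_sum, Finset.sum_eq_zero]
  · simp
  · intro r _
    rw [derivative_X_pow, natCast_pow_eq_zero hq ha (by omega)]
    simp

section Separable

variable {K F₁ F' : Type*} [Field K] [Field F₁] [Field F'] [Algebra K F₁] [Algebra K F']
  [Algebra F₁ F'] [IsScalarTower K F₁ F'] [CharP F' p]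

/-- By Z = X^(q^j) z, u is a root of Tr_j(T) - z (Tr_k(T) + α)^(q^j), whose derivative is 1. -/
theorem TowerRelation.isSeparable {S : IntermediateField F₁ F'} {x x' u : F'}
    (h : TowerRelation q j k x x' u) (hx : x ∈ S) : IsSeparable S u := by
  have hcharS : CharP S p := (algebraMap S F').charP (algebraMap S F').injective p
  have hn : q ^ (j + k) ≠ 0 := by
    have := two_le_pow hq ha (show 1 ≤ j + k by omega) (p := p)
    omega
  let z : S := ⟨-x ^ (q ^ (j + k) - 1), neg_mem (pow_mem hx _)⟩
  let f : S[X] := Tr q j X - C z * (Tr q k X + C (j : S)⁻¹) ^ q ^ j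
  have hf : derivative f = 1 := by
    simp only [f]
    rw [derivative_sub, derivative_C_mul, derivative_pow, derivative_tr hq ha hj hk hj,
      natCast_pow_eq_zero hq ha hj]
    simp
  have hroot : aeval u f = 0 := by
    have h1 : ∀ m, aeval u (Tr q m X : S[X]) = Tr q m u := fun m ↦ by
      have := tr_map (aeval u : S[X] →ₐ[S] F').toRingHom q m X
      simpa using this
    have h2 := h.mul_eq_tr_j hq hn
    simp only [f]
    rw [map_sub, map_mul, map_pow, map_add, h1, h1, aeval_C, aeval_C, map_inv₀, map_natCast,
      h.tr_k, h.tr_j, ← h2]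
    change _ - (-x ^ (q ^ (j + k) - 1)) * _ = 0
    ring
  have hsep : f.Separable := by
    rw [separable_def, hf]
    exact isCoprime_one_right
  exact hsep.of_dvd (minpoly.dvd S u hroot)

theorem tower_finite_separable {y u : ℕ → F'} {N : ℕ} (hy1 : ∃ ξ, algebraMap F₁ F' ξ = y 1)
    (hrel : ∀ s, 1 ≤ s → s < N → TowerRelation q j k (y s) (y (s + 1)) (u s))
    (hgen : IntermediateField.adjoin K (y '' Set.Icc 1 N) = ⊤) :
    FiniteDimensional F₁ F' ∧ Algebra.IsSeparable F₁ F' := by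
  have hmem : ∀ s, 1 ≤ s → s ≤ N → y s ∈ separableClosure F₁ F' := by
    intro s hs
    induction s, hs using Nat.le_induction with
    | base =>
      intro _
      obtain ⟨ξ, hξ⟩ := hy1
      rw [← hξ]
      exact (separableClosure F₁ F').algebraMap_mem ξ
    | succ s hs ih =>
      intro hsN
      have hys := ih (by omega)
      have hr := hrel s hs hsN
      have hu : u s ∈ separableClosure F₁ F' := mem_separableClosure_iff.2
        (IsSeparable.of_algebra_isSeparable_of_isSeparable F₁
          (hr.isSeparable hq ha hj hk hys))
      have h1 : y (s + 1) = (Tr q k (u s) + (j : F')⁻¹) * y s ^ q ^ k := by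
        rw [hr.tr_k, div_mul_cancel₀ _ (pow_ne_zero _ hr.ne_zero)]
      rw [h1]
      exact mul_mem (add_mem (sum_mem fun r _ ↦ pow_mem hu _) (inv_mem (natCast_mem _ _)))
        (pow_mem hys _)
  have htop : separableClosure F₁ F' = ⊤ := by
    have h1 : IntermediateField.adjoin K (y '' Set.Icc 1 N) ≤
        (separableClosure F₁ F').restrictScalars K := by
      rw [IntermediateField.adjoin_le_iff]
      rintro _ ⟨s, hs, rfl⟩
      exact hmem s hs.1 hs.2
    rw [hgen] at h1
    exact eq_top_iff.2 fun x _ ↦ h1 (IntermediateField.mem_top (x := x))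
  have hsep : Algebra.IsSeparable F₁ F' := (separableClosure.eq_top_iff F₁ F').1 htop
  refine ⟨?_, hsep⟩
  have hgen' : IntermediateField.adjoin F₁ (y '' Set.Icc 1 N) = ⊤ := by
    have h1 : IntermediateField.adjoin K (y '' Set.Icc 1 N) ≤
        (IntermediateField.adjoin F₁ (y '' Set.Icc 1 N)).restrictScalars K := by
      rw [IntermediateField.adjoin_le_iff]
      exact IntermediateField.subset_adjoin _ _
    rw [hgen] at h1
    exact eq_top_iff.2 fun x _ ↦ h1 (IntermediateField.mem_top (x := x))
  have hfin : Finite (y '' Set.Icc 1 N : Set F') := (Set.finite_Icc 1 N).image y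
  have := IntermediateField.finiteDimensional_adjoin (K := F₁) (S := y '' Set.Icc 1 N)
    fun x _ ↦ Algebra.IsIntegral.isIntegral (R := F₁) x
  rw [hgen'] at this
  exact Module.Finite.equiv (IntermediateField.topEquiv (F := F₁) (E := F')).toLinearEquiv

end Separable

section Elements

variable {K Ω : Type*} [Field K] [Field Ω] [Algebra K Ω] [CharP Ω p] {x : ℕ → Ω}

theorem GeneratesTower.ne_zero (hx : GeneratesTower K q j k x) {s : ℕ} (hs : 1 ≤ s) :
    x s ≠ 0 := by
  intro h0
  have h := hx.2 s hs
  have hq0 : q ≠ 0 := by rw [hq]; exact pow_ne_zero _ (Fact.out : p.Prime).ne_zero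
  have h00 : ∀ m, Tr q m (0 : Ω) = 0 := fun m ↦
    Finset.sum_eq_zero fun r _ ↦ zero_pow (pow_ne_zero _ hq0)
  rw [h0, zero_pow (pow_ne_zero _ hq0), div_zero, div_zero, h00, h00, add_zero] at h
  exact zero_ne_one h

theorem IsUElement.towerRelation (hx : GeneratesTower K q j k x) {s : ℕ} (hs : 1 ≤ s) {u : Ω}
    (hu : IsUElement K q j k (x s) (x (s + 1)) u) : TowerRelation q j k (x s) (x (s + 1)) u :=
  ⟨hx.ne_zero hq ha hj hk hs, hx.ne_zero hq ha hj hk (by omega), hu.2.1, hu.2.2⟩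

/-- With Tr_j(α) = 1, the recursive equation of the tower is precisely the compatibility condition
for prescribing both traces of u. -/
theorem existsUnique_isUElement (hjk : j.Coprime k) (hpj : ¬ p ∣ j)
    (hx : GeneratesTower K q j k x) {s : ℕ} (hs : 1 ≤ s) :
    ∃! u, IsUElement K q j k (x s) (x (s + 1)) u := by
  have hj0 : (j : Ω) ≠ 0 := by rwa [Ne, CharP.cast_eq_zero_iff Ω p]
  set S := IntermediateField.adjoin K {x s, x (s + 1)} with hS
  have h1 : x s ∈ S := IntermediateField.subset_adjoin _ _ (by simp)
  have h2 : x (s + 1) ∈ S := IntermediateField.subset_adjoin _ _ (by simp)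
  have hα : Tr q j (j : Ω)⁻¹ = 1 := by
    simp only [Tr, natCast_inv_pow_pow hq, Finset.sum_const, Finset.card_range, nsmul_eq_mul]
    exact mul_inv_cancel₀ hj0
  have hneg : ∀ m (b : Ω), Tr q m (-b) = -Tr q m b := fun m b ↦ by
    simp only [Tr, neg_pow_pow hq, Finset.sum_neg_distrib]
  obtain ⟨u, hu, hk', hj'⟩ := exists_tr_eq hq S (fun x hx r ↦ pow_mem hx _) _ j k rfl hjk
    (x (s + 1) / x s ^ q ^ k - (j : Ω)⁻¹)
    (sub_mem (div_mem h2 (pow_mem h1 _)) (inv_mem (natCast_mem _ _)))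
    (-(x (s + 1) ^ q ^ j / x s)) (neg_mem (div_mem (pow_mem h2 _) h1)) (by
      rw [tr_sub hq, hα, hneg]
      linear_combination hx.2 s hs)
  refine ⟨u, ⟨hu, by rw [hk']; ring, hj'⟩, fun w hw ↦ sub_eq_zero.1 ?_⟩
  refine eq_zero_of_tr_eq_zero hq hjk ?_ ?_
  · rw [tr_sub hq, hw.2.2, hj', sub_self]
  · rw [tr_sub hq, hk', eq_sub_of_add_eq hw.2.1, sub_self]

end Elements

end Global

/-! ### The symmetric form of a step of the tower -/

section Steps

variable {R : Type*} [Field R] {q j k : ℕ}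

/-- The relations between the traces of `u` and the elements `z`, `z'` at two consecutive
generators. -/
structure IsTowerStep {K : Type*} [Field K] (κ : K →+* R) (q j k : ℕ) (u X Z z z' : R) : Prop
    extends IsTraceSystem κ q j k u X Z where
  left_ne_zero : X ≠ 0
  right_ne_zero : Z ≠ 0
  ne_zero : z ≠ 0
  ne_zero' : z' ≠ 0
  mul_eq : X ^ q ^ j * z = Z
  mul_eq' : z' * X = Z ^ q ^ k

/-- This duality reverses the direction of the tower. It yields the steps towards x_1 from those
away from it. -/
theorem IsTowerStep.symm {K : Type*} [Field K] {κ : K →+* R} {u X Z z z' : R}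
    (h : IsTowerStep κ q j k u X Z z z') : IsTowerStep κ q k j u Z X z'⁻¹ z⁻¹ where
  toIsTraceSystem := h.toIsTraceSystem.symm
  left_ne_zero := h.right_ne_zero
  right_ne_zero := h.left_ne_zero
  ne_zero := inv_ne_zero h.ne_zero'
  ne_zero' := inv_ne_zero h.ne_zero
  mul_eq := by
    have := h.ne_zero'
    rw [← h.mul_eq']
    field_simp
  mul_eq' := by
    have := h.ne_zero
    rw [← h.mul_eq]
    field_simp

theorem TowerRelation.isTowerStep {K : Type*} [Field K] (κ : K →+* R) {p a : ℕ} [Fact p.Prime]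
    [CharP R p] (hq : q = p ^ a) {x x' u : R} (h : TowerRelation q j k x x' u) :
    IsTowerStep κ q j k u (x' / x ^ q ^ k) (-(x' ^ q ^ j / x)) (-x ^ (q ^ (j + k) - 1))
      (-x' ^ (q ^ (j + k) - 1)) where
  toIsTraceSystem := h.isTraceSystem hq κ
  left_ne_zero := h.tr_k_ne_zero
  right_ne_zero := h.tr_j_ne_zero
  ne_zero := neg_ne_zero.2 (pow_ne_zero _ h.ne_zero)
  ne_zero' := neg_ne_zero.2 (pow_ne_zero _ h.ne_zero')
  mul_eq := h.mul_eq_tr_j hq (pow_ne_zero _ (by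
    rw [hq]; exact pow_ne_zero _ (Fact.out : p.Prime).ne_zero))
  mul_eq' := h.mul_eq_tr_j_pow hq (pow_ne_zero _ (by
    rw [hq]; exact pow_ne_zero _ (Fact.out : p.Prime).ne_zero))

end Steps

/-! ### The field of u at a pole and its tame subfield -/

section PoleChain

open IntermediateField

variable {L Γ K : Type*} [Field L] [LinearOrderedCommGroupWithZero Γ] [Field K] [IsAlgClosed K]
variable {v : Valuation L Γ} {κ : K →+* L} {A B E H : Subfield L} {π ϖ : L}
variable {p a q j k : ℕ} [Fact p.Prime] [CharP K p] [CharP L p] (hq : q = p ^ a) (ha : 1 ≤ a)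
  (hj : 1 ≤ j) (hk : 1 ≤ k)
include hq ha hj hk

set_option linter.unusedSectionVars false

variable {u X Z z z' : L}

/-- In terms of 1/u, the inverse of z' = Z^(q^k)/X has order q^(j-1) q^k - q^(k-1) = (q^j - 1)
q^(k-1), a multiple of q^j - 1, which is prime to p. -/
theorem IsTowerStep.exists_pow_mul_eq_one (h : IsTowerStep κ q j k u X Z z z')
    (hE : IsLaurent v κ E u⁻¹) : ∃ t ∈ E, t ^ (q ^ j - 1) * z' = 1 := by
  obtain ⟨α, hX⟩ := h.left
  obtain ⟨β, hZ⟩ := h.right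
  have h2j := two_le_pow hq ha hj (p := p)
  have hu := hE.one_lt_val
  have huE : u ∈ E := by simpa using inv_mem hE.mem
  have hvX := val_tr_add hq ha hk hE.val_const_le hu α
  have hvZ := val_tr_add hq ha hj hE.val_const_le hu β
  rw [← hX] at hvX
  rw [← hZ] at hvZ
  have hXE : X ∈ E := by rw [hX]; exact add_mem (sum_mem fun r _ ↦ pow_mem huE _) (hE.const α)
  have hZE : Z ∈ E := by rw [hZ]; exact add_mem (sum_mem fun r _ ↦ pow_mem huE _) (hE.const β)
  have hz' : z' = Z ^ q ^ k / X := by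
    rw [eq_div_iff h.left_ne_zero, h.mul_eq']
  have hU : v u ≠ 0 := (zero_lt_one.trans hu).ne'
  have hkk : q ^ k = q * q ^ (k - 1) := by rw [← pow_succ']; congr 1; omega
  have hjj : q ^ j = q * q ^ (j - 1) := by rw [← pow_succ']; congr 1; omega
  have hexp : q ^ (j - 1) * q ^ k = (q ^ j - 1) * q ^ (k - 1) + q ^ (k - 1) := by
    rw [← Nat.succ_mul, Nat.succ_eq_add_one, Nat.sub_add_cancel (by omega), hkk, hjj]
    ring
  have hv : v z'⁻¹ = v u⁻¹ ^ (((q ^ j - 1 : ℕ) : ℤ) * ((q ^ (k - 1) : ℕ) : ℤ)) := by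
    rw [hz', map_inv₀, map_div₀, map_pow, hvX, hvZ, ← pow_mul, hexp, pow_add,
      mul_div_cancel_right₀ _ (pow_ne_zero _ hU), map_inv₀, inv_zpow, ← Nat.cast_mul,
      zpow_natCast]
  obtain ⟨t, ht, htz⟩ := hE.exists_pow_eq (natCast_pow_sub_one_ne_zero hq ha hj hk hj)
    (inv_mem (by rw [hz']; exact div_mem (pow_mem hZE _) hXE)) hv
  exact ⟨t, ht, by rw [htz, inv_mul_cancel₀ h.ne_zero']⟩

theorem IsTowerStep.exists_isAdditiveStep (h : IsTowerStep κ q j k u X Z z z')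
    (hE : IsLaurent v κ E u⁻¹) (hH : IsLaurent v κ H z'⁻¹) (hHE : H ≤ E) {t : L} (htE : t ∈ E)
    (ht : t ^ (q ^ j - 1) * z' = 1) : IsLaurent v κ (adjoinElement H t) t ∧
      ∃ y, IsAdditiveStep v κ (adjoinElement H t) E (q ^ (k - 1)) y := by
  obtain ⟨α, hX⟩ := h.left
  obtain ⟨β, hZ⟩ := h.right
  have hG := (hH.adjoin_root (natCast_pow_sub_one_ne_zero hq ha hj hk hj)
    (eq_inv_of_mul_eq_one_left ht)).2.1
  refine ⟨hG, pole_step hq ha hj hk hX hZ h.eq hE htE ?_ hG (adjoinElement_le hHE htE)⟩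
  rw [← h.mul_eq', ← mul_assoc, ht, one_mul]

end PoleChain

/-! ### Completions of the subfields K(s) -/

section Hat

variable {K F : Type*} [Field K] [Field F] [Algebra K F] {O : ValuationSubring F} {ϖ : Compl O}

theorem hat_mono {A B : IntermediateField K F} (h : A ≤ B) : hat O A ≤ hat O B := by
  refine Subfield.topologicalClosure_minimal _ ?_ (Subfield.isClosed_topologicalClosure _)
  rintro _ ⟨x, hx, rfl⟩
  exact Subfield.le_topologicalClosure _ ⟨x, h hx, rfl⟩

theorem toCompl_mem_hat {A : IntermediateField K F} {x : F} (h : x ∈ A) : toCompl O x ∈ hat O A :=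
  Subfield.le_topologicalClosure _ ⟨x, h, rfl⟩

theorem isLaurent_hat_of_pole (hL : HasExpansions
      (Valued.v : Valuation (Compl O) O.ValueGroup) (constCompl K O) ⊤ ϖ)
    (hO : ∀ c : K, algebraMap K F c ∈ O) {s : F}
    (hs : 1 < (Valued.v (toCompl O s) : O.ValueGroup)) :
    IsLaurent (Valued.v : Valuation (Compl O) O.ValueGroup) (constCompl K O)
      (hat O (IntermediateField.adjoin K {s})) (toCompl O s)⁻¹ := by
  rw [val_toCompl] at hs
  have hs0 : s ≠ 0 := by
    rintro rfl
    rw [map_zero] at hs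
    exact absurd hs (not_lt.2 zero_le)
  rw [← adjoin_inv_singleton, ← map_inv₀]
  refine isLaurent_hat_adjoin hL hO (inv_ne_zero hs0) ?_
  rw [map_inv₀]
  exact inv_lt_one_of_one_lt₀ hs

variable {p a q j k : ℕ} [Fact p.Prime] [CharP F p] (hq : q = p ^ a)
include hq

theorem TowerRelation.mem_adjoin {x x' u : F} (h : TowerRelation q j k x x' u) :
    -x ^ (q ^ (j + k) - 1) ∈ IntermediateField.adjoin K {u} ∧
      -x' ^ (q ^ (j + k) - 1) ∈ IntermediateField.adjoin K {u} := by
  have hu := IntermediateField.mem_adjoin_simple_self K u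
  have hs := h.isTowerStep (RingHom.id F) hq
  have hX : x' / x ^ q ^ k ∈ IntermediateField.adjoin K {u} := by
    rw [← h.tr_k]
    exact add_mem (sum_mem fun r _ ↦ pow_mem hu _) (inv_mem (natCast_mem _ _))
  have hZ : -(x' ^ q ^ j / x) ∈ IntermediateField.adjoin K {u} := by
    rw [← h.tr_j]
    exact sum_mem fun r _ ↦ pow_mem hu _
  constructor
  · rw [← mul_div_cancel_left₀ (-x ^ (q ^ (j + k) - 1)) (pow_ne_zero (q ^ j) hs.left_ne_zero),
      hs.mul_eq]
    exact div_mem hZ (pow_mem hX _)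
  · rw [← mul_div_cancel_right₀ (-x' ^ (q ^ (j + k) - 1)) hs.left_ne_zero, hs.mul_eq']
    exact div_mem (pow_mem hZ _) hX

end Hat

/-! ### Uniformizer, derivation and invariants at a place -/

section Setup

/-- Derivations of a field, with respect to its canonical structure of `ℤ`-algebra. -/
abbrev FieldDerivation (L : Type*) [Field L] : Type _ := Derivation ℤ L L

variable {K F₁ F' : Type*} [Field K] [IsAlgClosed K] [Field F₁] [Field F']
  [Algebra K F₁] [Algebra K F'] [Algebra F₁ F'] [IsScalarTower K F₁ F']
  [FiniteDimensional F₁ F'] [Algebra.IsSeparable F₁ F'] {O : ValuationSubring F'}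

/-- The completion is Laurent in a local generator, which provides D. That D does not vanish at ξ is
where separability enters: the formula for the different expresses D ξ by D β. -/
theorem exists_place_data (p : ℕ) [Fact p.Prime] [CharP K p] {ξ : F₁} (hξ : IntermediateField.adjoin K {ξ} = ⊤)
    (hO : ∀ c : K, algebraMap K F' c ∈ O) (hξ0 : ξ ≠ 0)
    (hvξ : O.valuation (algebraMap F₁ F' ξ) < 1) :
    ∃ (β : F') (D : FieldDerivation (Compl O)),
      HasExpansions (Valued.v : Valuation (Compl O) O.ValueGroup) (constCompl K O)
        (toCompl O).fieldRange (toCompl O β) ∧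
      IsLaurent (Valued.v : Valuation (Compl O) O.ValueGroup) (constCompl K O) ⊤ (toCompl O β) ∧
      (∀ c, D (constCompl K O c) = 0) ∧
      (∀ b, (Valued.v (D b) : O.ValueGroup) ≤ Valued.v b * (Valued.v (toCompl O β))⁻¹) ∧
      D (toCompl O β) ≠ 0 ∧ D (toCompl O (algebraMap F₁ F' ξ)) ≠ 0 ∧
      ∃ e d : ℕ, HasRamificationIndex F₁ O e ∧ HasDifferentExponent F₁ O d ∧
        (Valued.v (toCompl O (algebraMap F₁ F' ξ)) : O.ValueGroup) =
          Valued.v (toCompl O β) ^ e ∧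
        (Valued.v (toCompl O β) : O.ValueGroup) ^ d * Valued.v (D (toCompl O β)) =
          Valued.v (D (toCompl O (algebraMap F₁ F' ξ))) := by
  set v : Valuation (Compl O) O.ValueGroup := Valued.v with hv
  set i := toCompl O with hi
  have hO' : ∀ x, x ∈ O ↔ v (i x) ≤ 1 := fun x ↦ by
    rw [hv, hi, val_toCompl, O.valuation_le_one_iff]
  have hκ : ∀ c : K, i (algebraMap F₁ F' (algebraMap K F₁ c)) = constCompl K O c := fun c ↦ by
    rw [← IsScalarTower.algebraMap_apply]
    rfl
  have hF : HasExpansions v (constCompl K O) (i.comp (algebraMap F₁ F')).fieldRange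
      (i (algebraMap F₁ F' ξ)) := by
    have := hasExpansions_adjoin (i := i.comp (algebraMap F₁ F')) hκ (val_constCompl hO) hξ0
      (v := v) (by rw [RingHom.comp_apply, hv, val_toCompl]; exact hvξ)
    rw [hξ] at this
    have h1 : (⊤ : IntermediateField K F₁).toSubfield.map (i.comp (algebraMap F₁ F')) =
        (i.comp (algebraMap F₁ F')).fieldRange := by
      ext x
      simp [Subfield.mem_map]
    rw [h1] at this
    exact this
  obtain ⟨α, hα⟩ := exists_isLocalGenerator (comp_comap_iff (F := F₁) hO') hF
  have hL := isLaurent_top (hα.hasExpansions (comp_comap_iff (F := F₁) hO') hF)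
  have hp : 0 < p := (Fact.out : p.Prime).pos
  obtain ⟨D, hDκ, hDα, hD⟩ := exists_derivation hL.toHasExpansions hL p hp
  obtain ⟨β, hβ, d, hd, hdv⟩ := exists_hasDifferentExponent hO' hF D hDκ hL.toHasExpansions hD
  have hLβ := isLaurent_top hβ
  -- D is normalized at α, whereas the different is expressed at β; both are uniformizers.
  have hαβ : v (i α) = v (i β) := hL.val_unique hLβ.toHasExpansions
  have hDβ : v (D (i β)) = 1 := by
    have h1 := val_deriv_eq D hDκ hL.toHasExpansions hD hL.toHasExpansions (Subfield.mem_top (i β))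
      (m := 1) (by simp) (by rw [zpow_one]; exact hαβ.symm)
    rw [hDα, map_one, mul_one, ← hαβ] at h1
    exact (mul_eq_right₀ hL.pos.ne').1 h1
  have hDβ0 : D (i β) ≠ 0 := by
    rw [← Valuation.ne_zero_iff v, hDβ]
    exact one_ne_zero
  obtain ⟨m, hm⟩ := hβ.exists_val (a := i (algebraMap F₁ F' ξ)) ⟨_, rfl⟩ hF.ne_zero
  have hm0 : 0 ≤ m := by
    have := hF.lt_one.le
    rw [hm, ← zpow_zero (v (i β)), hβ.zpow_le_iff] at this
    exact this
  obtain ⟨e, rfl⟩ := Int.eq_ofNat_of_zero_le hm0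
  rw [zpow_natCast] at hm
  refine ⟨β, D, hβ, hLβ, hDκ, fun b ↦ ?_, hDβ0, ?_, e, d,
    hasRamificationIndex_of_val hO' hF hβ hm, hd, hm, hdv⟩
  · rw [← hαβ]; exact hD b
  · rw [← Valuation.ne_zero_iff v, ← hdv, hDβ, mul_one]
    exact pow_ne_zero _ hβ.pos.ne'

end Setup

/-! ### The completed tower beyond a pole -/

section CompletedTower

open IntermediateField

theorem deriv_neg_pow_ne_zero {K L : Type*} [Field K] [Field L] (κ : K →+* L)
    (D : Derivation ℤ L L) {x : L} {n : ℕ} (hn : (n : K) ≠ 0) (hx : x ≠ 0) (hD : D x ≠ 0) :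
    D (-x ^ n) ≠ 0 := by
  rw [map_neg, D.leibniz_pow, nsmul_eq_mul, smul_eq_mul, neg_ne_zero]
  have h0 : (n : L) ≠ 0 := by
    rw [← map_natCast κ]
    exact (map_ne_zero κ).2 hn
  exact mul_ne_zero h0 (mul_ne_zero (pow_ne_zero _ hx) hD)

variable {L Γ K : Type*} [Field L] [LinearOrderedCommGroupWithZero Γ] [Field K] [IsAlgClosed K]
variable {v : Valuation L Γ} {κ : K →+* L} {A B E H : Subfield L} {π ϖ : L}
  {O : ValuationSubring L}
variable {p a q j k : ℕ} [Fact p.Prime] [CharP K p] [CharP L p] (hq : q = p ^ a) (ha : 1 ≤ a)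
  (hj : 1 ≤ j) (hk : 1 ≤ k)
  (hO : ∀ x, x ∈ O ↔ v x ≤ 1)
  (D : Derivation ℤ L L) (hDκ : ∀ c, D (κ c) = 0) (hL : IsLaurent v κ ⊤ ϖ)
  (hD : ∀ a, v (D a) ≤ v a * (v ϖ)⁻¹)

set_option linter.unusedSectionVars false

-- D kills q-powers, so D X = D Z = D u. If D z' = 0, differentiating z' X = Z^(q^k) gives D u = 0,
-- and then X^(q^j) z = Z gives D z = 0.
include hq ha hj hk in
theorem IsTowerStep.deriv_ne_zero {u X Z z z' : L} (h : IsTowerStep κ q j k u X Z z z')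
    (hDκ : ∀ c, D (κ c) = 0) (hDz : D z ≠ 0) : D z' ≠ 0 := by
  obtain ⟨α, hX⟩ := h.left
  obtain ⟨β, hZ⟩ := h.right
  have hpow : ∀ r, 1 ≤ r → ∀ b : L, D (b ^ q ^ r) = 0 := fun r hr b ↦ by
    rw [D.leibniz_pow, nsmul_eq_mul, natCast_pow_eq_zero hq ha hr, zero_mul]
  have htr : ∀ m, 1 ≤ m → D (Tr q m u) = D u := fun m hm ↦ by
    obtain ⟨m, rfl⟩ : ∃ m', m = m' + 1 := ⟨m - 1, by omega⟩
    rw [Tr, Finset.sum_range_succ', map_add, map_sum, Finset.sum_eq_zero]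
    · simp
    · exact fun r _ ↦ hpow _ (by omega) u
  have hDX : D X = D u := by rw [hX, map_add, htr k hk, hDκ, add_zero]
  have hDZ : D Z = D u := by rw [hZ, map_add, htr j hj, hDκ, add_zero]
  have h1 := congrArg D h.mul_eq
  have h2 := congrArg D h.mul_eq'
  rw [D.leibniz, hpow j hj, smul_zero, add_zero, smul_eq_mul, hDZ] at h1
  rw [D.leibniz, hpow k hk, smul_eq_mul, smul_eq_mul, hDX] at h2
  intro h0
  rw [h0, mul_zero, add_zero] at h2
  have h3 : D u = 0 := (mul_eq_zero.1 h2).resolve_left h.ne_zero'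
  rw [h3] at h1
  exact hDz ((mul_eq_zero.1 h1).resolve_left (pow_ne_zero _ h.left_ne_zero))

include hq ha hj hk hO hDκ hL hD

/-- The induction along the fields G_s carries a uniformizer t' with t'^(q^j - 1) z_(s+1) = 1 and D
t' ≠ 0. The family C stands for the completions of the fields E_s, of which only the inclusions
matter. -/
theorem completed_tower (hjk : j.Coprime k) {u X Z z : ℕ → L} {N : ℕ} (hN : 1 < N)
    (hstep : ∀ s, 1 ≤ s → s < N →
      IsTowerStep κ q j k (u s) (X s) (Z s) (z s) (z (s + 1)))
    (hvZ : ∀ s, 2 ≤ s → s < N → v (Z s) = 1) (hE : IsLaurent v κ E (u 1)⁻¹)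
    (hH : IsLaurent v κ H (z 2)⁻¹) (hHE : H ≤ E) (hDz : D (z 2) ≠ 0) :
    (∃ t ∈ E, t ^ (q ^ j - 1) = (z 2)⁻¹) ∧
      ∀ t ∈ E, t ^ (q ^ j - 1) = (z 2)⁻¹ →
        IsFiniteCyclic H (adjoinElement H t) ∧
        HasInvariants O H (adjoinElement H t) (q ^ j - 1) (q ^ j - 1) (q ^ j - 2) ∧
        IsFiniteGalois (adjoinElement H t) E ∧
        HasInvariants O (adjoinElement H t) E (q ^ (k - 1)) (q ^ (k - 1))
          (2 * (q ^ (k - 1) - 1)) ∧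
        IsWeaklyRamified p O (adjoinElement H t) E ∧
        (∀ C : ℕ → Subfield L, E ≤ C 1 → (∀ s, 1 ≤ s → s + 1 < N → C s ≤ C (s + 1)) →
          (∀ s, 1 ≤ s → s < N → u s ∈ C s) → ∀ s, 1 ≤ s → s < N → gField H t u s ≤ C s) ∧
        (∀ s, 1 ≤ s → s + 1 < N →
          IsFiniteGalois (gField H t u s) (gField H t u (s + 1)) ∧
          HasInvariants O (gField H t u s) (gField H t u (s + 1)) (q ^ j) (q ^ j)
            (2 * (q ^ j - 1)) ∧
          IsWeaklyRamified p O (gField H t u s) (gField H t u (s + 1))) := by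
  have h1 := hstep 1 le_rfl hN
  have hz0 : z 2 ≠ 0 := h1.ne_zero'
  have hDz' : D (z 2)⁻¹ ≠ 0 := by
    rw [D.leibniz_inv, smul_eq_mul]
    exact mul_ne_zero (neg_ne_zero.2 (pow_ne_zero _ (inv_ne_zero hz0))) hDz
  constructor
  · obtain ⟨t, ht, htz⟩ := h1.exists_pow_mul_eq_one hq ha hj hk hE
    exact ⟨t, ht, eq_inv_of_mul_eq_one_left htz⟩
  intro t htE ht
  have htz : t ^ (q ^ j - 1) * z 2 = 1 := by rw [ht, inv_mul_cancel₀ hz0]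
  obtain ⟨-, y, hy⟩ := h1.exists_isAdditiveStep hq ha hj hk hE hH hHE htE htz
  obtain ⟨hG, hcyc, hinv, hDt⟩ := kummer_step hO D hDκ hL.toHasExpansions hD
    (natCast_pow_sub_one_ne_zero hq ha hj hk hj) hH ht hDz'
  have hpow : ∀ r, q ^ r = p ^ (a * r) := fun r ↦ by rw [hq, pow_mul]
  obtain ⟨-, hgal, hinv', hweak, -⟩ := additive_step hO D hDκ hL.toHasExpansions hD
    (hpow (k - 1)) hG hDt hy
  have key : ∀ s, 1 ≤ s → s + 1 < N → ∀ t', IsLaurent v κ (gField H t u s) t' →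
      t' ^ (q ^ j - 1) * z (s + 1) = 1 → D t' ≠ 0 →
      (∃ t'', IsLaurent v κ (gField H t u (s + 1)) t'' ∧
        t'' ^ (q ^ j - 1) * z (s + 1 + 1) = 1 ∧ D t'' ≠ 0) ∧
      IsFiniteGalois (gField H t u s) (gField H t u (s + 1)) ∧
      HasInvariants O (gField H t u s) (gField H t u (s + 1)) (q ^ j) (q ^ j)
        (2 * (q ^ j - 1)) ∧
      IsWeaklyRamified p O (gField H t u s) (gField H t u (s + 1)) := by
    intro s hs hsN t' hG' ht' hDt'
    have hst := hstep (s + 1) (by omega) hsN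
    obtain ⟨⟨y', hy'⟩, t'', -, hG'', ht''⟩ := unit_step' hq ha hj hk hjk hL hst.toIsTraceSystem
      hst.left_ne_zero hst.mul_eq hst.mul_eq' (hvZ (s + 1) (by omega) hsN) hG' ht'
    have heq : gField H t u (s + 1) = adjoinElement (gField H t u s) (u (s + 1)) := by
      obtain ⟨s, rfl⟩ : ∃ s', s = s' + 1 := ⟨s - 1, by omega⟩
      rfl
    rw [heq]
    obtain ⟨hB, h1, h2, h3, h4⟩ := additive_step hO D hDκ hL.toHasExpansions hD (hpow j) hG' hDt' hy'
    refine ⟨⟨t'', hG'', ht'', fun h0 ↦ h4 ?_⟩, h1, h2, h3⟩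
    have h5 := val_deriv_eq D hDκ hL.toHasExpansions hD hG''.toHasExpansions hB.mem (m := 1)
      (by simp) (by rw [zpow_one]; exact hB.val_unique hG''.toHasExpansions)
    rw [h0, map_zero, mul_zero] at h5
    exact (Valuation.zero_iff v).1 ((mul_eq_zero.1 h5).resolve_right hG''.pos.ne')
  have hchain : ∀ s, 1 ≤ s → s < N → ∃ t', IsLaurent v κ (gField H t u s) t' ∧
      t' ^ (q ^ j - 1) * z (s + 1) = 1 ∧ D t' ≠ 0 := by
    intro s hs
    induction s, hs using Nat.le_induction with
    | base => exact fun _ ↦ ⟨t, hG, htz, hDt⟩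
    | succ s hs ih =>
      intro hsN
      obtain ⟨t', h1, h2, h3⟩ := ih (by omega)
      exact (key s hs hsN t' h1 h2 h3).1
  refine ⟨hcyc, hinv, hgal, hinv', hweak, ?_, ?_⟩
  · intro C hEC hCC huC s hs
    induction s, hs using Nat.le_induction with
    | base => exact fun _ ↦ (adjoinElement_le hHE htE).trans hEC
    | succ s hs ih =>
      intro hsN
      obtain ⟨s, rfl⟩ : ∃ s', s = s' + 1 := ⟨s - 1, by omega⟩
      exact adjoinElement_le ((ih (by omega)).trans (hCC _ hs hsN)) (huC _ (by omega) hsN)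
  · intro s hs hsN
    obtain ⟨t', h1, h2, h3⟩ := hchain s hs (by omega)
    exact (key s hs hsN t' h1 h2 h3).2

end CompletedTower

/-! ### Part (A) at a place of the tower -/

section PlaceOfTower

open IntermediateField

theorem one_lt_val_of_pow {L Γ : Type*} [Field L] [LinearOrderedCommGroupWithZero Γ]
    {v : Valuation L Γ} {x : L} {n : ℕ} (hn : n ≠ 0) : 1 < v (-x ^ n) ↔ 1 < v x := by
  rw [Valuation.map_neg, map_pow, one_lt_pow_iff_of_nonneg zero_le hn]

theorem val_lt_one_of_pow {L Γ : Type*} [Field L] [LinearOrderedCommGroupWithZero Γ]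
    {v : Valuation L Γ} {x : L} {n : ℕ} (hn : n ≠ 0) : v (-x ^ n) < 1 ↔ v x < 1 := by
  rw [Valuation.map_neg, map_pow, pow_lt_one_iff_of_nonneg zero_le hn]

section Poles

variable {L Γ K : Type*} [Field L] [LinearOrderedCommGroupWithZero Γ] [Field K] [IsAlgClosed K]
variable {v : Valuation L Γ} {κ : K →+* L}
variable {p a q j k : ℕ} [Fact p.Prime] [CharP K p] [CharP L p] (hq : q = p ^ a) (ha : 1 ≤ a)
  (hj : 1 ≤ j) (hk : 1 ≤ k)
include hq ha hj hk

/-- All generators of the tower beyond a pole are poles. -/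
theorem val_of_pole (hpj : ¬ p ∣ j) (hκ : ∀ c, v (κ c) ≤ 1) {x u : ℕ → L} {N r : ℕ}
    (hrel : ∀ s, r ≤ s → s < N → TowerRelation q j k (x s) (x (s + 1)) (u s))
    (hr : 1 < v (x r)) : ∀ s, r ≤ s → s ≤ N → 1 < v (x s) ∧
      (s < N → v (u s) ≤ 1 ∧ v (-(x (s + 1) ^ q ^ j / x s)) = 1) := by
  have hn : q ^ (j + k) - 1 ≠ 0 := by
    have := two_le_pow hq ha (show 1 ≤ j + k by omega) (p := p)
    omega
  have hj0 : (j : L) ≠ 0 := by rwa [Ne, CharP.cast_eq_zero_iff L p]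
  have key : ∀ s, r ≤ s → s < N → 1 < v (x s) → v (u s) ≤ 1 ∧
      v (-(x (s + 1) ^ q ^ j / x s)) = 1 ∧ 1 < v (x (s + 1)) := by
    intro s hs hsN hxs
    have h := hrel s hs hsN
    have hst := h.isTowerStep κ hq
    obtain ⟨h1, h2, -, h3⟩ := hst.toIsTraceSystem.of_pole hq ha hj hk hκ hst.left_ne_zero
      hst.mul_eq hst.mul_eq' (h.tr_sub_tr hq hj0) ((one_lt_val_of_pow hn).2 hxs)
    exact ⟨h1, h2, (one_lt_val_of_pow hn).1 h3⟩
  intro s hs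
  induction s, hs using Nat.le_induction with
  | base => exact fun _ ↦ ⟨hr, fun h ↦ ⟨(key r le_rfl h hr).1, (key r le_rfl h hr).2.1⟩⟩
  | succ s hs ih =>
    intro hsN
    have h1 := (key s hs (by omega) (ih (by omega)).1).2.2
    exact ⟨h1, fun h ↦ ⟨(key _ (by omega) h h1).1, (key _ (by omega) h h1).2.1⟩⟩

end Poles

variable {p a q j k : ℕ} [Fact p.Prime] (hq : q = p ^ a) (ha : 1 ≤ a) (hj : 1 ≤ j) (hk : 1 ≤ k)
variable {K F' : Type*} [Field K] [IsAlgClosed K] [CharP K p] [Field F'] [Algebra K F']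
  {O : ValuationSubring F'}
include hq ha hj hk

theorem completed_tower_of_place (hjk : j.Coprime k) (hpj : ¬ p ∣ j) {y u : ℕ → F'} {i : ℕ}
    (hi : 1 ≤ i)
    (hrel : ∀ s, 1 ≤ s → s < i + 1 → TowerRelation q j k (y s) (y (s + 1)) (u s))
    (hgen : IntermediateField.adjoin K (y '' Set.Icc 1 (i + 1)) = ⊤)
    (hO : ∀ c : K, algebraMap K F' c ∈ O)
    (hy1 : O.valuation (y 1) < 1) (hy2 : 1 < O.valuation (y 2)) :
    let z := -(y 2) ^ (q ^ (j + k) - 1)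
    let H := hat O (IntermediateField.adjoin K {z})
    let E := hat O (IntermediateField.adjoin K {u 1})
    (∃ t ∈ E, t ^ (q ^ j - 1) = (toCompl O z)⁻¹) ∧
      ∀ t ∈ E, t ^ (q ^ j - 1) = (toCompl O z)⁻¹ →
        let Ht := adjoinElement H t
        let G := gField H t (fun s => toCompl O (u s))
        IsFiniteCyclic H Ht ∧
        HasInvariants (complRing O) H Ht (q ^ j - 1) (q ^ j - 1) (q ^ j - 2) ∧
        IsFiniteGalois Ht E ∧
        HasInvariants (complRing O) Ht E (q ^ (k - 1)) (q ^ (k - 1)) (2 * (q ^ (k - 1) - 1)) ∧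
        IsWeaklyRamified p (complRing O) Ht E ∧
        (∀ s, 1 ≤ s → s ≤ i →
          G s ≤ hat O (IntermediateField.adjoin K (u '' Set.Icc 1 s))) ∧
        (∀ s, 1 ≤ s → s + 1 ≤ i →
          IsFiniteGalois (G s) (G (s + 1)) ∧
          HasInvariants (complRing O) (G s) (G (s + 1)) (q ^ j) (q ^ j) (2 * (q ^ j - 1)) ∧
          IsWeaklyRamified p (complRing O) (G s) (G (s + 1))) := by
  intro z H E
  have hcF : CharP F' p := (algebraMap K F').charP_iff (algebraMap K F').injective p |>.1 ‹_›
  have hcL : CharP (Compl O) p :=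
    (constCompl K O).charP_iff (constCompl K O).injective p |>.1 ‹_›
  have hn : q ^ (j + k) - 1 ≠ 0 := by
    have := two_le_pow hq ha (show 1 ≤ j + k by omega) (p := p)
    omega
  -- The separable extension over this rational field supplies a derivation that does not vanish at
  -- y 1.
  let F₁ := IntermediateField.adjoin K {y 1}
  let ξ : F₁ := ⟨y 1, mem_adjoin_simple_self K (y 1)⟩
  have hξ : IntermediateField.adjoin K {ξ} = ⊤ := by
    apply IntermediateField.lift_injective
    rw [lift_adjoin_simple, lift_top]
  obtain ⟨hfd, hsep⟩ := tower_finite_separable (F₁ := F₁) hq ha hj hk ⟨ξ, rfl⟩ hrel hgen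
  have hξ0 : ξ ≠ 0 := fun h0 ↦ (hrel 1 le_rfl (by omega)).ne_zero (congrArg Subtype.val h0)
  obtain ⟨β, D, -, hL, hDκ, hD, -, hDξ, -⟩ := exists_place_data p hξ hO hξ0 hy1
  have hκ := hL.val_const_le
  have hrel' := fun s h1 h2 ↦ (hrel s h1 h2).map (toCompl O)
  have hstep : ∀ s, 1 ≤ s → s < i + 1 → _ := fun s h1 h2 ↦
    (hrel' s h1 h2).isTowerStep (constCompl K O) hq
  have hz : toCompl O z = -(toCompl O (y 2)) ^ (q ^ (j + k) - 1) := by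
    rw [map_neg, map_pow]
  have hy2' : 1 < (Valued.v (toCompl O (y 2)) : O.ValueGroup) := by rw [val_toCompl]; exact hy2
  have hvz : 1 < (Valued.v (toCompl O z) : O.ValueGroup) := by
    rw [hz, one_lt_val_of_pow hn]
    exact hy2'
  have hst := hstep 1 le_rfl (by omega)
  -- As y 2 has a pole, the alternative in which u is integral is excluded.
  have hu1 : 1 < (Valued.v (toCompl O (u 1)) : O.ValueGroup) := by
    rcases hst.toIsTraceSystem.of_zero hq ha hj hk hκ hst.left_ne_zero hst.mul_eq hst.mul_eq'
      ((val_lt_one_of_pow hn).2 (by rw [val_toCompl]; exact hy1)) with h | h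
    · exact h.1
    · rw [hz] at hvz
      exact absurd h.2.2.2 (not_lt.2 hvz.le)
  have hmem := (hrel 1 le_rfl (by omega)).mem_adjoin (K := K) hq
  have hHE : H ≤ E := hat_mono (by rw [adjoin_simple_le_iff]; exact hmem.2)
  have hDy1 : D (-(toCompl O (y 1)) ^ (q ^ (j + k) - 1)) ≠ 0 := by
    exact deriv_neg_pow_ne_zero (constCompl K O) D
      (natCast_pow_sub_one_ne_zero hq ha hj hk (by omega)) (hrel' 1 le_rfl (by omega)).ne_zero hDξ
  have hDz := hst.deriv_ne_zero hq ha hj hk D hDκ hDy1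
  have main := completed_tower hq ha hj hk mem_complRing_iff D hDκ hL hD hjk (N := i + 1) (by omega)
    (u := fun s ↦ toCompl O (u s))
    (z := fun s ↦ -(toCompl O (y s)) ^ (q ^ (j + k) - 1)) hstep (fun s h2 hs ↦
      ((val_of_pole hq ha hj hk hpj hκ (r := 2) (fun s h1 h2 ↦ hrel' s (by omega) h2) hy2' s h2
        hs.le).2 hs).2) (E := E) (H := H)
    (isLaurent_hat_of_pole hL.toHasExpansions hO hu1)
    (by
      have := isLaurent_hat_of_pole hL.toHasExpansions hO hvz
      rwa [hz] at this) hHE hDz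
  rw [hz]
  refine ⟨main.1, fun t htE ht ↦ ?_⟩
  obtain ⟨h1, h2, h3, h4, h5, h6, h7⟩ := main.2 t htE ht
  refine ⟨h1, h2, h3, h4, h5, fun s hs hsi ↦ ?_, fun s hs hsi ↦ h7 s hs (by omega)⟩
  refine h6 (fun s ↦ hat O (IntermediateField.adjoin K (u '' Set.Icc 1 s))) ?_ ?_ ?_ s hs (by omega)
  · refine hat_mono (adjoin.mono K _ _ ?_)
    rw [Set.singleton_subset_iff]
    exact ⟨1, ⟨le_rfl, le_rfl⟩, rfl⟩
  · intro s _ _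
    exact hat_mono (adjoin.mono K _ _ (Set.image_mono (Set.Icc_subset_Icc_right (by omega))))
  · intro s hs _
    exact toCompl_mem_hat (subset_adjoin _ _ ⟨s, ⟨hs, le_rfl⟩, rfl⟩)

end PlaceOfTower

/-! ### The tame top step and the numerical bound -/

section Numerics

open IntermediateField

variable {L Γ K : Type*} [Field L] [LinearOrderedCommGroupWithZero Γ] [Field K] [IsAlgClosed K]
variable {v : Valuation L Γ} {κ : K →+* L} {M : Subfield L} {ℓ ϖ : L}

/-- If a power of `x`, with exponent prime to the characteristic, lies in `M`, and `M(x)` contains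
a uniformizer of the whole field, then the values of `x` and of a uniformizer of `M` are coprime. -/
theorem IsLaurent.coprime_of_pow_mem (hL : IsLaurent v κ ⊤ ϖ) (hM : IsLaurent v κ M ℓ) {x : L}
    {e N a : ℕ} (he : e ≠ 0) (hN : N ≠ 0) (hx : v x = v ϖ ^ e) (hℓ : v ℓ = v ϖ ^ N)
    (ha : (a : K) ≠ 0) (hxa : x ^ a ∈ M) (hgen : ∀ A : Subfield L, M ≤ A → x ∈ A → ϖ ∈ A)
    (hNa : N ∣ e * a) : e.Coprime N := by
  have hϖ := hL.pos.ne'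
  have hx0 : x ≠ 0 := by
    rw [← Valuation.ne_zero_iff v, hx]
    exact pow_ne_zero _ hϖ
  have hℓ0 := hM.ne_zero
  obtain ⟨g, e', N', hg, hcop, rfl, rfl⟩ := Nat.exists_coprime' (Nat.gcd_pos_of_pos_left N
    (Nat.pos_of_ne_zero he))
  have hN' : N' ∣ a := by
    refine hcop.symm.dvd_of_dvd_mul_left (Nat.dvd_of_mul_dvd_mul_right hg ?_)
    rwa [mul_right_comm] at hNa
  obtain ⟨c, rfl⟩ := hN'
  have hNK : (N' : K) ≠ 0 := fun h ↦ ha (by rw [Nat.cast_mul, h, zero_mul])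
  have hcK : (c : K) ≠ 0 := fun h ↦ ha (by rw [Nat.cast_mul, h, mul_zero])
  -- The unit x^N' / ℓ^e' has its c-th power in M, and c divides a, so it lies in M itself.
  have hxN : x ^ N' ∈ M := by
    have h1 : x ^ N' / ℓ ^ e' ∈ M := by
      refine hM.mem_of_pow_mem hL.toHasExpansions le_top hcK (Subfield.mem_top _) ?_ ?_
      · rw [map_div₀, map_pow, map_pow, hx, hℓ, ← pow_mul, ← pow_mul,
          show e' * g * N' = N' * g * e' by ring, div_self (pow_ne_zero _ hϖ)]
      · rw [div_pow, ← pow_mul]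
        exact M.div_mem hxa (M.pow_mem (M.pow_mem hM.mem _) _)
    have h2 := M.mul_mem h1 (M.pow_mem hM.mem e')
    rwa [div_mul_cancel₀ _ (pow_ne_zero _ hℓ0)] at h2
  -- By Bézout, T = x^α ℓ^β has order g, and T^N' is a uniformizer of M. So T is a uniformizer of
  -- the tame extension M(T), which contains x and therefore ϖ; this forces g = 1.
  obtain ⟨α, β, hαβ⟩ := Nat.isCoprime_iff_coprime.2 hcop
  have hT : (x ^ α * ℓ ^ β) ^ N' = (x ^ N') ^ α * ℓ ^ (β * N') := by
    rw [mul_pow, ← zpow_natCast, ← zpow_natCast, ← zpow_natCast, ← zpow_mul, ← zpow_mul,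
      ← zpow_mul, mul_comm α]
  have hTv : v (x ^ α * ℓ ^ β) = v ϖ ^ g := by
    rw [map_mul, map_zpow₀, map_zpow₀, hx, hℓ, ← zpow_natCast, ← zpow_natCast, ← zpow_natCast,
      ← zpow_mul, ← zpow_mul, ← zpow_add₀ hϖ]
    congr 1
    push_cast
    linear_combination (g : ℤ) * hαβ
  have hTM : (x ^ α * ℓ ^ β) ^ N' ∈ M := by
    rw [hT]
    exact M.mul_mem (M.zpow_mem hxN _) (M.zpow_mem hM.mem _)
  have hM' := hM.of_val_eq hTM (by rw [map_pow, hTv, hℓ, ← pow_mul, mul_comm])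
  have hA := (hM'.adjoin_root hNK rfl).2.1
  have hMA := le_adjoinElement M (x ^ α * ℓ ^ β)
  have hxA : x ∈ adjoinElement M (x ^ α * ℓ ^ β) := by
    have h1 : x = (x ^ α * ℓ ^ β) ^ e' * (x ^ N') ^ β / ℓ ^ (β * e') := by
      rw [eq_div_iff (zpow_ne_zero _ hℓ0), mul_pow, ← zpow_natCast, ← zpow_natCast, ← zpow_natCast,
        ← zpow_mul, ← zpow_mul, ← zpow_mul, mul_right_comm, ← zpow_add₀ hx0,
        show α * (e' : ℤ) + N' * β = 1 by linear_combination hαβ, zpow_one]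
    refine (congrArg (· ∈ adjoinElement M (x ^ α * ℓ ^ β)) h1).mpr ?_
    exact div_mem (mul_mem (pow_mem (self_mem_adjoinElement _ _) _)
      (zpow_mem (hMA hxN) _)) (zpow_mem (hMA hM.mem) _)
  have hϖA := hA.val_le_of_lt_one (hgen _ hMA hxA) hL.lt_one
  rw [hTv, ← zpow_natCast] at hϖA
  have h1 : (g : ℤ) ≤ 1 := by rw [← hL.zpow_le_iff, zpow_one]; exact hϖA
  have h2 : g = 1 := by omega
  rw [h2, mul_one, mul_one]
  exact hcop

variable (D : Derivation ℤ L L) (hDκ : ∀ c, D (κ c) = 0) (hL : IsLaurent v κ ⊤ ϖ)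
  (hD : ∀ a, v (D a) ≤ v a * (v ϖ)⁻¹)
include hDκ hL hD

set_option linter.unusedSectionVars false

theorem val_deriv_inv {y : L} (hy : y ≠ 0) : v (D y⁻¹) * v y ^ 2 = v (D y) := by
  rw [D.leibniz_inv, smul_eq_mul, map_mul, Valuation.map_neg, map_pow, map_inv₀, mul_right_comm,
    ← mul_pow, inv_mul_cancel₀ ((Valuation.ne_zero_iff v).2 hy), one_pow, one_mul]

theorem val_deriv_of_pow_eq {x t : L} {a b : ℕ} (ha : (a : K) ≠ 0) (hb : (b : K) ≠ 0)
    (ht0 : t ≠ 0) (htx : t ^ b = -x ^ a) : v (D t) * v x = v (D x) * v t := by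
  have hpow : ∀ (y : L) (n : ℕ), D (y ^ n) * y = n * y ^ n * D y := by
    intro y n
    rcases n with - | n
    · simp
    · rw [D.leibniz_pow, nsmul_eq_mul, smul_eq_mul, Nat.add_sub_cancel]
      ring
  have h1 : (b : L) * t ^ b * (D t * x) = a * t ^ b * (D x * t) := by
    have e1 := hpow t b
    have e2 := hpow x a
    have e3 : D (t ^ b) = - D (x ^ a) := by rw [htx, map_neg]
    rw [e3] at e1
    linear_combination -x * e1 - t * e2 - a * D x * t * htx
  have h2 := congrArg v h1
  simp only [map_mul, hL.val_natCast ha, hL.val_natCast hb, one_mul] at h2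
  exact mul_left_cancel₀ ((Valuation.ne_zero_iff v).2 (pow_ne_zero _ ht0)) h2

/-- Logarithmic derivatives agree in value across the tame relations (x with t, ℓ with ϖ), and D
agrees at 1/t and 1/ℓ by weak ramification. This determines d from e, N and p^m. -/
theorem different_bound {p : ℕ} [Fact p.Prime] [CharP K p] (hDϖ : D ϖ ≠ 0) {x t : L}
    {e d a b m : ℕ} (he : e ≠ 0) (hx : v x = v ϖ ^ e) (hd : v ϖ ^ d * v (D ϖ) = v (D x))
    (ha : (a : K) ≠ 0) (hb : (b : K) ≠ 0) (hM : IsLaurent v κ M ℓ) (htM : t ∈ M)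
    (htx : t ^ b = -x ^ a) (htℓ : v t = v ℓ ^ p ^ m) (hDt : v (D ℓ⁻¹) = v (D t⁻¹))
    (hgen : ∀ A : Subfield L, M ≤ A → x ∈ A → ϖ ∈ A) :
    (d : ℝ) ≤ ((a : ℝ) / b + 1) * (e - 1) := by
  have hϖ := hL.pos.ne'
  have hp : p.Prime := Fact.out
  have ht0 : t ≠ 0 := by
    rw [← Valuation.ne_zero_iff v, htℓ]
    exact pow_ne_zero _ hM.pos.ne'
  obtain ⟨N, hN⟩ := hL.exists_val (Subfield.mem_top ℓ) hM.ne_zero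
  have hNpos : 0 < N := by
    rw [← hL.zpow_lt_iff, ← hN, zpow_zero]
    exact hM.lt_one
  lift N to ℕ using hNpos.le
  rw [zpow_natCast] at hN
  have hN0 : N ≠ 0 := by omega
  have hb0 : b ≠ 0 := by rintro rfl; simp at hb
  have ha0 : a ≠ 0 := by rintro rfl; simp at ha
  have heq : e * a = N * p ^ m * b := by
    have h1 := congrArg v htx
    rw [Valuation.map_neg, map_pow, map_pow, htℓ, hN, hx, ← pow_mul, ← pow_mul, ← pow_mul,
      ← zpow_natCast, ← zpow_natCast, hL.zpow_inj] at h1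
    rw [mul_assoc]
    exact_mod_cast h1.symm
  have hxa : x ^ a ∈ M := by
    rw [← neg_neg (x ^ a), ← htx]
    exact neg_mem (pow_mem htM _)
  have hcop := hL.coprime_of_pow_mem hM he hN0 hx hN ha hxa hgen
    (by rw [heq, mul_assoc]; exact dvd_mul_right _ _)
  -- N is coprime to e and divides e a, hence divides a, which is prime to the characteristic.
  have hNK : ((N : ℤ) : K) ≠ 0 := by
    rw [Int.cast_natCast]
    intro h0
    have hNa : N ∣ a := hcop.symm.dvd_of_dvd_mul_left
      (by rw [heq, mul_assoc]; exact dvd_mul_right _ _)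
    obtain ⟨c, rfl⟩ := hNa
    exact ha (by rw [Nat.cast_mul, h0, zero_mul])
  have hDℓ := val_deriv_eq D hDκ hL.toHasExpansions hD hL.toHasExpansions (Subfield.mem_top ℓ) hNK
    (by rw [zpow_natCast, hN])
  have hDtx := val_deriv_of_pow_eq D hDκ hL hD ha hb ht0 htx
  have e1 := val_deriv_inv D hDκ hL hD hM.ne_zero
  have e2 := val_deriv_inv D hDκ hL hD ht0
  have hδ := (Valuation.ne_zero_iff v).2 hDϖ
  -- The equations for D x, D t, D ℓ and D ϖ are multiplied together, and the order of D ϖ and of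
  -- D(1/ℓ) cancels.
  have key : d + 1 + N = e + N * p ^ m := by
    rw [← hDt, htℓ] at e2
    rw [← hd, hx, htℓ] at hDtx
    rw [← e2] at hDtx
    rw [← e1] at hDℓ
    have hne : v (D ℓ⁻¹) ≠ 0 := by
      intro h0
      rw [h0, zero_mul, zero_mul, hN] at hDℓ
      exact mul_ne_zero (pow_ne_zero _ hϖ) hδ hDℓ.symm
    have h3 : v ϖ ^ (d + 1 + N) * (v (D ϖ) * v (D ℓ⁻¹) * (v ℓ ^ p ^ m * v ℓ)) =
        v ϖ ^ (e + N * p ^ m) * (v (D ϖ) * v (D ℓ⁻¹) * (v ℓ ^ p ^ m * v ℓ)) := by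
      rw [pow_add, pow_add, pow_one, ← hN, pow_add, pow_mul, ← hN]
      calc _ = (v ϖ ^ d * v (D ϖ) * v ℓ ^ p ^ m) * (v (D ℓ⁻¹) * v ℓ ^ 2 * v ϖ) := by
            simp only [pow_two, mul_assoc, mul_comm, mul_left_comm]
        _ = (v (D ℓ⁻¹) * (v ℓ ^ p ^ m) ^ 2 * v ϖ ^ e) * (v ℓ * v (D ϖ)) := by rw [hDℓ, hDtx]
        _ = _ := by simp only [pow_two, mul_assoc, mul_comm, mul_left_comm]
    have h4 := mul_right_cancel₀ (mul_ne_zero (mul_ne_zero hδ hne)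
      (mul_ne_zero (pow_ne_zero _ hM.pos.ne') hM.pos.ne')) h3
    rw [← zpow_natCast, ← zpow_natCast, hL.zpow_inj] at h4
    exact_mod_cast h4
  -- The wild degree p^m is prime to a, so it divides e; with e = p^m f the relation becomes f a = N
  -- b.
  have hle : a ≤ N * b := by
    have hpa : (p ^ m).Coprime a := Nat.Coprime.pow_left _ ((Nat.Prime.coprime_iff_not_dvd hp).2
      fun h ↦ ha ((CharP.cast_eq_zero_iff K p a).2 h))
    obtain ⟨f, rfl⟩ : p ^ m ∣ e := hpa.dvd_of_dvd_mul_right (by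
      rw [heq, mul_right_comm]; exact dvd_mul_left _ _)
    have hf : f ≠ 0 := by rintro rfl; simp at he
    have h1 : f * a = N * b := Nat.eq_of_mul_eq_mul_left (pow_pos hp.pos m) (by
      rw [← mul_assoc, heq]; ring)
    rw [← h1]
    exact Nat.le_mul_of_pos_left _ (Nat.pos_of_ne_zero hf)
  have hbR : (0 : ℝ) < b := by exact_mod_cast Nat.pos_of_ne_zero hb0
  have h5 : (d : ℝ) + 1 + N = e + N * p ^ m := by exact_mod_cast key
  have h6 : (e : ℝ) * a = N * p ^ m * b := by exact_mod_cast heq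
  have h7 : (a : ℝ) ≤ N * b := by exact_mod_cast hle
  have h8 : ((a : ℝ) / b + 1) * (e - 1) - d = (N * b - a) / b := by
    field_simp
    linear_combination -(b : ℝ) * h5 + h6
  have h9 : 0 ≤ ((N : ℝ) * b - a) / b := div_nonneg (sub_nonneg.2 h7) hbR.le
  linarith

end Numerics

/-! ### Joining the two chains and bounding the different -/

section LocalBound

open Polynomial

variable {L Γ K : Type*} [Field L] [LinearOrderedCommGroupWithZero Γ] [Field K] [IsAlgClosed K]
variable {v : Valuation L Γ} {κ : K →+* L} {A B E M : Subfield L} {π ϖ : L}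
variable {p a q j k : ℕ} [Fact p.Prime] [CharP K p] [CharP L p] (hq : q = p ^ a) (ha : 1 ≤ a)
  (hj : 1 ≤ j) (hk : 1 ≤ k)

theorem TowerRelation.mem_of_mem {x x' u : L} (h : TowerRelation q j k x x' u) (hx : x ∈ A)
    (hu : u ∈ A) : x' ∈ A := by
  rw [← div_mul_cancel₀ x' (pow_ne_zero (q ^ k) h.ne_zero), ← h.tr_k]
  exact mul_mem (add_mem (sum_mem fun r _ ↦ pow_mem hu _) (inv_mem (natCast_mem _ _)))
    (pow_mem hx _)

set_option linter.unusedSectionVars false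

theorem additive_reflTransGen {N : ℕ} {y : L} (h : IsAdditiveStep v κ A B N y) :
    Relation.ReflTransGen (IsASStep v κ p) A B := by
  obtain ⟨S, W, s, hS, hW, hsA, hy, rfl⟩ := h
  exact additive_chain p _ S W s y rfl hS hsA hy

include hq ha hj hk

/-- Over a common zero of two consecutive generators, `u` is a simple root of its equation. -/
theorem TowerRelation.mem_of_zero (hL : HasExpansions v κ ⊤ ϖ) (hM : IsLaurent v κ M π)
    {x x' u : L} (h : TowerRelation q j k x x' u) (hx : v x < 1) (hx' : v x' < 1) (hxM : x ∈ M) :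
    u ∈ M := by
  have hn : q ^ (j + k) - 1 ≠ 0 := by
    have := two_le_pow hq ha (show 1 ≤ j + k by omega) (p := p)
    omega
  have hst := h.isTowerStep κ hq
  have hu : v u ≤ 1 := by
    rcases hst.toIsTraceSystem.of_zero hq ha hj hk hL.val_const_le hst.left_ne_zero hst.mul_eq
      hst.mul_eq' ((val_lt_one_of_pow hn).2 hx) with h1 | h1
    · exact absurd ((val_lt_one_of_pow hn).2 hx') (not_lt.2 h1.2.le)
    · exact h1.1
  have hz : -x ^ (q ^ (j + k) - 1) ∈ intRing v M :=
    ⟨neg_mem (pow_mem hxM _), ((val_lt_one_of_pow hn).2 hx).le⟩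
  have hα : ((j : L)⁻¹) ∈ intRing v M := by
    rw [← map_natCast κ, ← map_inv₀]
    exact ⟨hM.const _, hM.val_const_le _⟩
  have hcast : ∀ r, 1 ≤ r → ((q ^ r : ℕ) : intRing v M) = 0 := fun r hr ↦ by
    apply Subtype.ext
    push_cast
    have := natCast_pow_eq_zero (R := L) hq ha hr
    exact_mod_cast this
  refine hM.mem_of_root hL le_top ((∑ r ∈ Finset.range j, X ^ q ^ r) -
    C ⟨_, hz⟩ * ((∑ r ∈ Finset.range k, X ^ q ^ r) + C ⟨_, hα⟩) ^ q ^ j)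
    (Subfield.mem_top u) hu ?_ ?_
  · have h1 := hst.mul_eq
    rw [← h.tr_k, ← h.tr_j] at h1
    simp only [Tr] at h1
    simp only [eval₂_sub, eval₂_mul, eval₂_pow, eval₂_add, eval₂_finsetSum, eval₂_X, eval₂_C,
      Subring.subtype_apply]
    linear_combination -h1
  · obtain ⟨j, rfl⟩ : ∃ j', j = j' + 1 := ⟨j - 1, by omega⟩
    have hpow : ∀ f : (intRing v M)[X], derivative (f ^ q ^ (j + 1)) = 0 := fun f ↦ by
      rw [derivative_pow, hcast _ hj, C_0, zero_mul, zero_mul]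
    have hX : ∀ r ∈ Finset.range j, derivative ((X : (intRing v M)[X]) ^ q ^ (r + 1)) = 0 :=
      fun r _ ↦ by rw [derivative_X_pow, hcast _ (by omega), C_0, zero_mul]
    rw [derivative_sub, derivative_mul, derivative_C, hpow, zero_mul, mul_zero, add_zero, sub_zero,
      Finset.sum_range_succ', derivative_add, derivative_sum, Finset.sum_eq_zero hX]
    simp

/-- The fields generated by `u` and by the elements that follow it lie in a common extension by
Artin–Schreier steps. -/
theorem IsTowerStep.exists_join (hjk : j.Coprime k) (hL : IsLaurent v κ ⊤ ϖ)
    (hclo : ∀ w, 1 < v w → ∃ A, IsLaurent v κ A w⁻¹ ∧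
      ∀ B π', IsLaurent v κ B π' → w ∈ B → A ≤ B)
    {u₀ X₀ Z₀ z₀ : L} {u X Z z : ℕ → L} (h : IsTowerStep κ q j k u₀ X₀ Z₀ z₀ (z 0))
    (hE : IsLaurent v κ E u₀⁻¹) (hvz : 1 < v (z 0)) (m : ℕ)
    (hstep : ∀ s < m, IsTowerStep κ q j k (u s) (X s) (Z s) (z s) (z (s + 1)) ∧ v (Z s) = 1) :
    ∃ B Y, Relation.ReflTransGen (IsASStep v κ p) E Y ∧
      Relation.ReflTransGen (IsASStep v κ p) B Y ∧ (∀ s < m, u s ∈ B) ∧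
      ∃ t, IsLaurent v κ B t ∧ t ^ (q ^ j - 1) * z m = 1 := by
  obtain ⟨H, hH, hHmin⟩ := hclo _ hvz
  obtain ⟨t, htE, ht⟩ := h.exists_pow_mul_eq_one hq ha hj hk hE
  have hzE : z 0 ∈ E := by
    rw [eq_inv_of_mul_eq_one_right ht]
    exact inv_mem (pow_mem htE _)
  obtain ⟨hG, y, hy⟩ := h.exists_isAdditiveStep hq ha hj hk hE hH (hHmin E _ hE hzE) htE ht
  obtain ⟨B, hB, hu, ht'⟩ := unit_chain hq ha hj hk hjk hL hG ht m fun s hs ↦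
    have h1 := (hstep s hs).1
    ⟨h1.toIsTraceSystem, h1.left_ne_zero, h1.mul_eq, h1.mul_eq', (hstep s hs).2⟩
  obtain ⟨Y, hEY, hBY⟩ := Relation.church_rosser
    (fun _ _ _ ↦ asStep_diamond (p := p) hL.toHasExpansions) (additive_reflTransGen hy) hB
  exact ⟨B, Y, hEY, hBY, hu, ht'⟩

/-- At a zero of `x 1`, if some generator has a pole, there is a field `M` that contains all the
elements `u s`, and whose invariants are known. -/
theorem exists_join_of_pole (hjk : j.Coprime k) (hpj : ¬ p ∣ j) (hL : IsLaurent v κ ⊤ ϖ)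
    (hclo : ∀ w, 1 < v w → ∃ A, IsLaurent v κ A w⁻¹ ∧
      ∀ B π', IsLaurent v κ B π' → w ∈ B → A ≤ B)
    (D : Derivation ℤ L L) (hDκ : ∀ c, D (κ c) = 0) (hD : ∀ b, v (D b) ≤ v b * (v ϖ)⁻¹)
    {x u : ℕ → L} {N r : ℕ} (hr : 1 ≤ r) (hrN : r < N)
    (hrel : ∀ s, 1 ≤ s → s < N → TowerRelation q j k (x s) (x (s + 1)) (u s))
    (hzero : ∀ s, 1 ≤ s → s ≤ r → v (x s) < 1) (hpole : 1 ≤ v (x (r + 1))) :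
    ∃ M ℓ t m, IsLaurent v κ M ℓ ∧ (∀ s, 1 ≤ s → s < N → u s ∈ M) ∧ t ∈ M ∧
      t ^ (q ^ k - 1) = -x 1 ^ (q ^ (j + k) - 1) ∧ v t = v ℓ ^ p ^ m ∧ v (D ℓ⁻¹) = v (D t⁻¹) := by
  have hκ := hL.val_const_le
  have hn : q ^ (j + k) - 1 ≠ 0 := by
    have := two_le_pow hq ha (show 1 ≤ j + k by omega) (p := p)
    omega
  have hstep := fun s h1 h2 ↦ (hrel s h1 h2).isTowerStep κ hq
  have hsr := hstep r hr hrN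
  have hur : 1 < v (u r) ∧ 1 < v (-x (r + 1) ^ (q ^ (j + k) - 1)) := by
    rcases hsr.toIsTraceSystem.of_zero hq ha hj hk hκ hsr.left_ne_zero hsr.mul_eq
      hsr.mul_eq' ((val_lt_one_of_pow hn).2 (hzero r hr le_rfl)) with h1 | h1
    · exact h1
    · exact absurd hpole (not_le.2 ((val_lt_one_of_pow hn).1 h1.2.2.2))
  obtain ⟨E, hE, -⟩ := hclo _ hur.1
  have hpol := val_of_pole hq ha hj hk hpj hκ (fun s h1 h2 ↦ hrel s (by omega) h2)
    ((one_lt_val_of_pow hn).1 hur.2)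
  obtain ⟨B, Y, hEY, hBY, huB, t₀, hB, -⟩ := IsTowerStep.exists_join hq ha hj hk hjk hL hclo
    (u := fun s ↦ u (r + 1 + s)) (z := fun s ↦ -x (r + 1 + s) ^ (q ^ (j + k) - 1))
    (X := fun s ↦ _) (Z := fun s ↦ _) hsr hE hur.2 (N - (r + 1))
    fun s hs ↦ ⟨hstep (r + 1 + s) (by omega) (by omega),
      ((hpol (r + 1 + s) (by omega) (by omega)).2 (by omega)).2⟩
  have hpos : ∀ s, 1 ≤ s → s ≤ r → 1 < v (-x s ^ (q ^ (j + k) - 1))⁻¹ := fun s h1 h2 ↦ by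
    rw [map_inv₀, one_lt_inv₀ ((Valuation.pos_iff v).2 (hstep s h1 (by omega)).ne_zero)]
    exact (val_lt_one_of_pow hn).2 (hzero s h1 h2)
  -- The same argument with j and k exchanged and the indices reversed: the inverses of the z_s with
  -- s ≤ r now play the role of poles, and the chain ends at z_1.
  obtain ⟨B', Y', hEY', hBY', huB', t, hB't, ht⟩ := IsTowerStep.exists_join hq ha hk hj hjk.symm
    hL hclo (u := fun s ↦ u (r - 1 - s)) (z := fun s ↦ (-x (r - s) ^ (q ^ (j + k) - 1))⁻¹)
    (X := fun s ↦ -(x (r - s) ^ q ^ j / x (r - 1 - s)))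
    (Z := fun s ↦ x (r - s) / x (r - 1 - s) ^ q ^ k) hsr.symm hE
    (hpos r hr le_rfl) (r - 1) fun s hs ↦ by
      have e1 : r - s = r - 1 - s + 1 := by omega
      have e2 : r - (s + 1) = r - 1 - s := by omega
      have h1 := hstep (r - 1 - s) (by omega) (by omega)
      rw [e2, e1]
      refine ⟨h1.symm, ?_⟩
      rcases h1.toIsTraceSystem.of_zero hq ha hj hk hκ h1.left_ne_zero h1.mul_eq h1.mul_eq'
        ((val_lt_one_of_pow hn).2 (hzero _ (by omega) (by omega))) with h2 | h2
      · exact absurd ((val_lt_one_of_pow hn).2 (hzero (r - 1 - s + 1) (by omega) (by omega)))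
          (not_lt.2 h2.2.le)
      · exact h2.2.1
  -- The two joins share the field E of u_r, over which they are joined once more.
  obtain ⟨M, hYM, hYM'⟩ := Relation.church_rosser
    (fun _ _ _ ↦ asStep_diamond (p := p) hL.toHasExpansions) hEY hEY'
  obtain ⟨hB'M, ℓ, hM, hDℓ, m, hm⟩ := asChain_invariants D hDκ hL.toHasExpansions hD hB't
    (hBY'.trans hYM')
  have hle : ∀ {A π'}, IsLaurent v κ A π' → Relation.ReflTransGen (IsASStep v κ p) A M → A ≤ M :=
    fun hA h ↦ (asChain_invariants D hDκ hL.toHasExpansions hD hA h).1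
  have hEM := hle hE (hEY.trans hYM)
  have hBM := hle hB (hBY.trans hYM)
  refine ⟨M, ℓ, t, m, hM, fun s h1 h2 ↦ ?_, hB'M hB't.mem, ?_, hm, hDℓ⟩
  · rcases lt_trichotomy s r with h | rfl | h
    · have := huB' (r - 1 - s) (by omega)
      rw [show r - 1 - (r - 1 - s) = s by omega] at this
      exact hB'M this
    · refine hEM ?_
      simpa using inv_mem hE.mem
    · have := huB (s - (r + 1)) (by omega)
      rw [show r + 1 + (s - (r + 1)) = s by omega] at this
      exact hBM this
  · rw [show r - (r - 1) = 1 by omega] at ht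
    rw [← inv_inv (-x 1 ^ (q ^ (j + k) - 1))]
    exact eq_inv_of_mul_eq_one_left ht

/-- The hypothesis `hclo` provides the least complete subfield K((1/w)) containing w; `hgen` says
that the generators of the tower reach a uniformizer. Either no generator leaves the zeros and the
place is unramified, or the first one that does is a pole. -/
theorem local_bound (hjk : j.Coprime k) (hpj : ¬ p ∣ j) (hL : IsLaurent v κ ⊤ ϖ)
    (hclo : ∀ w, 1 < v w → ∃ A, IsLaurent v κ A w⁻¹ ∧
      ∀ B π', IsLaurent v κ B π' → w ∈ B → A ≤ B)
    (D : Derivation ℤ L L) (hDκ : ∀ c, D (κ c) = 0) (hD : ∀ b, v (D b) ≤ v b * (v ϖ)⁻¹)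
    (hDϖ : D ϖ ≠ 0) {x u : ℕ → L} {N : ℕ}
    (hrel : ∀ s, 1 ≤ s → s < N → TowerRelation q j k (x s) (x (s + 1)) (u s))
    (hgen : ∀ A : Subfield L, (∀ c, κ c ∈ A) → (∀ s, 1 ≤ s → s ≤ N → x s ∈ A) → ϖ ∈ A)
    (hx0 : x 1 ≠ 0) (hx1 : v (x 1) < 1) {e d : ℕ} (hx : v (x 1) = v ϖ ^ e)
    (hd : v ϖ ^ d * v (D ϖ) = v (D (x 1))) :
    (d : ℝ) ≤ (((q : ℝ) ^ (j + k) - 1) / ((q : ℝ) ^ k - 1) + 1) * (e - 1) := by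
  have hmem : ∀ A : Subfield L, x 1 ∈ A → (∀ s, 1 ≤ s → s < N → u s ∈ A) →
      ∀ s, 1 ≤ s → s ≤ N → x s ∈ A := by
    intro A h1 hu s hs
    induction s, hs using Nat.le_induction with
    | base => exact fun _ ↦ h1
    | succ s hs ih => exact fun hsN ↦ (hrel s hs hsN).mem_of_mem (ih (by omega)) (hu s hs hsN)
  have he : e ≠ 0 := by
    rintro rfl
    rw [pow_zero] at hx
    exact hx1.ne hx
  by_cases hzero : ∀ s, 1 ≤ s → s ≤ N → v (x s) < 1
  · obtain ⟨M, hM, -⟩ := hclo (x 1)⁻¹ (by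
      rw [map_inv₀, one_lt_inv₀ ((Valuation.pos_iff v).2 hx0)]
      exact hx1)
    rw [inv_inv] at hM
    have hxM : ∀ s, 1 ≤ s → s ≤ N → x s ∈ M ∧ (s < N → u s ∈ M) := by
      intro s hs
      have key : ∀ s, 1 ≤ s → s < N → x s ∈ M → u s ∈ M := fun s hs hsN h ↦
        (hrel s hs hsN).mem_of_zero hq ha hj hk hL.toHasExpansions hM (hzero s hs hsN.le)
          (hzero _ (by omega) (by omega)) h
      induction s, hs using Nat.le_induction with
      | base => exact fun _ ↦ ⟨hM.mem, fun h ↦ key _ le_rfl h hM.mem⟩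
      | succ s hs ih =>
        intro hsN
        have h1 := (hrel s hs hsN).mem_of_mem (ih (by omega)).1 ((ih (by omega)).2 hsN)
        exact ⟨h1, fun h ↦ key _ (by omega) h h1⟩
    -- All generators lie in K((x_1)), so x_1 is a uniformizer of L; this gives e = 1 and d = 0.
    have hϖM := hgen M hM.const fun s h1 h2 ↦ (hxM s h1 h2).1
    have hv : v (x 1) = v ϖ := le_antisymm (hL.val_le_of_lt_one (Subfield.mem_top _) hx1)
      (hM.val_le_of_lt_one hϖM hL.lt_one)
    have hD1 := val_deriv_eq D hDκ hL.toHasExpansions hD hL.toHasExpansions (Subfield.mem_top (x 1))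
      (m := 1) (by simp) (by rw [zpow_one, hv])
    rw [← hd, hv, mul_comm, ← mul_assoc, ← pow_succ'] at hD1
    have h1 := mul_right_cancel₀ ((Valuation.ne_zero_iff v).2 hDϖ) hD1
    rw [hx] at hv
    rw [← zpow_natCast, ← zpow_one (v ϖ), ← zpow_mul, hL.zpow_inj] at h1
    rw [← zpow_natCast, ← zpow_one (v ϖ), ← zpow_mul, hL.zpow_inj] at hv
    have h2 : e = 1 := by omega
    have h3 : d = 0 := by omega
    rw [h2, h3]
    simp
  · push Not at hzero
    classical
    -- The first generator that does not vanish has index r + 1, and r ≥ 1 since x_1 vanishes.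
    obtain ⟨hs1, hs2, hs3⟩ := Nat.find_spec hzero
    have hmin := fun s ↦ Nat.find_min hzero (m := s)
    obtain ⟨r, hr⟩ : ∃ r, Nat.find hzero = r + 1 := ⟨Nat.find hzero - 1, by omega⟩
    rw [hr] at hs1 hs2 hs3 hmin
    have hr1 : 1 ≤ r := by
      by_contra! h0
      obtain rfl : r = 0 := by omega
      exact absurd hx1 (not_lt.2 hs3)
    obtain ⟨M, ℓ, t, m, hM, huM, htM, htx, htℓ, hDt⟩ := exists_join_of_pole hq ha hj hk hjk hpj hL
      hclo D hDκ hD hr1 hs2 hrel (fun s h1 h2 ↦ by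
        have := hmin s (by omega)
        push Not at this
        exact this h1 (by omega)) hs3
    have h := different_bound D hDκ hL hD hDϖ he hx hd
      (natCast_pow_sub_one_ne_zero hq ha hj hk (show 1 ≤ j + k by omega))
      (natCast_pow_sub_one_ne_zero hq ha hj hk hk) hM htM htx htℓ hDt
      (fun A hMA hxA ↦ hgen A (fun c ↦ hMA (hM.const c))
        (hmem A hxA fun s h1 h2 ↦ hMA (huM s h1 h2)))
    have hc : ∀ n, 1 ≤ n → (((q ^ n - 1 : ℕ)) : ℝ) = (q : ℝ) ^ n - 1 := fun n hn ↦ by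
      rw [Nat.cast_sub (by have := two_le_pow hq ha hn (p := p); omega)]
      push_cast
      rfl
    rwa [hc _ (by omega), hc _ hk] at h

end LocalBound

/-! ### The bound at a place of the tower -/

section PlaceBound

/-- Integral elements of A are limits of polynomials in π, and the complete field B contains these
limits as soon as it contains π. -/
theorem IsLaurent.le_of_mem {L Γ K : Type*} [Field L] [LinearOrderedCommGroupWithZero Γ] [Field K]
    {v : Valuation L Γ} {κ : K →+* L} {A B : Subfield L} {π π' ϖ : L}
    (hL : HasExpansions v κ ⊤ ϖ) (hA : HasExpansions v κ A π) (hB : IsLaurent v κ B π')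
    (hπ : π ∈ B) : A ≤ B := by
  have key : ∀ b ∈ A, v b ≤ 1 → b ∈ B := fun b hb hvb ↦
    hB.mem_of_approx hL le_top (Subfield.mem_top b) fun n ↦ by
      obtain ⟨b', hb', -, hn⟩ := hA.exists_approx hπ hB.const hb hvb n
      exact ⟨b', hb', hn.trans (pow_le_pow_left₀ zero_le (hB.val_le_of_lt_one hπ hA.lt_one) n)⟩
  intro b hb
  rcases le_total (v b) 1 with h1 | h1
  · exact key b hb h1
  · rw [← inv_inv b]
    refine B.inv_mem (key _ (A.inv_mem hb) ?_)
    rw [map_inv₀]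
    exact inv_le_one_of_one_le₀ h1

theorem exists_isLaurent_inv {L Γ K : Type*} [Field L] [LinearOrderedCommGroupWithZero Γ]
    [Valued L Γ] [CompleteSpace L] [Field K] {κ : K →+* L} {ϖ : L}
    (hL : HasExpansions Valued.v κ ⊤ ϖ) (w : L) (hw : 1 < (Valued.v w : Γ)) :
    ∃ A, IsLaurent Valued.v κ A w⁻¹ ∧ ∀ B π', IsLaurent Valued.v κ B π' → w ∈ B → A ≤ B := by
  let _ := κ.toAlgebra
  have hw0 : w ≠ 0 := by
    rintro rfl
    rw [map_zero] at hw
    exact absurd hw (not_lt.2 zero_le)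
  have h1 := hL.isLaurent_closure (hasExpansions_adjoin (i := RingHom.id L) (κ := κ)
    (fun _ ↦ rfl) hL.val_const (inv_ne_zero hw0)
    (by rw [RingHom.id_apply, map_inv₀]; exact inv_lt_one_of_one_lt₀ hw))
  exact ⟨_, h1, fun B π' hB hwB ↦ hB.le_of_mem hL h1.toHasExpansions (inv_mem hwB)⟩

variable {p a q j k : ℕ} [Fact p.Prime] (hq : q = p ^ a) (ha : 1 ≤ a) (hj : 1 ≤ j) (hk : 1 ≤ k)
variable {K F₁ F' : Type*} [Field K] [IsAlgClosed K] [CharP K p] [Field F₁] [Field F']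
  [Algebra K F₁] [Algebra K F'] [Algebra F₁ F'] [IsScalarTower K F₁ F'] {O : ValuationSubring F'}
include hq ha hj hk

theorem bound_of_place (hjk : j.Coprime k) (hpj : ¬ p ∣ j) {y u : ℕ → F'} {N : ℕ} {ξ : F₁}
    (hξ : IntermediateField.adjoin K {ξ} = ⊤) (hξ0 : ξ ≠ 0) (hy1 : algebraMap F₁ F' ξ = y 1)
    (hrel : ∀ s, 1 ≤ s → s < N → TowerRelation q j k (y s) (y (s + 1)) (u s))
    (hgen : IntermediateField.adjoin K (y '' Set.Icc 1 N) = ⊤)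
    (hO : ∀ c : K, algebraMap K F' c ∈ O) (hvy : O.valuation (y 1) < 1) :
    ∃ e d : ℕ, HasRamificationIndex F₁ O e ∧ HasDifferentExponent F₁ O d ∧
      (d : ℝ) ≤ (((q : ℝ) ^ (j + k) - 1) / ((q : ℝ) ^ k - 1) + 1) * ((e : ℝ) - 1) := by
  have hcF : CharP F' p := (algebraMap K F').charP_iff (algebraMap K F').injective p |>.1 ‹_›
  have hcL : CharP (Compl O) p :=
    (constCompl K O).charP_iff (constCompl K O).injective p |>.1 ‹_›
  obtain ⟨hfd, hsep⟩ := tower_finite_separable (F₁ := F₁) hq ha hj hk ⟨ξ, hy1⟩ hrel hgen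
  obtain ⟨β, D, hβ, hL, hDκ, hD, hDβ, -, e, d, he, hd, hve, hvd⟩ :=
    exists_place_data p hξ hO hξ0 (by rw [hy1]; exact hvy)
  rw [hy1] at hve hvd
  refine ⟨e, d, he, hd, local_bound hq ha hj hk hjk hpj hL
    (exists_isLaurent_inv hL.toHasExpansions) D hDκ hD hDβ (x := fun s ↦ toCompl O (y s))
    (u := fun s ↦ toCompl O (u s)) (fun s h1 h2 ↦ (hrel s h1 h2).map (toCompl O)) ?_ ?_ ?_ hve hvd⟩
  -- The preimage of A in the function field is an intermediate field that contains all generators,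
  -- hence also β.
  · intro A hA hyA
    have h1 : IntermediateField.adjoin K (y '' Set.Icc 1 N) ≤
        { A.comap (toCompl O) with algebraMap_mem' := hA } := by
      rw [IntermediateField.adjoin_le_iff]
      rintro _ ⟨s, hs, rfl⟩
      exact hyA s hs.1 hs.2
    rw [hgen] at h1
    exact h1 (IntermediateField.mem_top (x := β))
  · rw [Ne, map_eq_zero, ← hy1, map_eq_zero]
    exact hξ0
  · rw [val_toCompl]
    exact hvy

end PlaceBound

/-! ### Transfer to the fields F_i inside Ω -/

section Concrete

variable {p a q j k : ℕ} [Fact p.Prime] (hq : q = p ^ a) (ha : 1 ≤ a) (hj : 1 ≤ j) (hk : 1 ≤ k)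
variable {K Ω F' : Type*} [Field K] [Field Ω] [Algebra K Ω] [Field F'] [Algebra K F'] {x : ℕ → Ω}
  {N : ℕ} (ι : F' →ₐ[K] Ω) (hι : ι.fieldRange = towerField K x N)

theorem charP_of_card {𝔽 : Type*} [Field 𝔽] [Finite 𝔽] {m : ℕ} (h : Nat.card 𝔽 = p ^ m) :
    CharP 𝔽 p := by
  obtain ⟨_⟩ := nonempty_fintype 𝔽
  have h1 := Nat.cast_card_eq_zero 𝔽
  rw [← Nat.card_eq_fintype_card, h, Nat.cast_pow] at h1
  exact (CharP.charP_iff_prime_eq_zero Fact.out).2 (by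
    by_contra h0
    exact pow_ne_zero m h0 h1)

include hι

theorem exists_generators : ∃ y : ℕ → F', (∀ s, 1 ≤ s → s ≤ N → ι (y s) = x s) ∧
    IntermediateField.adjoin K (y '' Set.Icc 1 N) = ⊤ := by
  have h : ∀ s, ∃ b, 1 ≤ s → s ≤ N → ι b = x s := by
    intro s
    by_cases hs : 1 ≤ s ∧ s ≤ N
    · have h1 : x s ∈ ι.fieldRange := by
        rw [hι]
        exact IntermediateField.subset_adjoin K _ ⟨s, hs, rfl⟩
      obtain ⟨b, hb⟩ := h1
      exact ⟨b, fun _ _ ↦ hb⟩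
    · exact ⟨0, fun h1 h2 ↦ absurd ⟨h1, h2⟩ hs⟩
  choose y hy using h
  refine ⟨y, hy, ?_⟩
  apply IntermediateField.map_injective ι
  rw [IntermediateField.adjoin_map, ← AlgHom.fieldRange_eq_map, hι, towerField, Set.image_image]
  congr 1
  exact Set.image_congr fun s hs ↦ hy s hs.1 hs.2

include hq ha hj hk

theorem exists_u_elements [CharP Ω p] (hjk : j.Coprime k) (hpj : ¬ p ∣ j)
    (hx : GeneratesTower K q j k x) {y : ℕ → F'} (hy : ∀ s, 1 ≤ s → s ≤ N → ι (y s) = x s) :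
    ∃ u : ℕ → F', ∀ s, 1 ≤ s → s < N → TowerRelation q j k (y s) (y (s + 1)) (u s) := by
  have h : ∀ s, ∃ b, 1 ≤ s → s < N → TowerRelation q j k (y s) (y (s + 1)) b := by
    intro s
    by_cases hs : 1 ≤ s ∧ s < N
    · obtain ⟨w, hw, -⟩ := existsUnique_isUElement hq ha hj hk hjk hpj hx hs.1
      have h1 : w ∈ ι.fieldRange := by
        rw [hι]
        refine IntermediateField.adjoin.mono K _ _ ?_ hw.1
        rintro b (rfl | rfl)
        · exact ⟨s, ⟨hs.1, hs.2.le⟩, rfl⟩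
        · exact ⟨s + 1, ⟨by omega, hs.2⟩, rfl⟩
      obtain ⟨b, rfl⟩ := h1
      refine ⟨b, fun _ _ ↦ TowerRelation.of_map (ι : F' →+* Ω) ?_⟩
      have h2 := hw.towerRelation hq ha hj hk hx hs.1
      rw [← hy s hs.1 hs.2.le, ← hy (s + 1) (by omega) hs.2] at h2
      exact h2
    · exact ⟨0, fun h1 h2 ↦ absurd ⟨h1, h2⟩ hs⟩
  choose u hu using h
  exact ⟨u, hu⟩

end Concrete

end

end GarciaTower

/-! ### The theorem -/

theorem mainTheorem7
    {p a q j k : ℕ} (hp : p.Prime) (ha : 1 ≤ a) (hq : q = p ^ a)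
    (hj : 1 ≤ j) (hk : 1 ≤ k) (hjk : Nat.Coprime j k) (hpj : ¬ p ∣ j)
    {𝔽 K Ω : Type*} [Field 𝔽] [Finite 𝔽] (hcard : Nat.card 𝔽 = q ^ (j + k))
    [Field K] [Algebra 𝔽 K] [IsAlgClosure 𝔽 K]
    [Field Ω] [Algebra K Ω] (x : ℕ → Ω) (hx : GarciaTower.GeneratesTower K q j k x) :
    -- the elements `u_s` exist and are unique
    (∀ s ≥ 1, ∃! v : Ω, GarciaTower.IsUElement K q j k (x s) (x (s + 1)) v) ∧
    -- a place `P` of `F_{i+1}` that is a zero of `x₁` and a pole of `x₂`; the elements `u_s`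
    (∀ (i : ℕ) (hi : 1 ≤ i) (P : ValuationSubring (GarciaTower.towerField K x (i + 1))),
      GarciaTower.IsPlace K P →
      GarciaTower.IsZeroAt P (GarciaTower.towerElement K x (i + 1) 1 ⟨le_rfl, by omega⟩) →
      GarciaTower.IsPoleAt P (GarciaTower.towerElement K x (i + 1) 2 ⟨by omega, by omega⟩) →
      ∀ u : ℕ → GarciaTower.towerField K x (i + 1),
      (∀ s, 1 ≤ s → s ≤ i →
        GarciaTower.IsUElement K q j k (x s) (x (s + 1)) (u s : Ω)) →
      -- `z = z₂`, `H` is the completion of `K(z)`, `E` is the completion of `K(u₁)`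
      let z := -(GarciaTower.towerElement K x (i + 1) 2 ⟨by omega, by omega⟩) ^ (q ^ (j + k) - 1)
      let H := GarciaTower.hat P (IntermediateField.adjoin K {z})
      let E := GarciaTower.hat P (IntermediateField.adjoin K {u 1})
      let O := GarciaTower.complRing P
      (∃ t ∈ E, t ^ (q ^ j - 1) = (GarciaTower.toCompl P z)⁻¹) ∧
      ∀ t ∈ E, t ^ (q ^ j - 1) = (GarciaTower.toCompl P z)⁻¹ →
        let Ht := GarciaTower.adjoinElement H t
        let G := GarciaTower.gField H t (fun s => GarciaTower.toCompl P (u s))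
        -- `H(t) / H`
        GarciaTower.IsFiniteCyclic H Ht ∧
        GarciaTower.HasInvariants O H Ht (q ^ j - 1) (q ^ j - 1) (q ^ j - 2) ∧
        -- `E / H(t)`
        GarciaTower.IsFiniteGalois Ht E ∧
        GarciaTower.HasInvariants O Ht E (q ^ (k - 1)) (q ^ (k - 1)) (2 * (q ^ (k - 1) - 1)) ∧
        GarciaTower.IsWeaklyRamified p O Ht E ∧
        -- `G_s` lies in the completion of `E_s = K(u₁, …, u_s)`
        (∀ s, 1 ≤ s → s ≤ i →
          G s ≤ GarciaTower.hat P (IntermediateField.adjoin K (u '' Set.Icc 1 s))) ∧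
        -- `G_{s+1} / G_s`
        (∀ s, 1 ≤ s → s + 1 ≤ i →
          GarciaTower.IsFiniteGalois (G s) (G (s + 1)) ∧
          GarciaTower.HasInvariants O (G s) (G (s + 1)) (q ^ j) (q ^ j) (2 * (q ^ j - 1)) ∧
          GarciaTower.IsWeaklyRamified p O (G s) (G (s + 1)))) ∧
    -- the place `x₁ = 0` of `F₁` is `b₀`-bounded in the tower
    (∀ P₁ : ValuationSubring (GarciaTower.towerField K x 1),
      GarciaTower.IsPlace K P₁ →
      GarciaTower.IsZeroAt P₁ (GarciaTower.towerElement K x 1 1 ⟨le_rfl, le_rfl⟩) →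
      ∀ (i : ℕ) (hi : 1 ≤ i),
        GarciaTower.IsBounded P₁
          (IntermediateField.extendScalars (GarciaTower.towerField_mono K x hi))
          (((q : ℝ) ^ (j + k) - 1) / ((q : ℝ) ^ k - 1) + 1)) := by
  open GarciaTower in
  have hp' : Fact p.Prime := ⟨hp⟩
  have hF : CharP 𝔽 p := charP_of_card (m := a * (j + k)) (by rw [hcard, hq, pow_mul])
  have hK : IsAlgClosed K := IsAlgClosure.isAlgClosed 𝔽
  have hcK : CharP K p := (algebraMap 𝔽 K).charP_iff (algebraMap 𝔽 K).injective p |>.1 hF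
  have hcΩ : CharP Ω p := (algebraMap K Ω).charP_iff (algebraMap K Ω).injective p |>.1 hcK
  refine ⟨fun s hs ↦ existsUnique_isUElement hq ha hj hk hjk hpj hx hs, ?_, ?_⟩
  · intro i hi P hP hzero hpole u hu
    obtain ⟨y, hy, hgen⟩ := exists_generators (N := i + 1) (towerField K x (i + 1)).val
      (IntermediateField.fieldRange_val _)
    have h1 : towerElement K x (i + 1) 1 ⟨le_rfl, by omega⟩ = y 1 :=
      Subtype.ext (hy 1 le_rfl (by omega)).symm
    have h2 : towerElement K x (i + 1) 2 ⟨by omega, by omega⟩ = y 2 :=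
      Subtype.ext (hy 2 (by omega) (by omega)).symm
    rw [h1] at hzero
    rw [h2] at hpole ⊢
    refine completed_tower_of_place hq ha hj hk hjk hpj hi (fun s hs hsi ↦ ?_) hgen hP.1 hzero hpole
    refine TowerRelation.of_map (towerField K x (i + 1)).val.toRingHom ?_
    have h3 := (hu s hs (by omega)).towerRelation hq ha hj hk hx hs
    rw [← hy s hs (by omega), ← hy (s + 1) (by omega) (by omega)] at h3
    exact h3
  · intro P₁ hP hzero i hi
    set F' := IntermediateField.extendScalars (towerField_mono K x hi)
    intro P hPP
    let ι : F' →ₐ[K] Ω := F'.val.restrictScalars K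
    have hι : ι.fieldRange = towerField K x i := by
      ext b
      exact ⟨fun ⟨w, hw⟩ ↦ hw ▸ w.2, fun hb ↦ ⟨⟨b, hb⟩, rfl⟩⟩
    obtain ⟨y, hy, hgen⟩ := exists_generators ι hι
    obtain ⟨u, hu⟩ := exists_u_elements hq ha hj hk ι hι hjk hpj hx hy
    set ξ := towerElement K x 1 1 ⟨le_rfl, le_rfl⟩ with hξdef
    have hξ : IntermediateField.adjoin K {ξ} = ⊤ := by
      apply IntermediateField.lift_injective
      rw [IntermediateField.lift_adjoin_simple, IntermediateField.lift_top]
      change IntermediateField.adjoin K {x 1} = IntermediateField.adjoin K (x '' Set.Icc 1 1)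
      rw [Set.Icc_self, Set.image_singleton]
    have hξ0 : ξ ≠ 0 := fun h0 ↦ hx.ne_zero hq ha hj hk le_rfl (congrArg Subtype.val h0)
    have hy1 : algebraMap (towerField K x 1) F' ξ = y 1 := Subtype.ext (hy 1 le_rfl hi).symm
    refine bound_of_place hq ha hj hk hjk hpj hξ hξ0 hy1 hu hgen (fun c ↦ ?_) ?_
    · have h1 := hP.1 c
      rw [← hPP] at h1
      exact h1
    -- If x_1 did not vanish at the upper place, its inverse would belong to the valuation ring
    -- below, where x_1 vanishes.
    · by_contra! h0
      have hv0 : P.valuation (y 1) ≠ 0 := (zero_lt_one.trans_le h0).ne'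
      have h1 : ξ⁻¹ ∈ P₁ := by
        rw [← hPP, ValuationSubring.mem_comap, ← P.valuation_le_one_iff, map_inv₀, map_inv₀, hy1]
        exact inv_le_one_of_one_le₀ h0
      rw [← P₁.valuation_le_one_iff, map_inv₀] at h1
      have h2 := one_lt_inv₀ ((Valuation.pos_iff _).2 hξ0) |>.2 hzero
      exact absurd h1 (not_le.2 h2)
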